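/- Consider the nearest-neighbour Ising model on the square lattice $\mathbb{Z}^2$ with Hamiltonian $-\sum_{\{x,y\}} S_xS_y$ and zero external field. Let $\beta_c$ be its critical inverse temperature, i.e. the supremum of those $\beta\ge 0$ for which the infinite-volume Gibbs distribution in zero field is unique. Let $\langle\cdot\rangle_c$ be the infinite-volume state at $\beta_c$ (the limit, along the boxes $[-n,n]^2$, of the Gibbs distributions with free boundary conditions), and let $\tau_c(y-x)=\langle S_xS_y\rangle_c$. Let $P$ be the corresponding critical FK (random-cluster) measure on the bonds of $\mathbb{Z}^2$, with $q=2$ and $p=1-e^{-2\beta_c}$ (the limit along the same boxes of the FK measures with free boundary conditions). For $r\ge 0$ let $B(r)=\{y\in\mathbb{Z}^2:\|y\|\le r\}$, with $\|\cdot\|$ the Euclidean norm. Let $\partial B(r)$ be the set of sites of $B(r)$ that have a nearest neighbour outside $B(r)$, and let $P^W_{\partial B(r)}$ be the FK measure with $q=2$ and $p=1-e^{-2\beta_c}$ on the bonds inside $B(r)$ with wired boundary condition on $\partial B(r)$, i.e. all sites of $\partial B(r)$ are identified when clusters are counted. For $a>0$, $x\in\mathbb{R}^2$ and $0<r_1<r_2<\infty$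 let $p^a_{FK}(x;r_1,r_2)$ be the $P$-probability that the configuration, drawn on the rescaled lattice $a\mathbb{Z}^2$, has a circuit of open bonds that is contained in the annulus $\{z\in\mathbb{R}^2: r_1\le\|z-x\|\le r_2\}$ and surrounds its centre $x$. Assume the RSW lower bound: for every $x\in\mathbb{R}^2$ there are $0<r_1<r_2<\infty$ with $$\liminf_{a\to 0}\, p^a_{FK}(x;r_1,r_2)>0 .$$ Then there is a constant $K>0$ such that for all $x,y\in\mathbb{Z}^2$ $$\tau_c(y-x)\;\ge\; K\; P^W_{\partial B(\|x-y\|/3)}\bigl(0\leftrightarrow\partial B(\|x-y\|/3)\bigr)^2 ,$$ where $0\leftrightarrow\partial B(r)$ is the event that $0$ is connected to some site of $\partial B(r)$ by a path of open bonds. -/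

import Mathlib

open Filter Topology MeasureTheory

namespace FKIsing

noncomputable section

/-! ### The square lattice -/

/-- Sites of the square lattice. -/
abbrev Site : Type := ℤ × ℤ

/-- The Euclidean plane. -/
abbrev Plane : Type := EuclideanSpace ℝ (Fin 2)

/-- The embedding of the square lattice in the Euclidean plane. -/
def toPlane (v : Site) : Plane := !₂[(v.1 : ℝ), (v.2 : ℝ)]

/-- The nearest-neighbour graph of the square lattice. -/
def squareLattice : SimpleGraph Site where
  Adj u v := |u.1 - v.1| + |u.2 - v.2| = 1
  symm := ⟨fun u v h => by rw [abs_sub_comm v.1, abs_sub_comm v.2]; exact h⟩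
  loopless := ⟨fun u h => by simp at h⟩

/-- Bonds: unordered pairs of nearest neighbours. -/
abbrev Bond : Type := {e : Sym2 Site // e ∈ squareLattice.edgeSet}

/-- The square box `[-n, n]²`. -/
def box (n : ℕ) : Finset Site := Finset.Icc (-(n : ℤ), -(n : ℤ)) ((n : ℤ), (n : ℤ))

open Classical in
/-- The bonds with both endpoints in `Λ`. -/
def bondsIn (Λ : Finset Site) : Finset Bond :=
  Λ.sym2.subtype (· ∈ squareLattice.edgeSet)

open Classical in
/-- The bonds with at least one endpoint in `Λ`. -/
def bondsTouching (Λ : Finset Site) : Finset Bond :=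
  (bondsIn (Λ.biUnion fun v => Finset.Icc (v - 1) (v + 1))).filter fun e => ∃ v ∈ Λ, v ∈ e.1

open Classical in
/-- The lattice disc `B(r)` of Euclidean radius `r` centred at the origin. -/
def disc (r : ℝ) : Finset Site := (box ⌈r⌉₊).filter fun y => ‖toPlane y‖ ≤ r

theorem mem_disc (r : ℝ) (y : Site) : y ∈ disc r ↔ ‖toPlane y‖ ≤ r := by
  classical
  simp only [disc, Finset.mem_filter, and_iff_right_iff_imp]
  intro h
  have key : ∀ k : ℤ, |(k : ℝ)| ≤ ‖toPlane y‖ → -(⌈r⌉₊ : ℤ) ≤ k ∧ k ≤ (⌈r⌉₊ : ℤ) := by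
    intro k hk
    have h1 : |(k : ℝ)| ≤ (⌈r⌉₊ : ℝ) := hk.trans (h.trans (Nat.le_ceil r))
    rw [abs_le] at h1
    exact ⟨by exact_mod_cast h1.1, by exact_mod_cast h1.2⟩
  have h0 : |(y.1 : ℝ)| ≤ ‖toPlane y‖ := by
    simpa [toPlane] using PiLp.norm_apply_le (toPlane y) 0
  have h1 : |(y.2 : ℝ)| ≤ ‖toPlane y‖ := by
    simpa [toPlane] using PiLp.norm_apply_le (toPlane y) 1
  rw [box, Finset.mem_Icc]
  exact ⟨⟨(key _ h0).1, (key _ h1).1⟩, ⟨(key _ h0).2, (key _ h1).2⟩⟩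

open Classical in
/-- The (inner vertex) boundary of `Λ`: the sites of `Λ` with a nearest neighbour outside `Λ`. -/
def boundary (Λ : Finset Site) : Finset Site :=
  Λ.filter fun v => ∃ w, squareLattice.Adj v w ∧ w ∉ Λ

/-! ### The Ising model -/

/-- Spin configurations; a spin is a unit `1` or `-1` of `ℤ`. -/
abbrev SpinConfig : Type := Site → ℤˣ

/-- The spin `S_x` as a real number. -/
def spin (σ : SpinConfig) (x : Site) : ℝ := ((σ x : ℤ) : ℝ)

/-- The product `S_x S_y` of the spins at the endpoints of the bond `{x, y}`. -/
def bondSpin (σ : SpinConfig) (e : Bond) : ℝ := (e.1.map (spin σ)).mul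

/-- The Hamiltonian with interaction along the bonds in `E` and external field `h` on `Λ`. -/
def hamiltonian (h : ℝ) (Λ : Finset Site) (E : Finset Bond) (σ : SpinConfig) : ℝ :=
  -(∑ e ∈ E, bondSpin σ e) - h * ∑ x ∈ Λ, spin σ x

open Classical in
/-- The configuration equal to `s` in `Λ` and to `η` outside `Λ`. -/
def glue (Λ : Finset Site) (s : Λ → ℤˣ) (η : SpinConfig) : SpinConfig :=
  fun x => if hx : x ∈ Λ then s ⟨x, hx⟩ else η x

open Classical in
/-- The probability of the event `A` for the finite-volume Gibbs distribution in `Λ` with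
interaction along the bonds in `E`, the spins outside `Λ` being frozen to `η`. -/
def isingProb (β h : ℝ) (Λ : Finset Site) (E : Finset Bond) (η : SpinConfig)
    (A : Set SpinConfig) : ℝ :=
  (∑ s : Λ → ℤˣ, if glue Λ s η ∈ A then Real.exp (-β * hamiltonian h Λ E (glue Λ s η)) else 0) /
    ∑ s : Λ → ℤˣ, Real.exp (-β * hamiltonian h Λ E (glue Λ s η))

/-- Infinite-volume Gibbs distributions at inverse temperature `β` and external field `h`
(Dobrushin–Lanford–Ruelle equations). -/
def IsGibbs (β h : ℝ) (μ : Measure SpinConfig) : Prop :=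
  IsProbabilityMeasure μ ∧ ∀ (Λ : Finset Site) (A : Set SpinConfig), MeasurableSet A →
    μ.real A = ∫ η, isingProb β h Λ (bondsTouching Λ) η A ∂μ

/-- The critical inverse temperature: the threshold for uniqueness of the infinite-volume Gibbs
distribution in zero external field. -/
def betaC : ℝ :=
  sSup {β : ℝ | 0 ≤ β ∧
    ∀ μ ν : Measure SpinConfig, IsGibbs β 0 μ → IsGibbs β 0 ν → μ = ν}

/-- An event that depends on finitely many spins only. -/
def IsLocalSpinEvent (A : Set SpinConfig) : Prop :=
  ∃ D : Finset Site, ∀ σ σ' : SpinConfig, (∀ x ∈ D, σ x = σ' x) → (σ ∈ A ↔ σ' ∈ A)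

/-- `μ` is the thermodynamic limit (along the boxes `[-n, n]²`) of the Ising model with zero
external field and free boundary conditions at inverse temperature `β`. The spins outside the box
do not interact with those inside. -/
def IsIsingState (β : ℝ) (μ : Measure SpinConfig) : Prop :=
  IsProbabilityMeasure μ ∧ ∀ A : Set SpinConfig, IsLocalSpinEvent A →
    Tendsto (fun n : ℕ => isingProb β 0 (box n) (bondsIn (box n)) 1 A) atTop (𝓝 (μ.real A))

/-- The two-point correlation `⟨S_x S_y⟩`. -/
def twoPoint (μ : Measure SpinConfig) (x y : Site) : ℝ := ∫ σ, spin σ x * spin σ y ∂μ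

/-! ### The FK model -/

/-- Bond configurations, given as the set of open bonds. -/
abbrev BondConfig : Type := Set Bond

/-- The graph of open bonds; its connected components are the FK clusters. -/
def openGraph (ω : BondConfig) : SimpleGraph Site :=
  SimpleGraph.fromEdgeSet (Subtype.val '' ω)

/-- The graph of open bonds with all sites of `W` joined to each other. -/
def wiredGraph (W : Finset Site) (ω : BondConfig) : SimpleGraph Site :=
  openGraph ω ⊔ SimpleGraph.fromRel fun x y => x ∈ W ∧ y ∈ W

/-- The number of clusters in `Λ` when all sites of `W` are identified. -/
def numClusters (Λ W : Finset Site) (ω : BondConfig) : ℕ :=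
  Nat.card ((wiredGraph W ω).induce (Λ : Set Site)).ConnectedComponent

open Classical in
/-- The FK weight (with `q = 2`) of the configuration in `Λ` whose open bonds are those in `F`. -/
def fkWeight (p : ℝ) (Λ W : Finset Site) (F : Finset Bond) : ℝ :=
  p ^ F.card * (1 - p) ^ (bondsIn Λ \ F).card * 2 ^ numClusters Λ W (F : Set Bond)

open Classical in
/-- The probability of the event `A` for the FK measure (with `q = 2`) inside `Λ` at bond
density `p`, with the sites of `W` wired together. `W = ∅` is the free boundary condition. -/
def fkProb (p : ℝ) (Λ W : Finset Site) (A : Set BondConfig) : ℝ :=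
  (∑ F ∈ (bondsIn Λ).powerset, if (F : Set Bond) ∈ A then fkWeight p Λ W F else 0) /
    ∑ F ∈ (bondsIn Λ).powerset, fkWeight p Λ W F

/-- The critical bond density `1 - exp (-2 β_c)`. -/
def pC : ℝ := 1 - Real.exp (-2 * betaC)

/-- An event that depends on finitely many bonds only. -/
def IsLocalBondEvent (A : Set BondConfig) : Prop :=
  ∃ D : Finset Bond, ∀ ω ω' : BondConfig, (∀ e ∈ D, e ∈ ω ↔ e ∈ ω') → (ω ∈ A ↔ ω' ∈ A)

/-- `P` is the infinite-volume FK measure (with `q = 2`) at bond density `p`: the thermodynamic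
limit along the boxes `[-n, n]²` with free boundary conditions. -/
def IsFKMeasure (p : ℝ) (P : Measure BondConfig) : Prop :=
  IsProbabilityMeasure P ∧ ∀ A : Set BondConfig, IsLocalBondEvent A →
    Tendsto (fun n : ℕ => fkProb p (box n) ∅ A) atTop (𝓝 (P.real A))

/-- The event that `x` is connected to some site of `T` by a path of open bonds. -/
def connectedTo (x : Site) (T : Finset Site) : Set BondConfig :=
  {ω | ∃ y ∈ T, (openGraph ω).Reachable x y}

/-- The probability that `0` is connected to `∂B(r)` for the critical FK measure inside `B(r)`
with wired boundary condition on `∂B(r)`. -/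
def wiredOneArm (r : ℝ) : ℝ :=
  fkProb pC (disc r) (boundary (disc r)) (connectedTo 0 (boundary (disc r)))

/-! ### Open circuits in annuli -/

/-- The closed annulus with radii `r₁ ≤ r₂` centred at `x`. -/
def annulus (x : Plane) (r₁ r₂ : ℝ) : Set Plane := {z | r₁ ≤ dist z x ∧ dist z x ≤ r₂}

/-- The subset of the plane covered by a lattice walk, drawn on the lattice of mesh `a`. -/
def trace (a : ℝ) {G : SimpleGraph Site} {u v : Site} (γ : G.Walk u v) : Set Plane :=
  ⋃ d ∈ γ.darts, segment ℝ (a • toPlane d.fst) (a • toPlane d.snd)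

/-- There is an open circuit in the lattice of mesh `a` that is contained in the annulus and
surrounds its centre `x` (hence, if `0 < r₁`, the inner disc): `x` lies in a bounded component of
the complement of the circuit. -/
def HasOpenCircuit (a : ℝ) (x : Plane) (r₁ r₂ : ℝ) (ω : BondConfig) : Prop :=
  ∃ (v : Site) (γ : (openGraph ω).Walk v v), γ.IsCycle ∧ trace a γ ⊆ annulus x r₁ r₂ ∧
    Bornology.IsBounded (connectedComponentIn (trace a γ)ᶜ x)

/-- The RSW lower bound: for every `x`, there are radii `0 < r₁ < r₂` such that the probability of
an open circuit in the annulus stays bounded away from `0` as the mesh `a` tends to `0`. -/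
def RSWLowerBound (P : Measure BondConfig) : Prop :=
  ∀ x : Plane, ∃ r₁ r₂ : ℝ, 0 < r₁ ∧ r₁ < r₂ ∧
    0 < liminf (fun a : ℝ => P.real {ω | HasOpenCircuit a x r₁ r₂ ω}) (𝓝[>] 0)

end

end FKIsing

/-! By the Edwards–Sokal coupling the spin correlation in a free box equals the FK probability that
`x` and `y` are connected. Hence the two-point function is a limit of such probabilities
(`tendsto_fkProb_twoPoint`), and they have to be bounded below in all large free boxes. By positive
association (`fkProb_inter`) it suffices to force the connection by increasing events whose
probabilities are bounded below separately.

Rings. The RSW bound, used at the centre `0` only and with the mesh playing the role of the scale,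
gives at each large scale `k` an open circuit between sup-distances `k` and `m * k` with probability
at least `c`; monotonicity in the domain carries this to any centre. With `k` proportional to the
distance of `x` and `y`, a number of rings depending on `m` only is strung along the segment from
`x` to `y`. Consecutive rings surround a common site, so they meet or are nested. The two end rings
are taken larger, so that no other ring of the chain surrounds them; then the first and the last
ring are connected (`reachable_of_rings`).

Arms. Open arms from `x` and from `y` that leave the end rings complete the connection. Their
probability is compared with the wired one-arm probability in `fkProb_armEvent_ge`: explore the
closed dual paths that enter a box from outside. If a circuit shields the origin, the unexplored
region around it has a boundary that is open and connected, so given the exploration the model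
inside is wired. This region lies inside `B(r)`, hence the conditional law dominates the wired
measure of `B(r)`, and there an arm to `∂B(r)` must reach the boundary of the region. The price is
one more factor `c` per arm.

All the domination statements come from the four functions theorem, whose hypothesis reduces to a
comparison of how many clusters are lost when bonds are added (`clusterCount_compare`). Bounded
distances are treated by finiteness, `pC` being positive under the RSW bound. -/

namespace FKIsing

/-! ### Counting clusters -/

/-- A path using the new edge need use it only once, so the components of `G'` are those of `G` with
the ones of `u` and `v` merged. -/
theorem card_connectedComponent_of_add_edge {V : Type*} [Finite V] {G G' : SimpleGraph V} {u v : V}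
    (hle : G ≤ G') (huv : G'.Adj u v)
    (hstep : ∀ a b, G'.Adj a b → G.Adj a b ∨ (a = u ∧ b = v) ∨ (a = v ∧ b = u)) :
    (G.Reachable u v → Nat.card G'.ConnectedComponent = Nat.card G.ConnectedComponent) ∧
    (¬ G.Reachable u v → Nat.card G'.ConnectedComponent + 1 = Nat.card G.ConnectedComponent) := by
  have key : ∀ a b, G'.Reachable a b → G.Reachable a b ∨ (G.Reachable a u ∧ G.Reachable v b) ∨
      (G.Reachable a v ∧ G.Reachable u b) := by
    rintro a b ⟨p⟩
    induction p with
    | nil => exact Or.inl (SimpleGraph.Reachable.refl _)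
    | @cons a c b h p ih =>
      rcases hstep _ _ h with h | ⟨rfl, rfl⟩ | ⟨rfl, rfl⟩
      · rcases ih with ih | ⟨h1, h2⟩ | ⟨h1, h2⟩
        · exact Or.inl (h.reachable.trans ih)
        · exact Or.inr (Or.inl ⟨h.reachable.trans h1, h2⟩)
        · exact Or.inr (Or.inr ⟨h.reachable.trans h1, h2⟩)
      · rcases ih with ih | ⟨h1, h2⟩ | ⟨h1, h2⟩
        · exact Or.inr (Or.inl ⟨SimpleGraph.Reachable.refl _, ih⟩)
        · exact Or.inr (Or.inl ⟨SimpleGraph.Reachable.refl _, h2⟩)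
        · exact Or.inl h2
      · rcases ih with ih | ⟨h1, h2⟩ | ⟨h1, h2⟩
        · exact Or.inr (Or.inr ⟨SimpleGraph.Reachable.refl _, ih⟩)
        · exact Or.inl h2
        · exact Or.inr (Or.inr ⟨SimpleGraph.Reachable.refl _, h2⟩)
  have hsurj := SimpleGraph.ConnectedComponent.surjective_map_ofLE hle
  constructor
  · intro hr
    refine (Nat.card_congr (Equiv.ofBijective _ ⟨?_, hsurj⟩)).symm
    intro c d
    induction c using SimpleGraph.ConnectedComponent.ind with | _ a
    induction d using SimpleGraph.ConnectedComponent.ind with | _ b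
    intro h
    simp only [SimpleGraph.ConnectedComponent.map_mk, SimpleGraph.ConnectedComponent.eq] at h ⊢
    rcases key _ _ h with h | ⟨h1, h2⟩ | ⟨h1, h2⟩
    · exact h
    · exact h1.trans (hr.trans h2)
    · exact h1.trans (hr.symm.trans h2)
  · intro hr
    have hcard : Nat.card {c : G.ConnectedComponent // c ≠ G.connectedComponentMk u} + 1 =
        Nat.card G.ConnectedComponent := by
      classical
      have := Fintype.ofFinite G.ConnectedComponent
      rw [Nat.card_eq_fintype_card, Nat.card_eq_fintype_card, Fintype.card_subtype_compl,
        Fintype.card_subtype_eq]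
      have : 0 < Fintype.card G.ConnectedComponent :=
        Fintype.card_pos_iff.2 ⟨G.connectedComponentMk u⟩
      omega
    rw [← hcard]
    congr 1
    -- With the class of `u` removed the map to the components of `G'` is injective; it stays
    -- surjective because the class of `v` represents the merged component.
    refine (Nat.card_congr (Equiv.ofBijective
      (fun c : {c : G.ConnectedComponent // c ≠ G.connectedComponentMk u} =>
        c.1.map (SimpleGraph.Hom.ofLE hle)) ⟨?_, ?_⟩)).symm
    · rintro ⟨c, hc⟩ ⟨d, hd⟩
      induction c using SimpleGraph.ConnectedComponent.ind with | _ a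
      induction d using SimpleGraph.ConnectedComponent.ind with | _ b
      intro h
      simp only [SimpleGraph.ConnectedComponent.map_mk, SimpleGraph.ConnectedComponent.eq,
        ne_eq, Subtype.mk.injEq] at h hc hd ⊢
      rcases key _ _ h with h | ⟨h1, h2⟩ | ⟨h1, h2⟩
      · exact h
      · exact absurd h1 hc
      · exact absurd h2.symm hd
    · intro d
      induction d using SimpleGraph.ConnectedComponent.ind with | _ b
      by_cases hb : G.Reachable b u
      · refine ⟨⟨G.connectedComponentMk v, fun h => hr ?_⟩, ?_⟩
        · exact (SimpleGraph.ConnectedComponent.eq.1 h).symm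
        · simp only [SimpleGraph.ConnectedComponent.map_mk, SimpleGraph.ConnectedComponent.eq]
          exact huv.symm.reachable.trans (hb.symm.mono hle)
      · exact ⟨⟨G.connectedComponentMk b, fun h => hb (SimpleGraph.ConnectedComponent.eq.1 h)⟩, rfl⟩

/-- The number of connected components of the restriction of `H` to `Λ`. -/
noncomputable def clusterCount (Λ : Finset Site) (H : SimpleGraph Site) : ℕ :=
  Nat.card (H.induce (Λ : Set Site)).ConnectedComponent

theorem openGraph_adj {ω : BondConfig} {u v : Site} :
    (openGraph ω).Adj u v ↔ ∃ h : s(u, v) ∈ squareLattice.edgeSet, (⟨s(u, v), h⟩ : Bond) ∈ ω := by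
  simp only [openGraph, SimpleGraph.fromEdgeSet_adj, Set.mem_image, Subtype.exists,
    exists_and_right, exists_eq_right, and_iff_left_iff_imp]
  rintro ⟨h, -⟩
  exact SimpleGraph.Adj.ne (G := squareLattice) h

theorem openGraph_mono {ω ω' : BondConfig} (h : ω ⊆ ω') : openGraph ω ≤ openGraph ω' := by
  intro u v huv
  rw [openGraph_adj] at huv ⊢
  exact ⟨huv.1, h huv.2⟩

theorem openGraph_le (ω : BondConfig) : openGraph ω ≤ squareLattice := by
  intro u v huv
  exact (openGraph_adj.1 huv).1

theorem openGraph_empty : openGraph ∅ = ⊥ := by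
  ext u v
  simp [openGraph_adj]

theorem openGraph_union (ω ω' : BondConfig) :
    openGraph (ω ∪ ω') = openGraph ω ⊔ openGraph ω' := by
  ext u v
  simp only [SimpleGraph.sup_adj, openGraph_adj, Set.mem_union]
  constructor
  · rintro ⟨h, h1 | h1⟩
    exacts [Or.inl ⟨h, h1⟩, Or.inr ⟨h, h1⟩]
  · rintro (⟨h, h1⟩ | ⟨h, h1⟩)
    exacts [⟨h, Or.inl h1⟩, ⟨h, Or.inr h1⟩]

theorem openGraph_insert_step {ω : BondConfig} {e : Bond} {u v : Site} (he : e.1 = s(u, v))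
    {a b : Site} (h : (openGraph (insert e ω)).Adj a b) :
    (openGraph ω).Adj a b ∨ (a = u ∧ b = v) ∨ (a = v ∧ b = u) := by
  obtain ⟨hab, h | h⟩ := openGraph_adj.1 h
  · right
    have : s(a, b) = s(u, v) := by rw [← he, ← h]
    simpa [Sym2.eq_iff] using this
  · exact Or.inl (openGraph_adj.2 ⟨hab, h⟩)

theorem mem_bondsIn {Λ : Finset Site} {e : Bond} : e ∈ bondsIn Λ ↔ ∀ v ∈ e.1, v ∈ Λ := by
  simp [bondsIn, Finset.mem_subtype, Finset.mem_sym2_iff]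

theorem adj_of_bond {e : Bond} {u v : Site} (he : e.1 = s(u, v)) : squareLattice.Adj u v := by
  have := e.2
  rwa [he] at this

/-- All edges of `H` join sites of `Λ`. -/
def SupportedIn (H : SimpleGraph Site) (Λ : Finset Site) : Prop :=
  ∀ u v, H.Adj u v → u ∈ Λ

theorem SupportedIn.sup {H H' : SimpleGraph Site} {Λ : Finset Site} (h : SupportedIn H Λ)
    (h' : SupportedIn H' Λ) : SupportedIn (H ⊔ H') Λ := by
  rintro u v (h1 | h1)
  exacts [h _ _ h1, h' _ _ h1]

theorem supportedIn_openGraph {Λ : Finset Site} {F : Finset Bond} (h : F ⊆ bondsIn Λ) :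
    SupportedIn (openGraph (F : Set Bond)) Λ := by
  intro u v huv
  obtain ⟨h1, h2⟩ := openGraph_adj.1 huv
  exact mem_bondsIn.1 (h h2) u (by simp)

theorem induce_reachable_iff {H : SimpleGraph Site} {Λ : Finset Site} (hH : SupportedIn H Λ)
    (u v : (Λ : Set Site)) :
    (H.induce (Λ : Set Site)).Reachable u v ↔ H.Reachable u v := by
  constructor
  · intro h
    exact h.map (SimpleGraph.Embedding.induce (G := H) (Λ : Set Site)).toHom
  · rintro ⟨p⟩
    obtain ⟨u, hu⟩ := u
    obtain ⟨v, hv⟩ := v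
    simp only at p
    induction p with
    | nil => exact SimpleGraph.Reachable.refl _
    | @cons a b c h p ih =>
      have hb : b ∈ Λ := hH _ _ h.symm
      have hadj : (H.induce (Λ : Set Site)).Adj ⟨a, hu⟩ ⟨b, hb⟩ := h
      exact hadj.reachable.trans (ih hb hv)

/-- As all edges lie in `Λ`, connections in the infinite graph and in its restriction to `Λ` agree,
so the finite count applies. -/
theorem clusterCount_add_edge {H H' : SimpleGraph Site} {Λ : Finset Site} {u v : Site}
    (hH : SupportedIn H Λ) (hH' : SupportedIn H' Λ) (hle : H ≤ H') (huv : H'.Adj u v)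
    (hstep : ∀ a b, H'.Adj a b → H.Adj a b ∨ (a = u ∧ b = v) ∨ (a = v ∧ b = u)) :
    (H.Reachable u v → clusterCount Λ H' = clusterCount Λ H) ∧
    (¬ H.Reachable u v → clusterCount Λ H' + 1 = clusterCount Λ H) := by
  have hu : u ∈ Λ := hH' _ _ huv
  have hv : v ∈ Λ := hH' _ _ huv.symm
  have := card_connectedComponent_of_add_edge (G := H.induce (Λ : Set Site))
    (G' := H'.induce (Λ : Set Site)) (u := ⟨u, hu⟩) (v := ⟨v, hv⟩)
    (fun _ _ hab => hle hab) huv (fun a b hab => by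
      simpa [Subtype.ext_iff] using hstep a b hab)
  rwa [induce_reachable_iff hH] at this

open Classical in
/-- If, whenever bonds of `D` are added one by one, the endpoints of the new bond are connected in
the first model as soon as they are connected in the second one, then adding `D` loses at most as
many clusters in the first model as in the second one. -/
theorem clusterCount_compare {Λ₁ Λ₂ : Finset Site} {H₁ H₂ : SimpleGraph Site}
    (hH₁ : SupportedIn H₁ Λ₁) (hH₂ : SupportedIn H₂ Λ₂) (D : Finset Bond)
    (hD₁ : D ⊆ bondsIn Λ₁) (hD₂ : D ⊆ bondsIn Λ₂)
    (hreach : ∀ G ⊆ D, ∀ e ∈ D, ∀ u v, e.1 = s(u, v) →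
      (H₂ ⊔ openGraph (G : Set Bond)).Reachable u v →
      (H₁ ⊔ openGraph (G : Set Bond)).Reachable u v) :
    clusterCount Λ₁ H₁ + clusterCount Λ₂ (H₂ ⊔ openGraph (D : Set Bond)) ≤
      clusterCount Λ₂ H₂ + clusterCount Λ₁ (H₁ ⊔ openGraph (D : Set Bond)) := by
  suffices h : ∀ G : Finset Bond, G ⊆ D →
      clusterCount Λ₁ H₁ + clusterCount Λ₂ (H₂ ⊔ openGraph (G : Set Bond)) ≤
      clusterCount Λ₂ H₂ + clusterCount Λ₁ (H₁ ⊔ openGraph (G : Set Bond)) from h D subset_rfl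
  intro G
  induction G using Finset.induction_on with
  | empty => intro _; simp [openGraph_empty, add_comm]
  | insert e G he ih =>
    intro hG
    have hGD : G ⊆ D := (Finset.subset_insert _ _).trans hG
    have heD : e ∈ D := hG (Finset.mem_insert_self _ _)
    have ih := ih hGD
    obtain ⟨u, v, huv⟩ : ∃ u v, e.1 = s(u, v) := by
      induction h : e.1 using Sym2.ind with | _ u v => exact ⟨u, v, rfl⟩
    have step : ∀ (Λ : Finset Site) (H : SimpleGraph Site), SupportedIn H Λ → D ⊆ bondsIn Λ →
        ((H ⊔ openGraph (G : Set Bond)).Reachable u v →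
          clusterCount Λ (H ⊔ openGraph ((insert e G : Finset Bond) : Set Bond)) =
          clusterCount Λ (H ⊔ openGraph (G : Set Bond))) ∧
        (¬ (H ⊔ openGraph (G : Set Bond)).Reachable u v →
          clusterCount Λ (H ⊔ openGraph ((insert e G : Finset Bond) : Set Bond)) + 1 =
          clusterCount Λ (H ⊔ openGraph (G : Set Bond))) := by
      intro Λ H hH hD
      refine clusterCount_add_edge (hH.sup (supportedIn_openGraph (hGD.trans hD)))
        (hH.sup (supportedIn_openGraph (hG.trans hD))) ?_ ?_ ?_
      · exact sup_le_sup_left (openGraph_mono (by simp)) _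
      · right
        rw [openGraph_adj]
        have := e.2
        rw [huv] at this
        refine ⟨this, ?_⟩
        have : (⟨s(u, v), this⟩ : Bond) = e := Subtype.ext huv.symm
        rw [this]; simp
      · rintro a b (h | h)
        · exact Or.inl (Or.inl h)
        · rw [Finset.coe_insert] at h
          rcases openGraph_insert_step huv h with h | h
          · exact Or.inl (Or.inr h)
          · exact Or.inr h
    have s1 := step Λ₁ H₁ hH₁ hD₁
    have s2 := step Λ₂ H₂ hH₂ hD₂
    have hr := hreach G hGD e heD u v huv
    by_cases h1 : (H₁ ⊔ openGraph (G : Set Bond)).Reachable u v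
    · have e1 := s1.1 h1
      by_cases h2 : (H₂ ⊔ openGraph (G : Set Bond)).Reachable u v
      · have e2 := s2.1 h2
        omega
      · have e2 := s2.2 h2
        omega
    · have e1 := s1.2 h1
      have e2 := s2.2 (fun h => h1 (hr h))
      omega

/-! ### Correlation inequalities for the FK model -/

/-- The four functions theorem for full sums over a power set. -/
theorem four_sums {α : Type*} [DecidableEq α] (E : Finset α) {f₁ f₂ f₃ f₄ : Finset α → ℝ}
    (h₁ : ∀ F, 0 ≤ f₁ F) (h₂ : ∀ F, 0 ≤ f₂ F) (h₃ : ∀ F, 0 ≤ f₃ F) (h₄ : ∀ F, 0 ≤ f₄ F)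
    (h : ∀ a ⊆ E, ∀ b ⊆ E, f₁ a * f₂ b ≤ f₃ (a ∩ b) * f₄ (a ∪ b)) :
    (∑ F ∈ E.powerset, f₁ F) * ∑ F ∈ E.powerset, f₂ F ≤
      (∑ F ∈ E.powerset, f₃ F) * ∑ F ∈ E.powerset, f₄ F := by
  refine (Finset.four_functions_theorem E h₁ h₂ h₃ h₄ (fun a ha b hb => h a ha b hb)
    subset_rfl subset_rfl).trans ?_
  have key : ∀ (S : Finset (Finset α)) (f : Finset α → ℝ), (∀ F, 0 ≤ f F) → S ⊆ E.powerset →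
      ∑ F ∈ S, f F ≤ ∑ F ∈ E.powerset, f F := fun S f hf hS =>
    Finset.sum_le_sum_of_subset_of_nonneg hS fun F _ _ => hf F
  refine mul_le_mul (key _ _ h₃ ?_) (key _ _ h₄ ?_) (Finset.sum_nonneg fun F _ => h₄ F)
    (Finset.sum_nonneg fun F _ => h₃ F)
  · intro F hF
    obtain ⟨a, ha, b, hb, rfl⟩ := Finset.mem_infs.1 hF
    rw [Finset.mem_powerset] at ha ⊢
    exact Finset.inter_subset_left.trans ha
  · intro F hF
    obtain ⟨a, ha, b, hb, rfl⟩ := Finset.mem_sups.1 hF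
    rw [Finset.mem_powerset] at ha hb ⊢
    exact Finset.union_subset ha hb

/-- The FK weight with the factor common to all configurations removed; `y = p / (1 - p)`. -/
noncomputable def relWeight (y : ℝ) (Λ W : Finset Site) (F : Finset Bond) : ℝ :=
  y ^ F.card * 2 ^ numClusters Λ W (F : Set Bond)

theorem relWeight_nonneg {y : ℝ} (hy : 0 ≤ y) (Λ W : Finset Site) (F : Finset Bond) :
    0 ≤ relWeight y Λ W F := by
  unfold relWeight; positivity

theorem relWeight_pos {y : ℝ} (hy : 0 < y) (Λ W : Finset Site) (F : Finset Bond) :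
    0 < relWeight y Λ W F := by
  unfold relWeight; positivity

theorem relWeight_empty_pos (y : ℝ) (Λ W : Finset Site) : 0 < relWeight y Λ W ∅ := by
  unfold relWeight; simp

theorem partition_pos {y : ℝ} (hy : 0 ≤ y) (Λ W : Finset Site) :
    0 < ∑ F ∈ (bondsIn Λ).powerset, relWeight y Λ W F :=
  Finset.sum_pos' (fun F _ => relWeight_nonneg hy Λ W F)
    ⟨∅, Finset.empty_mem_powerset _, relWeight_empty_pos y Λ W⟩

-- The factor `(1 - p) ^ |E|` is common to all configurations and cancels, which leaves weights that
-- need no complement of `F`.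
open Classical in
theorem fkProb_eq {p : ℝ} (hp : p < 1) (Λ W : Finset Site) (A : Set BondConfig) :
    fkProb p Λ W A =
      (∑ F ∈ (bondsIn Λ).powerset,
        if (F : Set Bond) ∈ A then relWeight (p / (1 - p)) Λ W F else 0) /
      ∑ F ∈ (bondsIn Λ).powerset, relWeight (p / (1 - p)) Λ W F := by
  have hq : 0 < 1 - p := by linarith
  have key : ∀ F ∈ (bondsIn Λ).powerset,
      fkWeight p Λ W F = (1 - p) ^ (bondsIn Λ).card * relWeight (p / (1 - p)) Λ W F := by
    intro F hF
    rw [Finset.mem_powerset] at hF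
    have hcard : (bondsIn Λ).card = F.card + (bondsIn Λ \ F).card := by
      rw [Finset.card_sdiff_of_subset hF]
      have := Finset.card_le_card hF
      omega
    rw [fkWeight, relWeight, hcard, pow_add, div_pow]
    field_simp
  have h1 : ∑ F ∈ (bondsIn Λ).powerset, fkWeight p Λ W F = (1 - p) ^ (bondsIn Λ).card *
      ∑ F ∈ (bondsIn Λ).powerset, relWeight (p / (1 - p)) Λ W F := by
    rw [Finset.mul_sum]
    exact Finset.sum_congr rfl key
  have h2 : (∑ F ∈ (bondsIn Λ).powerset,
        if (F : Set Bond) ∈ A then fkWeight p Λ W F else 0) = (1 - p) ^ (bondsIn Λ).card *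
      ∑ F ∈ (bondsIn Λ).powerset,
        if (F : Set Bond) ∈ A then relWeight (p / (1 - p)) Λ W F else 0 := by
    rw [Finset.mul_sum]
    refine Finset.sum_congr rfl fun F hF => ?_
    split_ifs
    · exact key F hF
    · simp
  rw [fkProb, h1, h2, mul_div_mul_left _ _ (by positivity)]

theorem fkProb_nonneg {p : ℝ} (hp0 : 0 ≤ p) (hp : p < 1) (Λ W : Finset Site)
    (A : Set BondConfig) : 0 ≤ fkProb p Λ W A := by
  classical
  have hy : 0 ≤ p / (1 - p) := div_nonneg hp0 (by linarith)
  rw [fkProb_eq hp]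
  refine div_nonneg (Finset.sum_nonneg fun F _ => ?_) (partition_pos hy Λ W).le
  split_ifs
  exacts [relWeight_nonneg hy _ _ _, le_rfl]

theorem fkProb_mono {p : ℝ} (hp0 : 0 ≤ p) (hp : p < 1) (Λ W : Finset Site)
    {A B : Set BondConfig}
    (h : ∀ F ⊆ bondsIn Λ, (F : Set Bond) ∈ A → (F : Set Bond) ∈ B) :
    fkProb p Λ W A ≤ fkProb p Λ W B := by
  classical
  have hy : 0 ≤ p / (1 - p) := div_nonneg hp0 (by linarith)
  rw [fkProb_eq hp, fkProb_eq hp]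
  refine div_le_div_of_nonneg_right (Finset.sum_le_sum fun F hF => ?_) (partition_pos hy Λ W).le
  have := h F (Finset.mem_powerset.1 hF)
  have := relWeight_nonneg hy Λ W F
  split_ifs <;> first | exact le_rfl | assumption | tauto

theorem fkProb_univ {p : ℝ} (hp0 : 0 ≤ p) (hp : p < 1) (Λ W : Finset Site) :
    fkProb p Λ W Set.univ = 1 := by
  have hy : 0 ≤ p / (1 - p) := div_nonneg hp0 (by linarith)
  rw [fkProb_eq hp]
  simp only [Set.mem_univ, if_true]
  exact div_self (partition_pos hy Λ W).ne'

theorem fkProb_le_one {p : ℝ} (hp0 : 0 ≤ p) (hp : p < 1) (Λ W : Finset Site)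
    (A : Set BondConfig) : fkProb p Λ W A ≤ 1 :=
  (fkProb_mono hp0 hp Λ W fun _ _ _ => Set.mem_univ _).trans_eq (fkProb_univ hp0 hp Λ W)

theorem fkProb_pos {p : ℝ} (hp0 : 0 < p) (hp : p < 1) (Λ W : Finset Site)
    {A : Set BondConfig} (hA : ((bondsIn Λ : Finset Bond) : Set Bond) ∈ A) :
    0 < fkProb p Λ W A := by
  classical
  have hy : 0 < p / (1 - p) := div_pos hp0 (by linarith)
  rw [fkProb_eq hp]
  refine div_pos (Finset.sum_pos' (fun F _ => ?_) ⟨bondsIn Λ, by simp, ?_⟩)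
    (partition_pos hy.le Λ W)
  · split_ifs
    exacts [relWeight_nonneg hy.le _ _ _, le_rfl]
  · rw [if_pos hA]
    exact relWeight_pos hy _ _ _

theorem wiredGraph_union (W : Finset Site) (ω ω' : BondConfig) :
    wiredGraph W (ω ∪ ω') = wiredGraph W ω ⊔ openGraph ω' := by
  rw [wiredGraph, wiredGraph, openGraph_union]
  ac_rfl

theorem wiredGraph_mono {W W' : Finset Site} (hW : W ⊆ W') {ω ω' : BondConfig} (h : ω ⊆ ω') :
    wiredGraph W ω ≤ wiredGraph W' ω' := by
  refine sup_le_sup (openGraph_mono h) ?_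
  intro u v huv
  rw [SimpleGraph.fromRel_adj] at huv ⊢
  refine ⟨huv.1, ?_⟩
  rcases huv.2 with h | h
  exacts [Or.inl ⟨hW h.1, hW h.2⟩, Or.inr ⟨hW h.1, hW h.2⟩]

theorem wiredGraph_empty (ω : BondConfig) : wiredGraph ∅ ω = openGraph ω := by
  ext u v
  simp [wiredGraph, SimpleGraph.fromRel_adj]

theorem supportedIn_wiredGraph {Λ W : Finset Site} (hW : W ⊆ Λ) {F : Finset Bond}
    (hF : F ⊆ bondsIn Λ) : SupportedIn (wiredGraph W (F : Set Bond)) Λ := by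
  refine (supportedIn_openGraph hF).sup ?_
  intro u v huv
  rw [SimpleGraph.fromRel_adj] at huv
  rcases huv.2 with h | h
  exacts [hW h.1, hW h.2]

theorem bondsIn_mono {Λ Λ' : Finset Site} (h : Λ ⊆ Λ') : bondsIn Λ ⊆ bondsIn Λ' := by
  intro e he
  rw [mem_bondsIn] at he ⊢
  exact fun v hv => h (he v hv)

-- Supermodularity of the cluster number: the bonds of `a \ b` merge at least as many clusters when
-- added to `a ∩ b` as when added to `b`, where the larger domain, wiring and configuration already
-- provide more connections.
open Classical in
theorem numClusters_compare {Λ₁ Λ₂ W₁ W₂ : Finset Site} (hΛ : Λ₂ ⊆ Λ₁) (hW : W₂ ⊆ W₁)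
    (hW₁ : W₁ ⊆ Λ₁) (hW₂ : W₂ ⊆ Λ₂) {a b : Finset Bond} (ha : a ⊆ bondsIn Λ₂)
    (hb : b ⊆ bondsIn Λ₁) :
    numClusters Λ₂ W₂ (a : Set Bond) + numClusters Λ₁ W₁ (b : Set Bond) ≤
      numClusters Λ₂ W₂ ((a ∩ b : Finset Bond) : Set Bond) +
      numClusters Λ₁ W₁ ((a ∪ b : Finset Bond) : Set Bond) := by
  have hD : a \ b ⊆ bondsIn Λ₂ := Finset.sdiff_subset.trans ha
  have := clusterCount_compare (supportedIn_wiredGraph hW₁ hb)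
    (supportedIn_wiredGraph hW₂ (Finset.inter_subset_left.trans ha : a ∩ b ⊆ bondsIn Λ₂))
    (a \ b) (hD.trans (bondsIn_mono hΛ)) hD (fun G _ e _ u v _ hr =>
      hr.mono (sup_le_sup_right (wiredGraph_mono hW (by simp)) _))
  rw [← wiredGraph_union, ← wiredGraph_union, ← Finset.coe_union, ← Finset.coe_union] at this
  have e1 : a ∩ b ∪ a \ b = a := by ext; simp; tauto
  have e2 : b ∪ a \ b = a ∪ b := by ext; simp; tauto
  rw [e1, e2] at this
  simp only [numClusters]
  simp only [clusterCount] at this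
  omega

-- The hypothesis of the four functions theorem: the bond factors balance, and the cluster factors
-- are compared by supermodularity. Equal domains give positive association, different ones
-- stochastic domination.
open Classical in
theorem relWeight_lattice {y : ℝ} (hy : 0 ≤ y) {Λ₁ Λ₂ W₁ W₂ : Finset Site} (hΛ : Λ₂ ⊆ Λ₁)
    (hW : W₂ ⊆ W₁) (hW₁ : W₁ ⊆ Λ₁) (hW₂ : W₂ ⊆ Λ₂) {a b : Finset Bond} (ha : a ⊆ bondsIn Λ₂)
    (hb : b ⊆ bondsIn Λ₁) :
    relWeight y Λ₂ W₂ a * relWeight y Λ₁ W₁ b ≤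
      relWeight y Λ₂ W₂ (a ∩ b) * relWeight y Λ₁ W₁ (a ∪ b) := by
  have h := numClusters_compare hΛ hW hW₁ hW₂ ha hb
  have hc := Finset.card_inter_add_card_union a b
  unfold relWeight
  rw [mul_mul_mul_comm, ← pow_add, ← pow_add, mul_mul_mul_comm, ← pow_add, ← pow_add, hc]
  exact mul_le_mul_of_nonneg_left (pow_le_pow_right₀ (by norm_num) h) (by positivity)

/-- Positive association of the FK model. -/
theorem fkProb_inter {p : ℝ} (hp0 : 0 ≤ p) (hp : p < 1) {Λ W : Finset Site} (hW : W ⊆ Λ)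
    {A B : Set BondConfig} (hA : IsUpperSet A) (hB : IsUpperSet B) :
    fkProb p Λ W A * fkProb p Λ W B ≤ fkProb p Λ W (A ∩ B) := by
  classical
  have hy : 0 ≤ p / (1 - p) := div_nonneg hp0 (by linarith)
  have hZ := partition_pos hy Λ W
  have hn : ∀ (C : Set BondConfig) (F : Finset Bond),
      0 ≤ if (F : Set Bond) ∈ C then relWeight (p / (1 - p)) Λ W F else 0 := by
    intro C F
    split_ifs
    exacts [relWeight_nonneg hy _ _ _, le_rfl]
  rw [fkProb_eq hp, fkProb_eq hp, fkProb_eq hp, div_mul_div_comm, div_le_div_iff₀ (by positivity) hZ]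
  -- The union of a configuration in `A` and one in `B` lies in both events, so the indicators sit
  -- on the first, second and fourth functions.
  have := four_sums (bondsIn Λ) (hn A) (hn B) (relWeight_nonneg hy Λ W) (hn (A ∩ B)) (by
    intro a ha b hb
    have hl := relWeight_lattice hy subset_rfl subset_rfl hW hW ha hb
    by_cases h1 : (a : Set Bond) ∈ A
    · by_cases h2 : (b : Set Bond) ∈ B
      · rw [if_pos h1, if_pos h2, if_pos]
        · exact hl
        · exact ⟨hA (by simp) h1, hB (by simp) h2⟩
      · rw [if_neg h2, mul_zero]
        exact mul_nonneg (relWeight_nonneg hy _ _ _) (hn _ _)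
    · rw [if_neg h1, zero_mul]
      exact mul_nonneg (relWeight_nonneg hy _ _ _) (hn _ _))
  nlinarith [this, hZ]

theorem fkProb_biInter {p : ℝ} (hp0 : 0 ≤ p) (hp : p < 1) {Λ W : Finset Site} (hW : W ⊆ Λ)
    {A : ℕ → Set BondConfig} (hA : ∀ i, IsUpperSet (A i)) {c : ℝ} (hc : 0 ≤ c) {N : ℕ}
    (h : ∀ i ∈ Finset.range N, c ≤ fkProb p Λ W (A i)) :
    c ^ N ≤ fkProb p Λ W (⋂ i ∈ Finset.range N, A i) := by
  induction N with
  | zero => simp [fkProb_univ hp0 hp]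
  | succ N ih =>
    have hup : IsUpperSet (⋂ i ∈ Finset.range N, A i) :=
      isUpperSet_iInter₂ fun i _ => hA i
    have e : (⋂ i ∈ Finset.range (N + 1), A i) = (⋂ i ∈ Finset.range N, A i) ∩ A N := by
      rw [Finset.range_add_one, Finset.set_biInter_insert, Set.inter_comm]
    rw [e, pow_succ]
    have ih := ih fun i hi => h i (Finset.mem_range.2 ((Finset.mem_range.1 hi).trans N.lt_succ_self))
    exact (mul_le_mul ih (h N (Finset.self_mem_range_succ N)) hc (fkProb_nonneg hp0 hp _ _ _)).trans
      (fkProb_inter hp0 hp hW hup (hA N))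

/-- Monotonicity in the domain and the boundary condition. -/
theorem fkProb_le_of_subset {p : ℝ} (hp0 : 0 ≤ p) (hp : p < 1) {Λ₁ Λ₂ W₁ W₂ : Finset Site}
    (hΛ : Λ₂ ⊆ Λ₁) (hW : W₂ ⊆ W₁) (hW₁ : W₁ ⊆ Λ₁) (hW₂ : W₂ ⊆ Λ₂)
    {A : Set BondConfig} (hA : IsUpperSet A) :
    fkProb p Λ₂ W₂ A ≤ fkProb p Λ₁ W₁ A := by
  classical
  have hy : 0 ≤ p / (1 - p) := div_nonneg hp0 (by linarith)
  have hZ₁ := partition_pos hy Λ₁ W₁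
  have hZ₂ := partition_pos hy Λ₂ W₂
  set y := p / (1 - p) with hy_def
  -- A configuration in `Λ₂` is read as one in `Λ₁` whose other bonds are closed; both models are
  -- then sums over the same power set.
  have hext : ∀ f : Finset Bond → ℝ, ∑ F ∈ (bondsIn Λ₂).powerset, f F =
      ∑ F ∈ (bondsIn Λ₁).powerset, if F ⊆ bondsIn Λ₂ then f F else 0 := by
    intro f
    rw [← Finset.sum_filter]
    refine Finset.sum_congr ?_ fun _ _ => rfl
    ext F
    simp only [Finset.mem_powerset, Finset.mem_filter]
    exact ⟨fun h => ⟨h.trans (bondsIn_mono hΛ), h⟩, fun h => h.2⟩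
  rw [fkProb_eq hp, fkProb_eq hp, ← hy_def, div_le_div_iff₀ hZ₂ hZ₁, hext, hext]
  refine le_of_le_of_eq ?_ (mul_comm _ _)
  refine four_sums (bondsIn Λ₁) ?_ (relWeight_nonneg hy Λ₁ W₁) ?_ ?_ ?_
  · intro F
    split_ifs <;> first | exact relWeight_nonneg hy _ _ _ | exact le_rfl
  · intro F
    split_ifs <;> first | exact relWeight_nonneg hy _ _ _ | exact le_rfl
  · intro F
    split_ifs <;> first | exact relWeight_nonneg hy _ _ _ | exact le_rfl
  · intro a ha b hb
    by_cases h1 : a ⊆ bondsIn Λ₂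
    · by_cases h2 : (a : Set Bond) ∈ A
      · have h3 : ((a ∪ b : Finset Bond) : Set Bond) ∈ A := hA (by simp) h2
        rw [if_pos h1, if_pos h2, if_pos (Finset.inter_subset_left.trans h1), if_pos h3]
        exact relWeight_lattice hy hΛ hW hW₁ hW₂ h1 hb
      · rw [if_pos h1, if_neg h2, zero_mul, if_pos (Finset.inter_subset_left.trans h1)]
        refine mul_nonneg (relWeight_nonneg hy _ _ _) ?_
        split_ifs <;> first | exact relWeight_nonneg hy _ _ _ | exact le_rfl
    · rw [if_neg h1, zero_mul]
      refine mul_nonneg ?_ ?_ <;>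
      split_ifs <;> first | exact relWeight_nonneg hy _ _ _ | exact le_rfl

/-! ### Translations -/

theorem squareLattice_adj_add (z : Site) {u v : Site} :
    squareLattice.Adj (u + z) (v + z) ↔ squareLattice.Adj u v := by
  simp [squareLattice]

/-- Translation of bonds by `z`. -/
def shiftBond (z : Site) (e : Bond) : Bond :=
  ⟨e.1.map (· + z), by
    obtain ⟨e, he⟩ := e
    induction e using Sym2.ind with | _ u v
    exact (squareLattice_adj_add z).2 he⟩

theorem shiftBond_neg (z : Site) (e : Bond) : shiftBond (-z) (shiftBond z e) = e := by
  obtain ⟨e, he⟩ := e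
  induction e using Sym2.ind with | _ u v
  refine Subtype.ext ?_
  simp [shiftBond]

theorem shiftBond_neg' (z : Site) (e : Bond) : shiftBond z (shiftBond (-z) e) = e := by
  simpa using shiftBond_neg (-z) e

/-- Translation of bonds by `z` as an equivalence. -/
def shiftEquiv (z : Site) : Bond ≃ Bond :=
  ⟨shiftBond z, shiftBond (-z), shiftBond_neg z, shiftBond_neg' z⟩

/-- The event `A` translated by `z`. -/
def shiftEvent (z : Site) (A : Set BondConfig) : Set BondConfig :=
  {ω | shiftBond z ⁻¹' ω ∈ A}

theorem IsUpperSet.shiftEvent {A : Set BondConfig} (hA : IsUpperSet A) (z : Site) :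
    IsUpperSet (shiftEvent z A) := fun _ _ h h1 => hA (Set.preimage_mono h) h1

theorem openGraph_shift_adj (z : Site) (ω : BondConfig) {u v : Site} :
    (openGraph (shiftBond z ⁻¹' ω)).Adj u v ↔ (openGraph ω).Adj (u + z) (v + z) := by
  simp only [openGraph_adj, Set.mem_preimage]
  constructor
  · rintro ⟨h, h1⟩
    exact ⟨(squareLattice_adj_add z).2 h, h1⟩
  · rintro ⟨h, h1⟩
    exact ⟨(squareLattice_adj_add z).1 h, h1⟩

theorem mem_bondsIn_shift {Λ Λ' : Finset Site} {z : Site} (hΛ : ∀ v, v + z ∈ Λ' ↔ v ∈ Λ)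
    (e : Bond) : shiftBond z e ∈ bondsIn Λ' ↔ e ∈ bondsIn Λ := by
  obtain ⟨e, he⟩ := e
  induction e using Sym2.ind with | _ u v
  simp [mem_bondsIn, shiftBond, hΛ]

/-- Translating configurations is a bijection that keeps the number of open bonds and induces an
isomorphism of the cluster graphs. -/
theorem fkProb_shift (p : ℝ) {Λ Λ' : Finset Site} {z : Site}
    (hΛ : ∀ v, v + z ∈ Λ' ↔ v ∈ Λ) (hp : p < 1) (A : Set BondConfig) :
    fkProb p Λ' ∅ (shiftEvent z A) = fkProb p Λ ∅ A := by
  classical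
  have hmap : ∀ F : Finset Bond, shiftBond z ⁻¹' ((F.map (shiftEquiv z).toEmbedding : Finset Bond) :
      Set Bond) = (F : Set Bond) := by
    intro F
    ext e
    simp only [Finset.coe_map, Set.mem_preimage, Set.mem_image, Finset.mem_coe]
    constructor
    · rintro ⟨e', he', h⟩
      exact (shiftEquiv z).injective h ▸ he'
    · intro h
      exact ⟨e, h, rfl⟩
  have hw : ∀ F : Finset Bond, relWeight (p / (1 - p)) Λ' ∅ (F.map (shiftEquiv z).toEmbedding) =
      relWeight (p / (1 - p)) Λ ∅ F := by
    intro F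
    rw [relWeight, relWeight, Finset.card_map]
    congr 2
    rw [numClusters, numClusters, wiredGraph_empty, wiredGraph_empty]
    refine (Nat.card_congr (SimpleGraph.Iso.connectedComponentEquiv ?_)).symm
    refine ⟨(Equiv.addRight z).subtypeEquiv fun v => ?_, ?_⟩
    · simpa using (hΛ v).symm
    · intro u v
      have := openGraph_shift_adj z ((F.map (shiftEquiv z).toEmbedding : Finset Bond) : Set Bond)
        (u := u) (v := v)
      rw [hmap] at this
      simpa using this.symm
  have hsum : ∀ f g : Finset Bond → ℝ, (∀ F, f (F.map (shiftEquiv z).toEmbedding) = g F) →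
      ∑ F ∈ (bondsIn Λ').powerset, f F = ∑ F ∈ (bondsIn Λ).powerset, g F := by
    intro f g hfg
    refine (Finset.sum_bij' (fun F _ => F.map (shiftEquiv z).toEmbedding)
      (fun F _ => F.map (shiftEquiv z).symm.toEmbedding) ?_ ?_ ?_ ?_ ?_).symm
    · intro F hF
      rw [Finset.mem_powerset] at hF ⊢
      intro e he
      obtain ⟨e', he', rfl⟩ := Finset.mem_map.1 he
      exact (mem_bondsIn_shift hΛ e').2 (hF he')
    · intro F hF
      rw [Finset.mem_powerset] at hF ⊢
      intro e he
      obtain ⟨e', he', rfl⟩ := Finset.mem_map.1 he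
      refine (mem_bondsIn_shift hΛ _).1 ?_
      have : shiftBond z ((shiftEquiv z).symm.toEmbedding e') = e' := shiftBond_neg' z e'
      rw [this]
      exact hF he'
    · intro F _
      rw [Finset.map_map]
      convert Finset.map_refl
      ext1 e
      exact shiftBond_neg z e
    · intro F _
      rw [Finset.map_map]
      convert Finset.map_refl
      ext1 e
      exact shiftBond_neg' z e
    · intro F _
      exact (hfg F).symm
  rw [fkProb_eq hp, fkProb_eq hp]
  congr 1
  · refine hsum _ _ fun F => ?_
    simp only [hw, shiftEvent, Set.mem_ofPred_eq, hmap]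
  · exact hsum _ _ hw

theorem mem_box {n : ℕ} {v : Site} : v ∈ box n ↔ |v.1| ≤ n ∧ |v.2| ≤ n := by
  rw [box, Finset.mem_Icc, abs_le, abs_le, Prod.le_def, Prod.le_def]
  tauto

/-- The translated box fits into the larger one, and free probabilities of increasing events grow
with the domain. This replaces translation invariance of the limit measure. -/
theorem fkProb_box_le_shift {p : ℝ} (hp0 : 0 ≤ p) (hp : p < 1) {m n : ℕ} {z : Site}
    (h1 : m + |z.1| ≤ n) (h2 : m + |z.2| ≤ n) {A : Set BondConfig} (hA : IsUpperSet A) :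
    fkProb p (box m) ∅ A ≤ fkProb p (box n) ∅ (shiftEvent z A) := by
  rw [← fkProb_shift p (Λ' := (box m).map (Equiv.addRight z).toEmbedding) (z := z) (by simp) hp]
  refine fkProb_le_of_subset hp0 hp ?_ subset_rfl (by simp) (by simp) (IsUpperSet.shiftEvent hA z)
  intro v hv
  obtain ⟨u, hu, rfl⟩ := Finset.mem_map.1 hv
  rw [mem_box] at hu ⊢
  have e1 := abs_add_le u.1 z.1
  have e2 := abs_add_le u.2 z.2
  constructor
  · show |u.1 + z.1| ≤ n
    omega
  · show |u.2 + z.2| ≤ n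
    omega

/-! ### The Edwards–Sokal coupling -/

/-- Spins that agree along edges are the same as functions on the set of components. -/
theorem card_constant_spins {V : Type*} [Finite V] (G : SimpleGraph V) :
    Nat.card {s : V → ℤˣ // ∀ u v, G.Adj u v → s u = s v} = 2 ^ Nat.card G.ConnectedComponent := by
  have key : ∀ s : V → ℤˣ, (∀ u v, G.Adj u v → s u = s v) →
      ∀ u v (p : G.Walk u v), p.IsPath → s u = s v := by
    intro s hs u v p _
    induction p with
    | nil => rfl
    | cons h p ih => exact (hs _ _ h).trans (ih (by simp_all [SimpleGraph.Walk.cons_isPath_iff]))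
  have e : {s : V → ℤˣ // ∀ u v, G.Adj u v → s u = s v} ≃ (G.ConnectedComponent → ℤˣ) :=
    { toFun := fun s => SimpleGraph.ConnectedComponent.lift s.1 (key s.1 s.2)
      invFun := fun t => ⟨fun v => t (G.connectedComponentMk v), fun u v h =>
        congrArg t (SimpleGraph.ConnectedComponent.sound h.reachable)⟩
      left_inv := fun s => rfl
      right_inv := fun t => by
        ext c
        induction c using SimpleGraph.ConnectedComponent.ind with | _ v
        rfl }
  rw [Nat.card_congr e, Nat.card_fun]
  simp

theorem sum_constant_spins (Λ : Finset Site) (H : SimpleGraph Site)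
    [DecidablePred fun s : Λ → ℤˣ => ∀ u v : Λ, H.Adj u v → s u = s v] :
    (∑ s : Λ → ℤˣ, if ∀ u v : Λ, H.Adj u v → s u = s v then (1 : ℝ) else 0) =
      2 ^ clusterCount Λ H := by
  rw [Finset.sum_boole, ← Fintype.card_subtype, ← Nat.card_eq_fintype_card]
  have := card_constant_spins (H.induce (Λ : Set Site))
  rw [clusterCount]
  exact_mod_cast this

theorem bondSpin_mk (σ : SpinConfig) {u v : Site} (h : s(u, v) ∈ squareLattice.edgeSet) :
    bondSpin σ ⟨s(u, v), h⟩ = spin σ u * spin σ v := rfl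

theorem spin_mul_spin (σ : SpinConfig) (u v : Site) :
    spin σ u * spin σ v = if σ u = σ v then 1 else -1 := by
  rcases Int.units_eq_one_or (σ u) with h | h <;> rcases Int.units_eq_one_or (σ v) with h' | h' <;>
    simp [spin, h, h', show ((-1 : ℤˣ) = 1) ↔ False by decide,
      show ((1 : ℤˣ) = -1) ↔ False by decide]

-- A spin product `s = ±1` satisfies `exp (β s) = exp (-β) ((exp (2β) - 1) 1[s = 1] + 1)`. Expanding
-- the product over bonds chooses the set `F` of open bonds, along which the spins must agree.
open Classical in
theorem exp_neg_hamiltonian (β : ℝ) (Λ : Finset Site) (E : Finset Bond) (σ : SpinConfig) :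
    Real.exp (-β * hamiltonian 0 Λ E σ) = Real.exp (-β) ^ E.card *
      ∑ F ∈ E.powerset, (Real.exp (2 * β) - 1) ^ F.card *
        if ∀ e ∈ F, bondSpin σ e = 1 then 1 else 0 := by
  have h1 : -β * hamiltonian 0 Λ E σ = ∑ e ∈ E, β * bondSpin σ e := by
    rw [hamiltonian, ← Finset.mul_sum]; ring
  have h2 : ∀ e ∈ E, Real.exp (β * bondSpin σ e) = Real.exp (-β) *
      ((Real.exp (2 * β) - 1) * (if bondSpin σ e = 1 then 1 else 0) + 1) := by
    rintro ⟨e, he⟩ -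
    induction e using Sym2.ind with | _ u v
    rw [bondSpin_mk, spin_mul_spin]
    split_ifs with h h' h'
    · rw [mul_one, mul_one, sub_add_cancel, ← Real.exp_add]; congr 1; ring
    · norm_num at h'
    · norm_num at h'
    · rw [mul_zero, zero_add, mul_one]; congr 1; ring
  rw [h1, Real.exp_sum, Finset.prod_congr rfl h2, Finset.prod_mul_distrib, Finset.prod_const,
    Finset.prod_add_one]
  congr 1
  refine Finset.sum_congr rfl fun F _ => ?_
  rw [Finset.prod_mul_distrib, Finset.prod_const, Finset.prod_boole]

open Classical in
theorem agree_iff {Λ : Finset Site} {F : Finset Bond} (hF : F ⊆ bondsIn Λ) (s : Λ → ℤˣ)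
    (η : SpinConfig) : (∀ e ∈ F, bondSpin (glue Λ s η) e = 1) ↔
      ∀ u v : Λ, (openGraph (F : Set Bond)).Adj u v → s u = s v := by
  have hg : ∀ u : Λ, glue Λ s η u = s u := fun u => by simp [glue]
  constructor
  · intro h u v huv
    obtain ⟨h1, h2⟩ := openGraph_adj.1 huv
    have := h _ h2
    rw [bondSpin_mk, spin_mul_spin, hg, hg] at this
    by_contra hne
    rw [if_neg hne] at this
    norm_num at this
  · rintro h ⟨e, he⟩ heF
    have hm := mem_bondsIn.1 (hF heF)
    induction e using Sym2.ind with | _ u v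
    have := h ⟨u, hm u (by simp)⟩ ⟨v, hm v (by simp)⟩ (openGraph_adj.2 ⟨he, heF⟩)
    rw [← hg, ← hg] at this
    rw [bondSpin_mk, spin_mul_spin, if_pos this]

/-- Identifies the FK odds `p / (1 - p)` with the coefficient in the expansion of the Gibbs weight.
-/
theorem one_sub_exp_div (β : ℝ) :
    (1 - Real.exp (-2 * β)) / (1 - (1 - Real.exp (-2 * β))) = Real.exp (2 * β) - 1 := by
  have h : Real.exp (-2 * β) = (Real.exp (2 * β))⁻¹ := by rw [← Real.exp_neg]; congr 1; ring
  have := Real.exp_pos (2 * β)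
  rw [h]
  field_simp
  ring

/-- Summing out the spins leaves a factor `2` per cluster. Asking for agreement at `x` and `y`
amounts to adding an edge between them, which halves the number of admissible spin configurations
unless the two sites are already connected. -/
theorem isingProb_eq_fkProb (β : ℝ) {Λ : Finset Site} (η : SpinConfig) {x y : Site}
    (hx : x ∈ Λ) (hy : y ∈ Λ) :
    2 * isingProb β 0 Λ (bondsIn Λ) η {σ | σ x = σ y} - 1 =
      fkProb (1 - Real.exp (-2 * β)) Λ ∅ (connectedTo x {y}) := by
  classical
  have hp : 1 - Real.exp (-2 * β) < 1 := by linarith [Real.exp_pos (-2 * β)]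
  rw [fkProb_eq hp, one_sub_exp_div]
  set t := Real.exp (2 * β) - 1 with ht
  have hg : ∀ (s : Λ → ℤˣ) (u : Site) (hu : u ∈ Λ), glue Λ s η u = s ⟨u, hu⟩ := fun s u hu => by
    simp [glue, hu]
  have hc : ∀ F : Finset Bond, clusterCount Λ (openGraph (F : Set Bond)) =
      numClusters Λ ∅ (F : Set Bond) := fun F => by
    rw [clusterCount, numClusters, wiredGraph_empty]
  have hZ : ∑ s : Λ → ℤˣ, Real.exp (-β * hamiltonian 0 Λ (bondsIn Λ) (glue Λ s η)) =
      Real.exp (-β) ^ (bondsIn Λ).card * ∑ F ∈ (bondsIn Λ).powerset, relWeight t Λ ∅ F := by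
    simp_rw [exp_neg_hamiltonian, ← Finset.mul_sum]
    rw [Finset.sum_comm]
    congr 1
    refine Finset.sum_congr rfl fun F hF => ?_
    rw [Finset.mem_powerset] at hF
    rw [← Finset.mul_sum, relWeight]
    simp_rw [agree_iff hF]
    rw [sum_constant_spins, hc]
  obtain ⟨A, hAdef⟩ : ∃ A, A = {σ : SpinConfig | σ x = σ y} := ⟨_, rfl⟩
  have hmem : ∀ s : Λ → ℤˣ, glue Λ s η ∈ A ↔ s ⟨x, hx⟩ = s ⟨y, hy⟩ := fun s => by
    rw [hAdef, Set.mem_ofPred_eq, hg s x hx, hg s y hy]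
  rw [← hAdef]
  have hA : 2 * (∑ s : Λ → ℤˣ, if glue Λ s η ∈ A then
        Real.exp (-β * hamiltonian 0 Λ (bondsIn Λ) (glue Λ s η)) else 0) =
      Real.exp (-β) ^ (bondsIn Λ).card * ∑ F ∈ (bondsIn Λ).powerset, (relWeight t Λ ∅ F +
        if (F : Set Bond) ∈ connectedTo x {y} then relWeight t Λ ∅ F else 0) := by
    have h1 : ∀ s : Λ → ℤˣ, (if glue Λ s η ∈ A then
        Real.exp (-β * hamiltonian 0 Λ (bondsIn Λ) (glue Λ s η)) else 0) =
        Real.exp (-β) ^ (bondsIn Λ).card * ∑ F ∈ (bondsIn Λ).powerset, t ^ F.card *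
        ((if ∀ e ∈ F, bondSpin (glue Λ s η) e = 1 then 1 else 0) *
          if s ⟨x, hx⟩ = s ⟨y, hy⟩ then 1 else 0) := by
      intro s
      rw [if_congr (hmem s) rfl rfl]
      split_ifs with h
      · rw [exp_neg_hamiltonian]; simp only [mul_one]; rfl
      · simp
    simp_rw [h1, ← Finset.mul_sum]
    rw [Finset.sum_comm, mul_left_comm]
    congr 1
    rw [Finset.mul_sum]
    refine Finset.sum_congr rfl fun F hF => ?_
    rw [Finset.mem_powerset] at hF
    rw [← Finset.mul_sum]
    have h2 : ∀ s : Λ → ℤˣ, ((if ∀ e ∈ F, bondSpin (glue Λ s η) e = 1 then (1 : ℝ) else 0) *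
          if s ⟨x, hx⟩ = s ⟨y, hy⟩ then 1 else 0) =
        if ∀ u v : Λ, (openGraph (F : Set Bond) ⊔ SimpleGraph.edge x y).Adj u v → s u = s v
          then 1 else 0 := by
      intro s
      rw [mul_ite, mul_one, mul_zero, ← ite_and]
      refine if_congr (and_comm.trans ?_) rfl rfl
      rw [agree_iff hF]
      constructor
      · rintro ⟨h3, h4⟩ ⟨u, hu⟩ ⟨v, hv⟩ (h | h)
        · exact h3 _ _ h
        · rw [SimpleGraph.edge_adj] at h
          rcases h.1 with ⟨rfl, rfl⟩ | ⟨rfl, rfl⟩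
          exacts [h4, h4.symm]
      · intro h
        refine ⟨fun u v huv => h u v (Or.inl huv), ?_⟩
        by_cases hxy : x = y
        · subst hxy; rfl
        · exact h ⟨x, hx⟩ ⟨y, hy⟩ (Or.inr (by rw [SimpleGraph.edge_adj]; simp [hxy]))
    simp_rw [h2]
    rw [sum_constant_spins, relWeight, ← hc]
    have hcon : (F : Set Bond) ∈ connectedTo x {y} ↔ (openGraph (F : Set Bond)).Reachable x y := by
      simp [connectedTo]
    rw [hcon]
    have hs := supportedIn_openGraph hF
    by_cases hxy : x = y
    · subst hxy
      rw [if_pos (SimpleGraph.Reachable.refl _), SimpleGraph.edge_self_eq_bot, sup_bot_eq]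
      ring
    · have hs' : SupportedIn (openGraph (F : Set Bond) ⊔ SimpleGraph.edge x y) Λ := by
        refine hs.sup fun u v huv => ?_
        rw [SimpleGraph.edge_adj] at huv
        rcases huv.1 with ⟨rfl, rfl⟩ | ⟨rfl, rfl⟩
        exacts [hx, hy]
      have hadd := clusterCount_add_edge hs hs' le_sup_left
        (u := x) (v := y) (Or.inr (by rw [SimpleGraph.edge_adj]; simp [hxy])) (by
          rintro a b (h | h)
          · exact Or.inl h
          · rw [SimpleGraph.edge_adj] at h
            exact Or.inr h.1)
      split_ifs with hr
      · rw [hadd.1 hr]; ring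
      · rw [← hadd.2 hr, pow_succ]; ring
  -- The sign of `β` is free. For negative `t` the FK weights may be negative, but their sum is a
  -- positive multiple of the Ising partition function.
  have hpos : 0 < ∑ F ∈ (bondsIn Λ).powerset, relWeight t Λ ∅ F := by
    by_cases h0 : 0 ≤ t
    · exact partition_pos h0 Λ ∅
    · have : 0 < ∑ s : Λ → ℤˣ, Real.exp (-β * hamiltonian 0 Λ (bondsIn Λ) (glue Λ s η)) :=
        Finset.sum_pos (fun s _ => Real.exp_pos _) Finset.univ_nonempty
      rw [hZ] at this
      exact pos_of_mul_pos_right this (by positivity)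
  have he : 0 < Real.exp (-β) ^ (bondsIn Λ).card := by positivity
  rw [isingProb, ← mul_div_assoc, hA, hZ, mul_div_mul_left _ _ he.ne', Finset.sum_add_distrib,
    add_div, div_self hpos.ne']
  ring

theorem measurable_spin (x : Site) : Measurable fun σ : SpinConfig => spin σ x := by
  have h1 : Measurable fun σ : SpinConfig => ((σ x : ℤˣ) : ℤ) :=
    (comap_measurable Units.val).comp (measurable_pi_apply x)
  exact (measurable_from_top (f := fun k : ℤ => (k : ℝ))).comp h1

/-- The two-point function is the limit of the FK connection probabilities. -/
theorem tendsto_fkProb_twoPoint {β : ℝ} {μ : Measure SpinConfig} (hμ : IsIsingState β μ)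
    (x y : Site) :
    Tendsto (fun n : ℕ => fkProb (1 - Real.exp (-2 * β)) (box n) ∅ (connectedTo x {y})) atTop
      (𝓝 (twoPoint μ x y)) := by
  classical
  obtain ⟨hprob, hlim⟩ := hμ
  have hmeas : MeasurableSet {σ : SpinConfig | σ x = σ y} := by
    have : {σ : SpinConfig | σ x = σ y} = {σ | spin σ x = spin σ y} := by
      ext σ
      simp [spin, Units.ext_iff]
    rw [this]
    exact measurableSet_eq_fun (measurable_spin x) (measurable_spin y)
  have hint : twoPoint μ x y = 2 * μ.real {σ : SpinConfig | σ x = σ y} - 1 := by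
    have h1 : ∀ σ : SpinConfig, spin σ x * spin σ y =
        2 * ({σ : SpinConfig | σ x = σ y}.indicator 1 σ) - 1 := by
      intro σ
      rw [spin_mul_spin, Set.indicator_apply]
      simp only [Set.mem_ofPred_eq]
      split_ifs <;> norm_num
    rw [twoPoint]
    simp_rw [h1]
    have hi : Integrable ({σ : SpinConfig | σ x = σ y}.indicator (1 : SpinConfig → ℝ)) μ :=
      (integrable_const (1 : ℝ)).indicator hmeas
    rw [integral_sub (hi.const_mul 2) (integrable_const _), integral_const_mul,
      integral_indicator_one hmeas]
    simp
  rw [hint]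
  have hl := (hlim {σ | σ x = σ y} ⟨{x, y}, fun σ σ' h => by
    simp [h x (by simp), h y (by simp)]⟩).const_mul 2 |>.sub_const 1
  refine hl.congr' ?_
  have hev : ∀ z : Site, ∀ᶠ n : ℕ in atTop, z ∈ box n := by
    intro z
    filter_upwards [eventually_ge_atTop (max z.1.natAbs z.2.natAbs)] with n hn
    rw [mem_box, abs_le, abs_le]
    omega
  filter_upwards [hev x, hev y] with n hx hy
  exact isingProb_eq_fkProb β 1 hx hy

/-! ### Bonds and faces -/

theorem hadj (i j : ℤ) : squareLattice.Adj (i, j) (i + 1, j) := by simp [squareLattice]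

theorem vadj (i j : ℤ) : squareLattice.Adj (i, j) (i, j + 1) := by simp [squareLattice]

/-- The horizontal bond with left endpoint `(i, j)`. -/
def hb (i j : ℤ) : Bond := ⟨s((i, j), (i + 1, j)), hadj i j⟩

/-- The vertical bond with lower endpoint `(i, j)`. -/
def vb (i j : ℤ) : Bond := ⟨s((i, j), (i, j + 1)), vadj i j⟩

theorem adj_cases {u v : Site} (h : squareLattice.Adj u v) :
    (∃ i j, u = (i, j) ∧ v = (i + 1, j)) ∨ (∃ i j, v = (i, j) ∧ u = (i + 1, j)) ∨
    (∃ i j, u = (i, j) ∧ v = (i, j + 1)) ∨ (∃ i j, v = (i, j) ∧ u = (i, j + 1)) := by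
  obtain ⟨u1, u2⟩ := u
  obtain ⟨v1, v2⟩ := v
  simp only [squareLattice] at h
  simp only [Prod.mk.injEq]
  rcases abs_cases (u1 - v1) with ⟨h1, _⟩ | ⟨h1, _⟩ <;>
  rcases abs_cases (u2 - v2) with ⟨h2, _⟩ | ⟨h2, _⟩ <;> rw [h1, h2] at h
  · rcases (by omega : u1 = v1 + 1 ∧ u2 = v2 ∨ u1 = v1 ∧ u2 = v2 + 1) with h | h
    · exact Or.inr (Or.inl ⟨v1, v2, by omega, by omega⟩)
    · exact Or.inr (Or.inr (Or.inr ⟨v1, v2, by omega, by omega⟩))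
  · rcases (by omega : u1 = v1 + 1 ∧ u2 = v2 ∨ u1 = v1 ∧ v2 = u2 + 1) with h | h
    · exact Or.inr (Or.inl ⟨v1, v2, by omega, by omega⟩)
    · exact Or.inr (Or.inr (Or.inl ⟨u1, u2, by omega, by omega⟩))
  · rcases (by omega : v1 = u1 + 1 ∧ u2 = v2 ∨ u1 = v1 ∧ u2 = v2 + 1) with h | h
    · exact Or.inl ⟨u1, u2, by omega, by omega⟩
    · exact Or.inr (Or.inr (Or.inr ⟨v1, v2, by omega, by omega⟩))
  · rcases (by omega : v1 = u1 + 1 ∧ u2 = v2 ∨ u1 = v1 ∧ v2 = u2 + 1) with h | h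
    · exact Or.inl ⟨u1, u2, by omega, by omega⟩
    · exact Or.inr (Or.inr (Or.inl ⟨u1, u2, by omega, by omega⟩))

theorem bond_cases (e : Bond) : (∃ i j, e = hb i j) ∨ ∃ i j, e = vb i j := by
  obtain ⟨e, he⟩ := e
  induction e using Sym2.ind with | _ u v
  rcases adj_cases he with ⟨i, j, rfl, rfl⟩ | ⟨i, j, rfl, rfl⟩ | ⟨i, j, rfl, rfl⟩ | ⟨i, j, rfl, rfl⟩
  · exact Or.inl ⟨i, j, rfl⟩
  · exact Or.inl ⟨i, j, Subtype.ext Sym2.eq_swap⟩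
  · exact Or.inr ⟨i, j, rfl⟩
  · exact Or.inr ⟨i, j, Subtype.ext Sym2.eq_swap⟩

theorem hb_inj {i j i' j' : ℤ} : hb i j = hb i' j' ↔ i = i' ∧ j = j' := by
  rw [Subtype.ext_iff]
  simp only [hb, Sym2.eq_iff, Prod.mk.injEq]
  omega

theorem vb_inj {i j i' j' : ℤ} : vb i j = vb i' j' ↔ i = i' ∧ j = j' := by
  rw [Subtype.ext_iff]
  simp only [vb, Sym2.eq_iff, Prod.mk.injEq]
  omega

theorem hb_ne_vb {i j i' j' : ℤ} : hb i j ≠ vb i' j' := by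
  rw [ne_eq, Subtype.ext_iff]
  simp only [hb, vb, Sym2.eq_iff, Prod.mk.injEq]
  omega

/-- `e` is one of the four sides of the unit square with lower left corner `f`. The unit squares
(faces) are represented by their lower left corners. -/
def IsSide (f : Site) (e : Bond) : Prop :=
  e = hb f.1 f.2 ∨ e = hb f.1 (f.2 + 1) ∨ e = vb f.1 f.2 ∨ e = vb (f.1 + 1) f.2

theorem isSide_hb {f : Site} {i j : ℤ} : IsSide f (hb i j) ↔ f = (i, j) ∨ f = (i, j - 1) := by
  obtain ⟨f1, f2⟩ := f
  simp only [IsSide, hb_inj, hb_ne_vb, Prod.mk.injEq, or_false]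
  omega

theorem isSide_vb {f : Site} {i j : ℤ} : IsSide f (vb i j) ↔ f = (i, j) ∨ f = (i - 1, j) := by
  obtain ⟨f1, f2⟩ := f
  simp only [IsSide, vb_inj, hb_ne_vb.symm, Prod.mk.injEq, false_or]
  omega

/-- Two faces that share a side which is closed in `ω`. -/
def ClosedStep (ω : BondConfig) (f g : Site) : Prop := ∃ e, e ∉ ω ∧ IsSide f e ∧ IsSide g e

theorem ClosedStep.symm {ω : BondConfig} {f g : Site} (h : ClosedStep ω f g) : ClosedStep ω g f :=
  let ⟨e, h1, h2, h3⟩ := h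
  ⟨e, h1, h3, h2⟩

/-- The supremum norm of a site. -/
def supNorm (v : Site) : ℤ := max |v.1| |v.2|

theorem norm_toPlane_le (v : Site) : ‖toPlane v‖ ≤ 2 * supNorm v := by
  have h0 : (|v.1| : ℤ) ≤ supNorm v := le_max_left _ _
  have h1 : (|v.2| : ℤ) ≤ supNorm v := le_max_right _ _
  have h0' : |(v.1 : ℝ)| ≤ supNorm v := by exact_mod_cast h0
  have h1' : |(v.2 : ℝ)| ≤ supNorm v := by exact_mod_cast h1
  have hs : (0 : ℝ) ≤ supNorm v := (abs_nonneg _).trans h0'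
  rw [EuclideanSpace.norm_eq, Fin.sum_univ_two]
  refine Real.sqrt_le_iff.2 ⟨by positivity, ?_⟩
  simp only [toPlane, Real.norm_eq_abs, PiLp.toLp_apply, Matrix.cons_val_zero, Matrix.cons_val_one]
  nlinarith [abs_nonneg (v.1 : ℝ), abs_nonneg (v.2 : ℝ)]

theorem abs_apply_le_norm (z : Plane) (i : Fin 2) : |z i| ≤ ‖z‖ := by
  simpa using PiLp.norm_apply_le z i

theorem supNorm_le_norm_toPlane (v : Site) : (supNorm v : ℝ) ≤ ‖toPlane v‖ := by
  have h0 := abs_apply_le_norm (toPlane v) 0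
  have h1 := abs_apply_le_norm (toPlane v) 1
  simp only [toPlane, PiLp.toLp_apply, Matrix.cons_val_zero, Matrix.cons_val_one] at h0 h1
  rw [supNorm, Int.cast_max, Int.cast_abs, Int.cast_abs]
  exact max_le h0 h1

/-- The face `f` is not contained in the box of size `M`. -/
def OuterFace (M : ℤ) (f : Site) : Prop := ¬ (-M ≤ f.1 ∧ f.1 < M ∧ -M ≤ f.2 ∧ f.2 < M)

/-- No face inside the box of size `k` can be reached from outside the box of size `M` through
closed bonds. -/
def Shielded (M k : ℤ) (ω : BondConfig) : Prop :=
  ∀ f g, OuterFace M g → Relation.ReflTransGen (ClosedStep ω) g f → OuterFace k f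

/-- `C` is a connected set of sites, at distance between `k` and `l` from `z`, that separates `z`
from infinity. -/
structure IsRing (ω : BondConfig) (z : Site) (k l : ℤ) (C : Set Site) : Prop where
  lower : ∀ v ∈ C, k ≤ supNorm (v - z)
  upper : ∀ v ∈ C, supNorm (v - z) ≤ l
  connected : ∀ u ∈ C, ∀ v ∈ C, ∃ p : (openGraph ω).Walk u v, ∀ w ∈ p.support, w ∈ C
  separates : ∀ v (p : squareLattice.Walk z v), l < supNorm (v - z) → ∃ w ∈ p.support, w ∈ C

/-! ### Circuits in the plane -/

theorem trace_cons (a : ℝ) {G : SimpleGraph Site} {u v w : Site} (h : G.Adj u v) (p : G.Walk v w) :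
    trace a (SimpleGraph.Walk.cons h p) =
      segment ℝ (a • toPlane u) (a • toPlane v) ∪ trace a p := by
  simp [trace, SimpleGraph.Walk.darts_cons, Set.iUnion_or, Set.iUnion_union_distrib]

theorem trace_transfer (a : ℝ) {G G' : SimpleGraph Site} {u v : Site} (p : G.Walk u v)
    (h : ∀ e ∈ p.edges, e ∈ G'.edgeSet) : trace a (p.transfer G' h) = trace a p := by
  induction p with
  | nil => simp [trace]
  | cons hadj p ih =>
    refine (trace_cons a (G := G') _ _).trans ?_
    rw [trace_cons, ih]

theorem mem_trace_of_mem_support (a : ℝ) {G : SimpleGraph Site} {u v : Site} (p : G.Walk u v)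
    (hp : ¬ p.Nil) {w : Site} (hw : w ∈ p.support) : a • toPlane w ∈ trace a p := by
  induction p with
  | nil => simp at hp
  | @cons u v t h p ih =>
    rw [trace_cons]
    rw [SimpleGraph.Walk.support_cons, List.mem_cons] at hw
    rcases hw with rfl | hw
    · exact Or.inl (left_mem_segment _ _ _)
    · by_cases hn : p.Nil
      · cases p with
        | nil =>
          rw [SimpleGraph.Walk.support_nil, List.mem_singleton] at hw
          subst hw
          exact Or.inl (right_mem_segment _ _ _)
        | cons => simp at hn
      · exact Or.inr (ih hn hw)

/-- The circuit uses only bonds with both endpoints in the annulus. This gives monotonicity of the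
event and, the annulus being bounded, its locality. -/
theorem hasOpenCircuit_of_forall {a : ℝ} {x : Plane} {r₁ r₂ : ℝ} {ω ω' : BondConfig}
    (h : HasOpenCircuit a x r₁ r₂ ω)
    (hω : ∀ e ∈ ω, (∀ v ∈ e.1, a • toPlane v ∈ annulus x r₁ r₂) → e ∈ ω') :
    HasOpenCircuit a x r₁ r₂ ω' := by
  obtain ⟨v, γ, hγ, hsub, hb⟩ := h
  have htr : ∀ e ∈ γ.edges, e ∈ (openGraph ω').edgeSet := by
    intro e he
    have he' := γ.edges_subset_edgeSet he
    have hs : ∀ w ∈ e, a • toPlane w ∈ annulus x r₁ r₂ := fun w hw =>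
      hsub (mem_trace_of_mem_support a γ hγ.not_nil (γ.mem_support_of_mem_edges he hw))
    induction e using Sym2.ind with | _ s t
    obtain ⟨h1, h2⟩ := openGraph_adj.1 he'
    exact openGraph_adj.2 ⟨h1, hω _ h2 hs⟩
  refine ⟨v, γ.transfer _ htr, hγ.transfer htr, ?_, ?_⟩
  · rwa [trace_transfer]
  · rwa [trace_transfer]

theorem isUpperSet_hasOpenCircuit (a : ℝ) (x : Plane) (r₁ r₂ : ℝ) :
    IsUpperSet {ω | HasOpenCircuit a x r₁ r₂ ω} :=
  fun _ _ h h1 => hasOpenCircuit_of_forall h1 fun _ he _ => h he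

theorem isLocalBondEvent_hasOpenCircuit {a : ℝ} (ha : 0 < a) (r₁ r₂ : ℝ) :
    IsLocalBondEvent {ω | HasOpenCircuit a 0 r₁ r₂ ω} := by
  refine ⟨bondsIn (disc (r₂ / a)), fun ω ω' h => ?_⟩
  have hD : ∀ e : Bond, (∀ v ∈ e.1, a • toPlane v ∈ annulus 0 r₁ r₂) →
      e ∈ bondsIn (disc (r₂ / a)) := by
    intro e he
    rw [mem_bondsIn]
    intro v hv
    have h2 := (he v hv).2
    rw [dist_zero_right, norm_smul, Real.norm_of_nonneg ha.le] at h2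
    rw [mem_disc, le_div_iff₀ ha]
    linarith
  constructor
  · intro h1
    exact hasOpenCircuit_of_forall h1 fun e he hs => (h e (hD e hs)).1 he
  · intro h1
    exact hasOpenCircuit_of_forall h1 fun e he hs => (h e (hD e hs)).2 he

/-! ### Lattice walks and dual paths cannot cross a circuit -/

theorem mem_hsegment {a : ℝ} (ha : 0 < a) {i j : ℤ} {z : Plane}
    (hz : z ∈ segment ℝ (a • toPlane (i, j)) (a • toPlane (i + 1, j))) :
    z 1 / a = j ∧ (i : ℝ) ≤ z 0 / a ∧ z 0 / a ≤ i + 1 := by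
  obtain ⟨s, t, hs, ht, hst, rfl⟩ := hz
  have : s = 1 - t := by linarith
  subst this
  simp only [toPlane, PiLp.add_apply, PiLp.smul_apply, Matrix.cons_val_zero,
    Matrix.cons_val_one, smul_eq_mul, Int.cast_add, Int.cast_one]
  have e1 : ((1 - t) * (a * i) + t * (a * (i + 1))) / a = i + t := by field_simp; ring
  have e2 : ((1 - t) * (a * j) + t * (a * j)) / a = j := by field_simp; ring
  rw [e1, e2]
  exact ⟨rfl, by linarith, by linarith⟩

theorem mem_vsegment {a : ℝ} (ha : 0 < a) {i j : ℤ} {z : Plane}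
    (hz : z ∈ segment ℝ (a • toPlane (i, j)) (a • toPlane (i, j + 1))) :
    z 0 / a = i ∧ (j : ℝ) ≤ z 1 / a ∧ z 1 / a ≤ j + 1 := by
  obtain ⟨s, t, hs, ht, hst, rfl⟩ := hz
  have : s = 1 - t := by linarith
  subst this
  simp only [toPlane, PiLp.add_apply, PiLp.smul_apply, Matrix.cons_val_zero,
    Matrix.cons_val_one, smul_eq_mul, Int.cast_add, Int.cast_one]
  have e1 : ((1 - t) * (a * j) + t * (a * (j + 1))) / a = j + t := by field_simp; ring
  have e2 : ((1 - t) * (a * i) + t * (a * i)) / a = i := by field_simp; ring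
  rw [e1, e2]
  exact ⟨rfl, by linarith, by linarith⟩

/-- Coordinates, in units of the mesh, of the points of a bond. -/
theorem mem_segment_cases {a : ℝ} (ha : 0 < a) {u v : Site} (h : squareLattice.Adj u v) {z : Plane}
    (hz : z ∈ segment ℝ (a • toPlane u) (a • toPlane v)) :
    (∃ i j : ℤ, s(u, v) = s((i, j), (i + 1, j)) ∧ z 1 / a = j ∧ (i : ℝ) ≤ z 0 / a ∧
      z 0 / a ≤ i + 1) ∨
    (∃ i j : ℤ, s(u, v) = s((i, j), (i, j + 1)) ∧ z 0 / a = i ∧ (j : ℝ) ≤ z 1 / a ∧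
      z 1 / a ≤ j + 1) := by
  rcases adj_cases h with ⟨i, j, rfl, rfl⟩ | ⟨i, j, rfl, rfl⟩ | ⟨i, j, rfl, rfl⟩ | ⟨i, j, rfl, rfl⟩
  · exact Or.inl ⟨i, j, rfl, mem_hsegment ha hz⟩
  · rw [segment_symm] at hz
    exact Or.inl ⟨i, j, Sym2.eq_swap, mem_hsegment ha hz⟩
  · exact Or.inr ⟨i, j, rfl, mem_vsegment ha hz⟩
  · rw [segment_symm] at hz
    exact Or.inr ⟨i, j, Sym2.eq_swap, mem_vsegment ha hz⟩

theorem mem_trace_cases {a : ℝ} (ha : 0 < a) {ω : BondConfig} {u v : Site}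
    (γ : (openGraph ω).Walk u v) {z : Plane} (hz : z ∈ trace a γ) :
    (∃ i j : ℤ, hb i j ∈ ω ∧ (i, j) ∈ γ.support ∧ (i + 1, j) ∈ γ.support ∧
      z 1 / a = j ∧ (i : ℝ) ≤ z 0 / a ∧ z 0 / a ≤ i + 1) ∨
    (∃ i j : ℤ, vb i j ∈ ω ∧ (i, j) ∈ γ.support ∧ (i, j + 1) ∈ γ.support ∧
      z 0 / a = i ∧ (j : ℝ) ≤ z 1 / a ∧ z 1 / a ≤ j + 1) := by
  simp only [trace, Set.mem_iUnion, exists_prop] at hz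
  obtain ⟨d, hd, hz⟩ := hz
  obtain ⟨h1, h2⟩ := openGraph_adj.1 d.adj
  have hedge : s(d.fst, d.snd) ∈ γ.edges := List.mem_map_of_mem hd
  rcases mem_segment_cases ha h1 hz with ⟨i, j, hs, hc⟩ | ⟨i, j, hs, hc⟩
  · rw [hs] at hedge
    refine Or.inl ⟨i, j, ?_, γ.mem_support_of_mem_edges hedge (by simp),
      γ.mem_support_of_mem_edges hedge (by simp), hc⟩
    convert h2
    exact hs.symm
  · rw [hs] at hedge
    refine Or.inr ⟨i, j, ?_, γ.mem_support_of_mem_edges hedge (by simp),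
      γ.mem_support_of_mem_edges hedge (by simp), hc⟩
    convert h2
    exact hs.symm

theorem mem_component_of_segment {T : Set Plane} {x p q : Plane}
    (hp : p ∈ connectedComponentIn T x) (h : segment ℝ p q ⊆ T) :
    q ∈ connectedComponentIn T x := by
  rw [connectedComponentIn_eq hp]
  exact (convex_segment p q).isPreconnected.subset_connectedComponentIn (left_mem_segment _ _ _) h
    (right_mem_segment _ _ _)

/-- From a point beyond radius `r₂` the radial ray to infinity avoids the annulus, hence `T`, and
stays in the component. -/
theorem not_isBounded_of_escape {T : Set Plane} {r₁ r₂ : ℝ} (hr : 0 < r₁) (hr₂ : r₁ < r₂)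
    (hT : T ⊆ annulus 0 r₁ r₂) {q : Plane} (hq : q ∈ connectedComponentIn Tᶜ 0) (hn : r₂ < ‖q‖) :
    ¬ Bornology.IsBounded (connectedComponentIn Tᶜ (0 : Plane)) := by
  intro hb
  obtain ⟨R, hR⟩ := hb.exists_norm_le
  have hq0 : 0 < ‖q‖ := hr.trans (hr₂.trans hn)
  have hRn : 0 ≤ R := hq0.le.trans (hR q hq)
  have key : ∀ t : ℝ, 1 ≤ t → t • q ∈ connectedComponentIn Tᶜ (0 : Plane) := by
    intro t ht
    refine mem_component_of_segment hq fun z hz hzT => ?_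
    obtain ⟨s, s', hs, hs', hss, rfl⟩ := hz
    have h2 := (hT hzT).2
    rw [dist_zero_right, smul_smul, ← add_smul, norm_smul, Real.norm_of_nonneg (by positivity)] at h2
    have : 1 ≤ s + s' * t := by nlinarith
    nlinarith
  have h1 := hR _ (key (R / ‖q‖ + 1) (by have := div_nonneg hRn hq0.le; linarith))
  rw [norm_smul, Real.norm_of_nonneg (by positivity), add_mul, div_mul_cancel₀ _ hq0.ne'] at h1
  linarith

theorem zero_mem_component {T : Set Plane} {r₁ r₂ : ℝ} (hr : 0 < r₁) (hT : T ⊆ annulus 0 r₁ r₂) :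
    (0 : Plane) ∈ connectedComponentIn Tᶜ (0 : Plane) := by
  refine mem_connectedComponentIn fun h => ?_
  have := (hT h).1
  rw [dist_self] at this
  linarith

/-- Two bonds of the square lattice can only meet at, or overlap so as to share, a common endpoint.
The four cases are the orientations of the two bonds. -/
theorem segment_subset_compl_trace {a : ℝ} (ha : 0 < a) {ω : BondConfig} {v : Site}
    (γ : (openGraph ω).Walk v v) {u w : Site} (h : squareLattice.Adj u w) (hu : u ∉ γ.support)
    (hw : w ∉ γ.support) : segment ℝ (a • toPlane u) (a • toPlane w) ⊆ (trace a γ)ᶜ := by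
  intro z hz hzt
  have hmem : ∀ t ∈ s(u, w), t ∉ γ.support := by
    intro t ht
    rcases Sym2.mem_iff.1 ht with rfl | rfl <;> assumption
  have eqc : ∀ {m n : ℤ} {s : ℝ}, s = m → s = n → m = n := by
    intro m n s h1 h2
    exact_mod_cast h1.symm.trans h2
  have lec : ∀ {m n : ℤ} {s : ℝ}, (m : ℝ) ≤ s → s = n → m ≤ n := by
    intro m n s h1 h2
    exact_mod_cast h1.trans_eq h2
  have gec : ∀ {m n : ℤ} {s : ℝ}, s ≤ (m : ℝ) + 1 → s = n → n ≤ m + 1 := by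
    intro m n s h1 h2
    exact_mod_cast h2.symm.trans_le h1
  have conv : ∀ {m n : ℤ} {s : ℝ}, (m : ℝ) ≤ s → s ≤ n + 1 → m ≤ n + 1 := by
    intro m n s h1 h2
    exact_mod_cast h1.trans h2
  rcases mem_segment_cases ha h hz with ⟨i, j, hs, e1, e2, e3⟩ | ⟨i, j, hs, e1, e2, e3⟩ <;>
  rcases mem_trace_cases ha γ hzt with ⟨m, n, -, s1, s2, e4, e5, e6⟩ | ⟨m, n, -, s1, s2, e4, e5, e6⟩ <;>
  rw [hs] at hmem
  · have hj : j = n := eqc e1 e4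
    subst hj
    have h1 := conv e2 e6
    have h2 := conv e5 e3
    rcases (by omega : m = i ∨ m = i + 1 ∨ m + 1 = i) with rfl | rfl | rfl
    · exact hmem (m, j) (by simp) s1
    · exact hmem (i + 1, j) (by simp) s1
    · exact hmem (m + 1, j) (by simp) s2
  · have h1 := lec e2 e4
    have h2 := gec e3 e4
    have h3 := lec e5 e1
    have h4 := gec e6 e1
    have hm : (m, j) ∉ γ.support := by
      rcases (by omega : m = i ∨ m = i + 1) with rfl | rfl
      · exact hmem (m, j) (by simp)
      · exact hmem (i + 1, j) (by simp)
    rcases (by omega : j = n ∨ j = n + 1) with rfl | rfl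
    exacts [hm s1, hm s2]
  · have h1 := lec e2 e4
    have h2 := gec e3 e4
    have h3 := lec e5 e1
    have h4 := gec e6 e1
    have hm : (i, n) ∉ γ.support := by
      rcases (by omega : n = j ∨ n = j + 1) with rfl | rfl
      · exact hmem (i, n) (by simp)
      · exact hmem (i, j + 1) (by simp)
    rcases (by omega : i = m ∨ i = m + 1) with rfl | rfl
    exacts [hm s1, hm s2]
  · have hj : i = m := eqc e1 e4
    subst hj
    have h1 := conv e2 e6
    have h2 := conv e5 e3
    rcases (by omega : n = j ∨ n = j + 1 ∨ n + 1 = j) with rfl | rfl | rfl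
    · exact hmem (i, n) (by simp) s1
    · exact hmem (i, j + 1) (by simp) s1
    · exact hmem (i, n + 1) (by simp) s2

/-- An open circuit in an annulus yields a ring of sites. -/
theorem exists_isRing {a r₁ r₂ : ℝ} (ha : 0 < a) (hr : 0 < r₁) (hr₂ : r₁ < r₂) {k l : ℤ}
    (hk : 2 * k * a ≤ r₁) (hl : r₂ ≤ l * a) {ω : BondConfig} (h : HasOpenCircuit a 0 r₁ r₂ ω) :
    ∃ C, IsRing ω 0 k l C := by
  obtain ⟨v₀, γ, hγ, hsub, hbdd⟩ := h
  have hnorm : ∀ v ∈ γ.support, r₁ ≤ a * ‖toPlane v‖ ∧ a * ‖toPlane v‖ ≤ r₂ := by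
    intro v hv
    have := hsub (mem_trace_of_mem_support a γ hγ.not_nil hv)
    simpa [annulus, norm_smul, abs_of_pos ha] using this
  refine ⟨{v | v ∈ γ.support}, ?_, ?_, ?_, ?_⟩
  · intro v hv
    -- The factor `2` in `hk` pays for passing from the Euclidean norm to the sup norm; the converse
    -- passage for the outer radius is free.
    have h1 := (hnorm v hv).1
    have h2 := norm_toPlane_le v
    have h3 : (2 * k) * a ≤ (2 * supNorm v) * a := by nlinarith
    have h4 : (2 * k : ℝ) ≤ 2 * supNorm v := le_of_mul_le_mul_right h3 ha
    rw [sub_zero]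
    have h5 : (k : ℝ) ≤ supNorm v := by linarith
    exact_mod_cast h5
  · intro v hv
    have h1 := (hnorm v hv).2
    have h2 := supNorm_le_norm_toPlane v
    have h3 : (supNorm v : ℝ) * a ≤ l * a := by nlinarith
    have h4 := le_of_mul_le_mul_right h3 ha
    rw [sub_zero]
    exact_mod_cast h4
  · intro u hu v hv
    refine ⟨(γ.takeUntil u hu).reverse.append (γ.takeUntil v hv), fun w hw => ?_⟩
    rw [SimpleGraph.Walk.mem_support_append_iff, SimpleGraph.Walk.support_reverse,
      List.mem_reverse] at hw
    rcases hw with hw | hw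
    · exact γ.support_takeUntil_subset_support hu hw
    · exact γ.support_takeUntil_subset_support hv hw
  · intro v p hv
    by_contra hcon
    push Not at hcon
    -- A walk that avoids the sites of the circuit remains, once drawn, in the component of the
    -- origin; reaching beyond radius `r₂` would make that component unbounded.
    have key : ∀ (u v : Site) (p : squareLattice.Walk u v), (∀ w ∈ p.support, w ∉ γ.support) →
        a • toPlane u ∈ connectedComponentIn (trace a γ)ᶜ 0 →
        a • toPlane v ∈ connectedComponentIn (trace a γ)ᶜ 0 := by
      intro u v p
      induction p with
      | nil => exact fun _ h => h
      | @cons u v t h p ih =>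
        intro hs hu
        refine ih (fun w hw => hs w (by simp [hw])) (mem_component_of_segment hu ?_)
        exact segment_subset_compl_trace ha γ h (hs u (by simp)) (hs v (by simp))
    have h0 : a • toPlane (0 : Site) = 0 := by
      ext i; fin_cases i <;> simp [toPlane]
    have h1 := key 0 v p hcon (by rw [h0]; exact zero_mem_component hr hsub)
    refine not_isBounded_of_escape hr hr₂ hsub h1 ?_ hbdd
    rw [norm_smul, Real.norm_of_nonneg ha.le]
    rw [sub_zero] at hv
    have h2 := supNorm_le_norm_toPlane v
    have h3 : (l : ℝ) < supNorm v := by exact_mod_cast hv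
    nlinarith

/-- The centre of a face. -/
noncomputable def faceCenter (f : Site) : Plane := !₂[(f.1 : ℝ) + 1 / 2, (f.2 : ℝ) + 1 / 2]

/-- The segment between two neighbouring face centres crosses the lattice only at the midpoint of
their common side, and that side is closed while the circuit is open. -/
theorem closedStep_segment {a : ℝ} (ha : 0 < a) {ω : BondConfig} {v : Site}
    (γ : (openGraph ω).Walk v v) {f g : Site} (h : ClosedStep ω f g) (hfg : f ≠ g) :
    segment ℝ (a • faceCenter f) (a • faceCenter g) ⊆ (trace a γ)ᶜ := by
  have half : ∀ {m n : ℤ} {s : ℝ}, s = m → s = n + 1 / 2 → False := by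
    intro m n s h1 h2
    have h3 : (2 * m : ℝ) = 2 * n + 1 := by linarith
    have h4 : 2 * m = 2 * n + 1 := by exact_mod_cast h3
    omega
  have near : ∀ {m n : ℤ} {s : ℝ}, s = m → (n : ℝ) - 1 / 2 ≤ s → s ≤ n + 1 / 2 → m = n := by
    intro m n s h1 h2 h3
    have h4 : (m : ℝ) < n + 1 := by linarith
    have h5 : (n : ℝ) < m + 1 := by linarith
    have h4 : m < n + 1 := by exact_mod_cast h4
    have h5 : n < m + 1 := by exact_mod_cast h5
    omega
  have unit : ∀ {m n : ℤ} {s : ℝ}, s = n + 1 / 2 → (m : ℝ) ≤ s → s ≤ m + 1 → m = n := by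
    intro m n s h1 h2 h3
    have h4 : (m : ℝ) < n + 1 := by linarith
    have h5 : (n : ℝ) < m + 1 := by linarith
    have h4 : m < n + 1 := by exact_mod_cast h4
    have h5 : n < m + 1 := by exact_mod_cast h5
    omega
  obtain ⟨e, heω, hf, hg⟩ := h
  rcases bond_cases e with ⟨i, j, rfl⟩ | ⟨i, j, rfl⟩
  · have main : ∀ z ∈ segment ℝ (a • faceCenter (i, j)) (a • faceCenter (i, j - 1)),
        z ∈ (trace a γ)ᶜ := by
      intro z hz hzt
      have hc : z 0 / a = i + 1 / 2 ∧ (j : ℝ) - 1 / 2 ≤ z 1 / a ∧ z 1 / a ≤ j + 1 / 2 := by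
        obtain ⟨s, t, hs, ht, hst, rfl⟩ := hz
        have : s = 1 - t := by linarith
        subst this
        simp only [faceCenter, PiLp.add_apply, PiLp.smul_apply,
          Matrix.cons_val_zero, Matrix.cons_val_one, smul_eq_mul, Int.cast_sub, Int.cast_one]
        have e1 : ((1 - t) * (a * (i + 1 / 2)) + t * (a * (i + 1 / 2))) / a = (i : ℝ) + 1 / 2 := by
          field_simp; ring
        have e2 : ((1 - t) * (a * (j + 1 / 2)) + t * (a * (j - 1 + 1 / 2))) / a =
            (j : ℝ) + 1 / 2 - t := by
          field_simp; ring
        rw [e1, e2]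
        exact ⟨rfl, by linarith, by linarith⟩
      rcases mem_trace_cases ha γ hzt with ⟨m, n, hω, -, -, e4, e5, e6⟩ | ⟨m, n, -, -, -, e4, e5, e6⟩
      · obtain rfl := near e4 hc.2.1 hc.2.2
        obtain rfl := unit hc.1 e5 e6
        exact heω hω
      · exact half e4 hc.1
    rw [isSide_hb] at hf hg
    rcases hf with rfl | rfl <;> rcases hg with rfl | rfl
    · exact absurd rfl hfg
    · exact main
    · rw [segment_symm]; exact main
    · exact absurd rfl hfg
  · have main : ∀ z ∈ segment ℝ (a • faceCenter (i, j)) (a • faceCenter (i - 1, j)),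
        z ∈ (trace a γ)ᶜ := by
      intro z hz hzt
      have hc : z 1 / a = j + 1 / 2 ∧ (i : ℝ) - 1 / 2 ≤ z 0 / a ∧ z 0 / a ≤ i + 1 / 2 := by
        obtain ⟨s, t, hs, ht, hst, rfl⟩ := hz
        have : s = 1 - t := by linarith
        subst this
        simp only [faceCenter, PiLp.add_apply, PiLp.smul_apply,
          Matrix.cons_val_zero, Matrix.cons_val_one, smul_eq_mul, Int.cast_sub, Int.cast_one]
        have e1 : ((1 - t) * (a * (j + 1 / 2)) + t * (a * (j + 1 / 2))) / a = (j : ℝ) + 1 / 2 := by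
          field_simp; ring
        have e2 : ((1 - t) * (a * (i + 1 / 2)) + t * (a * (i - 1 + 1 / 2))) / a =
            (i : ℝ) + 1 / 2 - t := by
          field_simp; ring
        rw [e1, e2]
        exact ⟨rfl, by linarith, by linarith⟩
      rcases mem_trace_cases ha γ hzt with ⟨m, n, -, -, -, e4, e5, e6⟩ | ⟨m, n, hω, -, -, e4, e5, e6⟩
      · exact half e4 hc.1
      · obtain rfl := near e4 hc.2.1 hc.2.2
        obtain rfl := unit hc.1 e5 e6
        exact heω hω
    rw [isSide_vb] at hf hg
    rcases hf with rfl | rfl <;> rcases hg with rfl | rfl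
    · exact absurd rfl hfg
    · exact main
    · rw [segment_symm]; exact main
    · exact absurd rfl hfg

/-- An open circuit in an annulus shields the inner disc from closed dual paths. -/
theorem shielded_of_hasOpenCircuit {a r₁ r₂ : ℝ} (ha : 0 < a) (hr : 0 < r₁) (hr₂ : r₁ < r₂)
    {k l M : ℤ} (hk : 2 * k * a ≤ r₁) (hl : r₂ ≤ l * a) (hM : l ≤ M) {ω : BondConfig}
    (h : HasOpenCircuit a 0 r₁ r₂ ω) : Shielded M k ω := by
  obtain ⟨v₀, γ, hγ, hsub, hbdd⟩ := h
  intro f g hg hgf hf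
  have hl0 : (0 : ℝ) < l := by nlinarith
  -- The chain of face centres is followed backwards, from the face near the origin to the outer
  -- face.
  have key : ∀ f', Relation.ReflTransGen (ClosedStep ω) g f' →
      a • faceCenter f' ∈ connectedComponentIn (trace a γ)ᶜ 0 →
      a • faceCenter g ∈ connectedComponentIn (trace a γ)ᶜ 0 := by
    intro f' h
    induction h with
    | refl => exact id
    | @tail b c _ hbc ih =>
      intro hc
      by_cases hbc' : c = b
      · exact ih (hbc' ▸ hc)
      · exact ih (mem_component_of_segment hc (closedStep_segment ha γ hbc.symm hbc'))
  -- The centre of a face inside the box of size `k` lies in the open ball of radius `r₁`, which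
  -- misses the circuit.
  have hf' : a • faceCenter f ∈ connectedComponentIn (trace a γ)ᶜ 0 := by
    refine mem_component_of_segment (zero_mem_component hr hsub) fun z hz hzt => ?_
    have h1 := (hsub hzt).1
    rw [dist_zero_right] at h1
    have h2 : z ∈ Metric.ball (0 : Plane) r₁ := by
      refine (convex_ball (0 : Plane) r₁).segment_subset (Metric.mem_ball_self hr) ?_ hz
      rw [mem_ball_zero_iff, norm_smul, Real.norm_of_nonneg ha.le]
      obtain ⟨c1, c2, c3, c4⟩ := hf
      have d1 : (-k : ℝ) ≤ f.1 := by exact_mod_cast c1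
      have d2 : (f.1 : ℝ) + 1 ≤ k := by exact_mod_cast c2
      have d3 : (-k : ℝ) ≤ f.2 := by exact_mod_cast c3
      have d4 : (f.2 : ℝ) + 1 ≤ k := by exact_mod_cast c4
      have hk0 : (0 : ℝ) < k := by linarith
      have h3 : ‖faceCenter f‖ < 2 * k := by
        rw [EuclideanSpace.norm_eq, Fin.sum_univ_two]
        refine (Real.sqrt_lt' (by positivity)).2 ?_
        simp only [faceCenter, Real.norm_eq_abs, PiLp.toLp_apply, Matrix.cons_val_zero,
          Matrix.cons_val_one, sq_abs]
        nlinarith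
      nlinarith
    rw [mem_ball_zero_iff] at h2
    linarith
  refine not_isBounded_of_escape hr hr₂ hsub (key f hgf hf') ?_ hbdd
  rw [norm_smul, Real.norm_of_nonneg ha.le]
  have h3 : (l : ℝ) < ‖faceCenter g‖ := by
    have c0 : |(g.1 : ℝ) + 1 / 2| ≤ ‖faceCenter g‖ := abs_apply_le_norm (faceCenter g) 0
    have c1 : |(g.2 : ℝ) + 1 / 2| ≤ ‖faceCenter g‖ := abs_apply_le_norm (faceCenter g) 1
    have hlM : (l : ℝ) ≤ M := by exact_mod_cast hM
    have hg' : g.1 + 1 ≤ -M ∨ M ≤ g.1 ∨ g.2 + 1 ≤ -M ∨ M ≤ g.2 := by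
      unfold OuterFace at hg; omega
    rcases hg' with h | h | h | h
    · have : (g.1 : ℝ) + 1 ≤ -M := by exact_mod_cast h
      have := neg_le_abs ((g.1 : ℝ) + 1 / 2)
      linarith
    · have : (M : ℝ) ≤ g.1 := by exact_mod_cast h
      have := le_abs_self ((g.1 : ℝ) + 1 / 2)
      linarith
    · have : (g.2 : ℝ) + 1 ≤ -M := by exact_mod_cast h
      have := neg_le_abs ((g.2 : ℝ) + 1 / 2)
      linarith
    · have : (M : ℝ) ≤ g.2 := by exact_mod_cast h
      have := le_abs_self ((g.2 : ℝ) + 1 / 2)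
      linarith
  nlinarith

/-! ### Connecting rings -/

theorem supNorm_le_iff {v : Site} {l : ℤ} :
    supNorm v ≤ l ↔ -l ≤ v.1 ∧ v.1 ≤ l ∧ -l ≤ v.2 ∧ v.2 ≤ l := by
  rw [supNorm, max_le_iff, abs_le, abs_le]
  tauto

theorem supNorm_lt_iff {v : Site} {l : ℤ} :
    supNorm v < l ↔ -l < v.1 ∧ v.1 < l ∧ -l < v.2 ∧ v.2 < l := by
  rw [supNorm, max_lt_iff, abs_lt, abs_lt]
  tauto

theorem supNorm_nonneg (v : Site) : 0 ≤ supNorm v := (abs_nonneg _).trans (le_max_left _ _)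

theorem supNorm_neg (v : Site) : supNorm (-v) = supNorm v := by simp [supNorm]

theorem supNorm_sub_comm (u v : Site) : supNorm (u - v) = supNorm (v - u) := by
  rw [← supNorm_neg, neg_sub]

theorem supNorm_add_le (u v : Site) : supNorm (u + v) ≤ supNorm u + supNorm v := by
  have h1 := (supNorm_le_iff (v := u)).1 le_rfl
  have h2 := (supNorm_le_iff (v := v)).1 le_rfl
  rw [supNorm_le_iff, Prod.fst_add, Prod.snd_add]
  omega

/-- Two sites are joined by a lattice walk inside the rectangle that they span. -/
theorem exists_walk_rect (u v : Site) : ∃ p : squareLattice.Walk u v, ∀ w ∈ p.support,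
    min u.1 v.1 ≤ w.1 ∧ w.1 ≤ max u.1 v.1 ∧ min u.2 v.2 ≤ w.2 ∧ w.2 ≤ max u.2 v.2 := by
  induction h : (u.1 - v.1).natAbs + (u.2 - v.2).natAbs generalizing u with
  | zero =>
    have : u = v := Prod.ext (by omega) (by omega)
    subst this
    exact ⟨.nil, by simp⟩
  | succ n ih =>
    obtain ⟨u1, u2⟩ := u
    obtain ⟨v1, v2⟩ := v
    simp only at h
    obtain ⟨⟨s1, s2⟩, hs, hn, h1, h2⟩ : ∃ s : Site, squareLattice.Adj (u1, u2) s ∧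
        (s.1 - v1).natAbs + (s.2 - v2).natAbs = n ∧ (min u1 v1 ≤ s.1 ∧ s.1 ≤ max u1 v1) ∧
        (min u2 v2 ≤ s.2 ∧ s.2 ≤ max u2 v2) := by
      rcases lt_trichotomy u1 v1 with hlt | heq | hgt
      · exact ⟨(u1 + 1, u2), hadj _ _, by simp only; omega, by simp only; omega, by simp⟩
      · rcases lt_trichotomy u2 v2 with hlt | heq | hgt
        · exact ⟨(u1, u2 + 1), vadj _ _, by simp only; omega, by simp, by simp only; omega⟩
        · omega
        · refine ⟨(u1, u2 - 1), ?_, by simp only; omega, by simp, by simp only; omega⟩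
          simpa using (vadj u1 (u2 - 1)).symm
      · refine ⟨(u1 - 1, u2), ?_, by simp only; omega, by simp only; omega, by simp⟩
        simpa using (hadj (u1 - 1) u2).symm
    obtain ⟨p, hp⟩ := ih (s1, s2) hn
    refine ⟨.cons hs p, fun w hw => ?_⟩
    rw [SimpleGraph.Walk.support_cons, List.mem_cons] at hw
    rcases hw with rfl | hw
    · simp
    · have := hp w hw
      simp only at this h1 h2 ⊢
      omega

/-- Any two sites of `C` are joined by an open path in `C`. -/
def IsOpenConnected (ω : BondConfig) (C : Set Site) : Prop :=
  ∀ u ∈ C, ∀ v ∈ C, ∃ p : (openGraph ω).Walk u v, ∀ w ∈ p.support, w ∈ C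

theorem IsOpenConnected.union {ω : BondConfig} {C C' : Set Site} (h : IsOpenConnected ω C)
    (h' : IsOpenConnected ω C') {t : Site} (ht : t ∈ C) (ht' : t ∈ C') :
    IsOpenConnected ω (C ∪ C') := by
  have key : ∀ u ∈ C ∪ C', ∃ p : (openGraph ω).Walk u t, ∀ w ∈ p.support, w ∈ C ∪ C' := by
    rintro u (hu | hu)
    · obtain ⟨p, hp⟩ := h u hu t ht
      exact ⟨p, fun w hw => Or.inl (hp w hw)⟩
    · obtain ⟨p, hp⟩ := h' u hu t ht'
      exact ⟨p, fun w hw => Or.inr (hp w hw)⟩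
  intro u hu v hv
  obtain ⟨p, hp⟩ := key u hu
  obtain ⟨q, hq⟩ := key v hv
  refine ⟨p.append q.reverse, fun w hw => ?_⟩
  rw [SimpleGraph.Walk.mem_support_append_iff, SimpleGraph.Walk.support_reverse,
    List.mem_reverse] at hw
  exact hw.elim (hp w) (hq w)

theorem IsOpenConnected.exists_lattice_walk {ω : BondConfig} {C : Set Site}
    (h : IsOpenConnected ω C) {u v : Site} (hu : u ∈ C) (hv : v ∈ C) :
    ∃ p : squareLattice.Walk u v, ∀ w ∈ p.support, w ∈ C := by
  obtain ⟨p, hp⟩ := h u hu v hv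
  refine ⟨p.mapLe (openGraph_le ω), fun w hw => hp w ?_⟩
  simpa using hw

/-- `C` separates `v` from the sites of norm at least `R`. -/
def Encloses (R : ℤ) (C : Set Site) (v : Site) : Prop :=
  ∀ t, R ≤ supNorm t → ∀ p : squareLattice.Walk v t, ∃ w ∈ p.support, w ∈ C

theorem encloses_of_mem {R : ℤ} {C : Set Site} {v : Site} (h : v ∈ C) : Encloses R C v :=
  fun _ _ p => ⟨v, p.start_mem_support, h⟩

theorem Encloses.of_walk {R : ℤ} {C : Set Site} {u v : Site} (h : Encloses R C u)
    (p : squareLattice.Walk u v) (hp : ∀ w ∈ p.support, w ∉ C) : Encloses R C v := by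
  intro t ht q
  obtain ⟨w, hw, hwC⟩ := h t ht (p.append q)
  rw [SimpleGraph.Walk.mem_support_append_iff] at hw
  exact hw.elim (fun h => absurd hwC (hp w h)) fun h => ⟨w, h, hwC⟩

theorem Encloses.exists_mem {R : ℤ} {C : Set Site} {v : Site} (h : Encloses R C v) :
    ∃ w, w ∈ C := by
  obtain ⟨p, -⟩ := exists_walk_rect v (R, 0)
  obtain ⟨w, -, hw⟩ := h (R, 0) (le_max_of_le_left (le_abs_self _)) p
  exact ⟨w, hw⟩

theorem IsOpenConnected.encloses_of_disjoint {ω : BondConfig} {R : ℤ} {K C : Set Site}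
    (hK : IsOpenConnected ω K) (hd : ∀ v ∈ K, v ∉ C) {u : Site} (hu : u ∈ K)
    (h : Encloses R C u) : ∀ v ∈ K, Encloses R C v := by
  intro v hv
  obtain ⟨p, hp⟩ := hK.exists_lattice_walk hu hv
  exact h.of_walk p fun w hw => hd w (hp w hw)

theorem Encloses.trans {R : ℤ} {C C' : Set Site} (h : ∀ v ∈ C, Encloses R C' v) {v : Site}
    (hv : Encloses R C v) : Encloses R C' v := by
  intro t ht p
  obtain ⟨w, hw, hwC⟩ := hv t ht p
  obtain ⟨s, hs, hsC⟩ := h w hwC t ht (p.dropUntil w hw)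
  exact ⟨s, p.support_dropUntil_subset_support hw hs, hsC⟩

theorem exists_first_hit {S : Set Site} {u v : Site} (p : squareLattice.Walk u v) {s : Site}
    (hs : s ∈ p.support) (hS : s ∈ S) :
    ∃ w ∈ S, ∃ q : squareLattice.Walk u w, ∀ t ∈ q.support, t ∈ S → t = w := by
  induction p with
  | @nil u =>
    rw [SimpleGraph.Walk.support_nil, List.mem_singleton] at hs
    subst hs
    exact ⟨s, hS, .nil, by simp⟩
  | @cons u v t h p ih =>
    by_cases hu : u ∈ S
    · exact ⟨u, hu, .nil, by simp⟩
    · rw [SimpleGraph.Walk.support_cons, List.mem_cons] at hs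
      rcases hs with rfl | hs
      · exact absurd hS hu
      · obtain ⟨w, hw, q, hq⟩ := ih hs
        refine ⟨w, hw, .cons h q, fun t ht htS => ?_⟩
        rw [SimpleGraph.Walk.support_cons, List.mem_cons] at ht
        rcases ht with rfl | ht
        exacts [absurd htS hu, hq t ht htS]

/-- Disjoint connected sets that enclose a common site are nested. -/
theorem encloses_nested {ω : BondConfig} {R : ℤ} {C C' : Set Site} (hC : IsOpenConnected ω C)
    (hC' : IsOpenConnected ω C') (hd : ∀ v ∈ C, v ∉ C') {v : Site} (h : Encloses R C v)
    (h' : Encloses R C' v) :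
    (∀ w, Encloses R C w → Encloses R C' w) ∨ (∀ w, Encloses R C' w → Encloses R C w) := by
  by_cases h1 : ∃ u ∈ C, Encloses R C' u
  · obtain ⟨u, hu, h1⟩ := h1
    exact Or.inl fun w hw => hw.trans (hC.encloses_of_disjoint hd hu h1)
  by_cases h2 : ∃ u ∈ C', Encloses R C u
  · obtain ⟨u, hu, h2⟩ := h2
    exact Or.inr fun w hw =>
      hw.trans (hC'.encloses_of_disjoint (fun t ht ht' => hd t ht' ht) hu h2)
  -- Neither set encloses a site of the other. Yet the first site of `C ∪ C'` on a walk from `v` to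
  -- infinity is reached from `v` without touching the set it does not belong to, so it is enclosed
  -- by that set.
  exfalso
  push Not at h1 h2
  obtain ⟨p, -⟩ := exists_walk_rect v (R, 0)
  obtain ⟨s, hs, hsC⟩ := h (R, 0) (le_max_of_le_left (le_abs_self _)) p
  obtain ⟨w, hw, q, hq⟩ := exists_first_hit (S := C ∪ C') p hs (Or.inl hsC)
  rcases hw with hw | hw
  · refine h1 w hw (h'.of_walk q fun t ht htC => ?_)
    have := hq t ht (Or.inr htC)
    subst this
    exact hd t hw htC
  · refine h2 w hw (h.of_walk q fun t ht htC => ?_)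
    have := hq t ht (Or.inl htC)
    subst this
    exact hd t htC hw

theorem IsRing.encloses_center {ω : BondConfig} {z : Site} {k l R : ℤ} {C : Set Site}
    (h : IsRing ω z k l C) (hR : ∀ t, R ≤ supNorm t → l < supNorm (t - z)) : Encloses R C z :=
  fun t ht p => h.separates t p (hR t ht)

/-- The rectangle spanned by the centre and `u` stays below the inner radius, so a walk in it misses
the ring. -/
theorem IsRing.encloses_near {ω : BondConfig} {z : Site} {k l R : ℤ} {C : Set Site}
    (h : IsRing ω z k l C) (hR : ∀ t, R ≤ supNorm t → l < supNorm (t - z)) {u : Site}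
    (hu : supNorm (u - z) < k) : Encloses R C u := by
  obtain ⟨p, hp⟩ := exists_walk_rect z u
  refine (h.encloses_center hR).of_walk p fun w hw hwC => ?_
  have h1 := h.lower w hwC
  have h2 := hp w hw
  rw [supNorm_lt_iff, Prod.fst_sub, Prod.snd_sub] at hu
  have h3 : supNorm (w - z) < k := by
    rw [supNorm_lt_iff, Prod.fst_sub, Prod.snd_sub]
    omega
  omega

/-- A ring is not enclosed by a ring that does not reach far enough. -/
theorem IsRing.not_enclosed {ω : BondConfig} {z₀ z : Site} {k₀ l₀ k l R : ℤ} {C₀ C : Set Site}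
    (h₀ : IsRing ω z₀ k₀ l₀ C₀) (h : IsRing ω z k l C) (hl : l < k₀ + supNorm (z - z₀)) :
    ¬ ∀ w ∈ C₀, Encloses R C w := by
  intro hall
  -- A walk from `z₀` to `t` hits `C₀` at some `w`. If continuing from `w` to `t` keeps farther than
  -- `l` from `z`, it misses `C`, so `w` is not enclosed.
  have main : ∀ t : Site, R ≤ supNorm t → l₀ < supNorm (t - z₀) →
      (∀ w : Site, (min z₀.1 t.1 ≤ w.1 ∧ w.1 ≤ max z₀.1 t.1 ∧ min z₀.2 t.2 ≤ w.2 ∧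
        w.2 ≤ max z₀.2 t.2) → ∀ s : Site, (min w.1 t.1 ≤ s.1 ∧ s.1 ≤ max w.1 t.1 ∧
        min w.2 t.2 ≤ s.2 ∧ s.2 ≤ max w.2 t.2) → k₀ ≤ supNorm (w - z₀) → l < supNorm (s - z)) →
      False := by
    intro t ht1 ht2 ht3
    obtain ⟨p, hp⟩ := exists_walk_rect z₀ t
    obtain ⟨w, hw, hwC⟩ := h₀.separates t p ht2
    obtain ⟨q, hq⟩ := exists_walk_rect w t
    obtain ⟨s, hs, hsC⟩ := hall w hwC t ht1 q
    have h1 := ht3 w (hp w hw) s (hq s hs) (h₀.lower w hwC)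
    have h2 := h.upper s hsC
    omega
  have hmax : supNorm (z - z₀) = z.1 - z₀.1 ∨ supNorm (z - z₀) = -(z.1 - z₀.1) ∨
      supNorm (z - z₀) = z.2 - z₀.2 ∨ supNorm (z - z₀) = -(z.2 - z₀.2) := by
    rw [supNorm, Prod.fst_sub, Prod.snd_sub]
    rcases max_choice |z.1 - z₀.1| |z.2 - z₀.2| with h | h <;> rw [h]
    · rcases abs_choice (z.1 - z₀.1) with h | h <;> rw [h] <;> simp
    · rcases abs_choice (z.2 - z₀.2) with h | h <;> rw [h] <;> simp
  set d := supNorm (z - z₀) with hd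
  -- The target lies on the axis ray from `z₀` pointing away from `z` in a coordinate that realises
  -- `d`: past `C₀` the distance from `z` is at least `k₀ + d > l`. The length `n` puts it beyond
  -- both `R` and the outer radius `l₀`.
  have key : ∀ t : Site, ∀ n : ℤ, n = |z₀.1| + |z₀.2| + |R| + |l₀| + 1 →
      ((d = z.1 - z₀.1 ∧ t = (z₀.1 - n, z₀.2)) ∨ (d = -(z.1 - z₀.1) ∧ t = (z₀.1 + n, z₀.2)) ∨
      (d = z.2 - z₀.2 ∧ t = (z₀.1, z₀.2 - n)) ∨ (d = -(z.2 - z₀.2) ∧ t = (z₀.1, z₀.2 + n))) →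
      False := by
    intro t n hn ht
    have a1 := neg_abs_le z₀.1
    have a2 := le_abs_self z₀.1
    have a3 := neg_abs_le z₀.2
    have a4 := le_abs_self z₀.2
    have a5 := le_abs_self R
    have a6 := le_abs_self l₀
    have a7 := abs_nonneg R
    have a8 := abs_nonneg l₀
    obtain ⟨t1, t2⟩ := t
    simp only [Prod.mk.injEq] at ht
    refine main (t1, t2) ?_ ?_ ?_
    · by_contra hcon
      rw [not_le, supNorm_lt_iff] at hcon
      omega
    · by_contra hcon
      rw [not_lt, supNorm_le_iff, Prod.fst_sub, Prod.snd_sub] at hcon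
      omega
    · intro w hw s hs hk
      by_contra hcon
      rw [not_lt, supNorm_le_iff, Prod.fst_sub, Prod.snd_sub] at hcon
      have hk' : ¬ supNorm (w - z₀) < k₀ := not_lt.2 hk
      rw [supNorm_lt_iff, Prod.fst_sub, Prod.snd_sub] at hk'
      simp only at hw hs
      omega
  rcases hmax with h | h | h | h
  · exact key _ _ rfl (Or.inl ⟨h, rfl⟩)
  · exact key _ _ rfl (Or.inr (Or.inl ⟨h, rfl⟩))
  · exact key _ _ rfl (Or.inr (Or.inr (Or.inl ⟨h, rfl⟩)))
  · exact key _ _ rfl (Or.inr (Or.inr (Or.inr ⟨h, rfl⟩)))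

/-- One radius beyond all rings of the chain, so that a single notion of enclosure serves for all of
them. -/
theorem exists_far (N : ℕ) (z : ℕ → Site) (l : ℕ → ℤ) :
    ∃ R : ℤ, ∀ i ≤ N, ∀ t, R ≤ supNorm t → l i < supNorm (t - z i) := by
  refine ⟨∑ i ∈ Finset.range (N + 1), (supNorm (z i) + |l i|) + 1, fun i hi t ht => ?_⟩
  have h1 : supNorm (z i) + |l i| ≤ ∑ i ∈ Finset.range (N + 1), (supNorm (z i) + |l i|) :=
    Finset.single_le_sum (f := fun i => supNorm (z i) + |l i|)
      (fun i _ => add_nonneg (supNorm_nonneg _) (abs_nonneg _))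
      (Finset.mem_range.2 (Nat.lt_succ_of_le hi))
  have h2 := supNorm_add_le (t - z i) (z i)
  rw [sub_add_cancel] at h2
  have h3 := le_abs_self (l i)
  omega

/-- A chain of rings, consecutive ones surrounding a common site, connects the first ring to the
last one, if these two are not surrounded by other rings of the chain. -/
theorem reachable_of_rings {ω : BondConfig} {N : ℕ} {z : ℕ → Site} {k l : ℕ → ℤ}
    {C : ℕ → Set Site} (hC : ∀ i ≤ N, IsRing ω (z i) (k i) (l i) (C i))
    (hstep : ∀ i < N, supNorm (z (i + 1) - z i) < k i ∨ supNorm (z (i + 1) - z i) < k (i + 1))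
    (hfirst : ∀ i ≤ N, i ≠ 0 → l i < k 0 + supNorm (z i - z 0))
    (hlast : ∀ i < N, l i < k N + supNorm (z i - z N)) :
    ∀ u ∈ C 0, ∀ v ∈ C N, (openGraph ω).Reachable u v := by
  obtain ⟨R, hR⟩ := exists_far N z l
  have hcommon : ∀ i < N, ∃ v, Encloses R (C i) v ∧ Encloses R (C (i + 1)) v := by
    intro i hi
    rcases hstep i hi with h | h
    · exact ⟨z (i + 1), (hC i hi.le).encloses_near (hR i hi.le) h,
        (hC (i + 1) hi).encloses_center (hR (i + 1) hi)⟩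
    · rw [supNorm_sub_comm] at h
      exact ⟨z i, (hC i hi.le).encloses_center (hR i hi.le),
        (hC (i + 1) hi).encloses_near (hR (i + 1) hi) h⟩
  -- Invariant: some ring `j`, already joined by an open-connected set `K` to the first ring,
  -- encloses everything that ring `i` encloses.
  have main : ∀ i ≤ N, ∃ j ≤ N, (∀ w, Encloses R (C i) w → Encloses R (C j) w) ∧
      ∃ K, IsOpenConnected ω K ∧ C 0 ⊆ K ∧ C j ⊆ K := by
    intro i
    induction i with
    | zero =>
      intro _
      exact ⟨0, Nat.zero_le _, fun _ h => h, C 0, (hC 0 (Nat.zero_le _)).connected, subset_rfl,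
        subset_rfl⟩
    | succ i ih =>
      intro hi
      obtain ⟨j, hj, hij, K, hK, h0K, hjK⟩ := ih (by omega)
      by_cases hmeet : ∃ t ∈ K, t ∈ C (i + 1)
      · obtain ⟨t, ht, ht'⟩ := hmeet
        exact ⟨i + 1, hi, fun _ h => h, K ∪ C (i + 1), hK.union (hC _ hi).connected ht ht',
          h0K.trans Set.subset_union_left, Set.subset_union_right⟩
      · push Not at hmeet
        obtain ⟨v, hv, hv'⟩ := hcommon i hi
        rcases encloses_nested (hC j hj).connected (hC (i + 1) hi).connected
          (fun t ht => hmeet t (hjK ht)) (hij v hv) hv' with h | h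
        -- If ring `i + 1` is the outer one, it traps the whole of `K`, which it does not meet, and
        -- in particular the first ring; `hfirst` excludes this.
        · exfalso
          obtain ⟨t, ht⟩ := (hij v hv).exists_mem
          have := hK.encloses_of_disjoint hmeet (hjK ht) (h t (encloses_of_mem ht))
          exact (hC 0 (Nat.zero_le _)).not_enclosed (hC (i + 1) hi)
            (hfirst (i + 1) hi (Nat.succ_ne_zero i)) fun w hw => this w (h0K hw)
        -- If ring `j` is the outer one, ring `i + 1` is skipped and `j` is kept.
        · exact ⟨j, hj, h, K, hK, h0K, hjK⟩
  obtain ⟨j, hj, hNj, K, hK, h0K, hjK⟩ := main N le_rfl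
  rcases hj.lt_or_eq with hj' | rfl
  · exact absurd (fun w hw => hNj w (encloses_of_mem hw))
      ((hC N le_rfl).not_enclosed (hC j hj) (hlast j hj'))
  · intro u hu v hv
    obtain ⟨p, -⟩ := hK u (h0K hu) v (hjK hv)
    exact ⟨p⟩

/-- An open path from the centre of a ring to the outside meets the ring. -/
theorem IsRing.exists_reachable {ω : BondConfig} {z : Site} {k l : ℤ} {C : Set Site}
    (h : IsRing ω z k l C) {v : Site} (hv : l < supNorm (v - z))
    (hr : (openGraph ω).Reachable z v) : ∃ w ∈ C, (openGraph ω).Reachable z w := by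
  obtain ⟨p⟩ := hr
  obtain ⟨w, hw, hwC⟩ := h.separates v (p.mapLe (openGraph_le ω)) hv
  have hw' : w ∈ p.support := by simpa using hw
  exact ⟨w, hwC, ⟨p.takeUntil w hw'⟩⟩

/-! ### Connectivity of the boundary of a set of faces -/

/-- Two faces that share a side. -/
def FaceAdj (f g : Site) : Prop := ∃ e, IsSide f e ∧ IsSide g e

theorem FaceAdj.symm {f g : Site} (h : FaceAdj f g) : FaceAdj g f :=
  let ⟨e, h1, h2⟩ := h
  ⟨e, h2, h1⟩

theorem faceAdj_of_adj {f g : Site} (h : squareLattice.Adj f g) : FaceAdj f g := by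
  rcases adj_cases h with ⟨i, j, rfl, rfl⟩ | ⟨i, j, rfl, rfl⟩ | ⟨i, j, rfl, rfl⟩ | ⟨i, j, rfl, rfl⟩
  · exact ⟨vb (i + 1) j, by simp [isSide_vb], by simp [isSide_vb]⟩
  · exact ⟨vb (i + 1) j, by simp [isSide_vb], by simp [isSide_vb]⟩
  · exact ⟨hb i (j + 1), by simp [isSide_hb], by simp [isSide_hb]⟩
  · exact ⟨hb i (j + 1), by simp [isSide_hb], by simp [isSide_hb]⟩

/-- The bond `e` separates a face in `Q` from a face outside `Q`. -/
def IsCut (Q : Set Site) (e : Bond) : Prop := ∃ f g, IsSide f e ∧ IsSide g e ∧ f ∈ Q ∧ g ∉ Q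

theorem exists_potential_int (g : ℤ → ZMod 2) :
    ∃ h : ℤ → ZMod 2, h 0 = 0 ∧ ∀ i, h (i + 1) = h i + g i := by
  refine ⟨fun n => ∑ i ∈ Finset.Ico 0 n, g i - ∑ i ∈ Finset.Ico n 0, g i, by simp, fun i => ?_⟩
  rcases lt_or_ge i 0 with hi | hi
  · have h1 : Finset.Ico i 0 = insert i (Finset.Ico (i + 1) 0) := by
      ext t; simp only [Finset.mem_Ico, Finset.mem_insert]; omega
    have h2 : Finset.Ico 0 (i + 1) = ∅ := Finset.Ico_eq_empty (by omega)
    have h3 : Finset.Ico 0 i = ∅ := Finset.Ico_eq_empty (by omega)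
    simp only [h1, h2, h3]
    rw [Finset.sum_insert (by simp)]
    simp only [Finset.sum_empty]
    ring
  · have h1 : Finset.Ico 0 (i + 1) = insert i (Finset.Ico 0 i) := by
      ext t; simp only [Finset.mem_Ico, Finset.mem_insert]; omega
    have h2 : Finset.Ico i 0 = ∅ := Finset.Ico_eq_empty (by omega)
    have h3 : Finset.Ico (i + 1) 0 = ∅ := Finset.Ico_eq_empty (by omega)
    simp only [h1, h2, h3]
    rw [Finset.sum_insert (by simp)]
    simp [add_comm]

/-- A cocycle modulo `2` on the square lattice is a coboundary. -/
theorem exists_potential (gH gV : ℤ → ℤ → ZMod 2)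
    (hcocycle : ∀ i j, gH i j + gV (i + 1) j = gV i j + gH i (j + 1)) :
    ∃ h : ℤ → ℤ → ZMod 2, (∀ i j, h (i + 1) j = h i j + gH i j) ∧
      ∀ i j, h i (j + 1) = h i j + gV i j := by
  -- Integrate along row `0`, then along each column; the cocycle relation propagates the horizontal
  -- equation from row to row.
  obtain ⟨A, -, hA⟩ := exists_potential_int fun i => gH i 0
  choose B hB0 hB using fun i => exists_potential_int (gV i)
  refine ⟨fun i j => A i + B i j, fun i j => ?_, fun i j => ?_⟩
  · induction j using Int.induction_on with
    | zero => simp only [hB0, hA]; ring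
    | succ j ih =>
      have := hcocycle i j
      simp only [hB, hA] at ih ⊢
      linear_combination ih + this
    | pred j ih =>
      have := hcocycle i (-j - 1)
      have e1 := hB i (-j - 1)
      have e2 := hB (i + 1) (-j - 1)
      rw [sub_add_cancel] at this e1 e2
      linear_combination ih - this + e1 - e2
  · simp only [hB]; ring

theorem isCut_hb {Q : Set Site} {i j : ℤ} :
    IsCut Q (hb i j) ↔ ¬ ((i, j) ∈ Q ↔ (i, j - 1) ∈ Q) := by
  simp only [IsCut, isSide_hb]
  constructor
  · rintro ⟨f, g, rfl | rfl, rfl | rfl, h1, h2⟩ <;> tauto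
  · intro h
    by_cases h1 : (i, j) ∈ Q
    · exact ⟨(i, j), (i, j - 1), by simp, by simp, h1, by tauto⟩
    · exact ⟨(i, j - 1), (i, j), by simp, by simp, by tauto, h1⟩

theorem isCut_vb {Q : Set Site} {i j : ℤ} :
    IsCut Q (vb i j) ↔ ¬ ((i, j) ∈ Q ↔ (i - 1, j) ∈ Q) := by
  simp only [IsCut, isSide_vb]
  constructor
  · rintro ⟨f, g, rfl | rfl, rfl | rfl, h1, h2⟩ <;> tauto
  · intro h
    by_cases h1 : (i, j) ∈ Q
    · exact ⟨(i, j), (i - 1, j), by simp, by simp, h1, by tauto⟩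
    · exact ⟨(i - 1, j), (i, j), by simp, by simp, by tauto, h1⟩

/-- The boundary bonds of a connected set of faces with connected complement are connected. -/
theorem reachable_of_isCut {Q : Set Site} {f₀ f₁ : Site} {η : BondConfig}
    (hQ : ∀ f ∈ Q, Relation.ReflTransGen (fun f g => FaceAdj f g ∧ f ∈ Q ∧ g ∈ Q) f₀ f)
    (hQc : ∀ f ∉ Q, Relation.ReflTransGen (fun f g => FaceAdj f g ∧ f ∉ Q ∧ g ∉ Q) f f₁)
    (hopen : ∀ e, IsCut Q e → e ∈ η) {u v : Site} {d e : Bond} (hd : IsCut Q d) (hu : u ∈ d.1)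
    (he : IsCut Q e) (hv : v ∈ e.1) : (openGraph η).Reachable u v := by
  classical
  have hmove : ∀ e : Bond, IsCut Q e → ∀ s ∈ e.1, ∀ t ∈ e.1, (openGraph η).Reachable u s →
      (openGraph η).Reachable u t := by
    intro e he s hs t ht hus
    by_cases hst : s = t
    · exact hst ▸ hus
    · have h1 : e.1 = s(s, t) := (Sym2.mem_and_mem_iff hst).1 ⟨hs, ht⟩
      refine hus.trans (SimpleGraph.Adj.reachable (openGraph_adj.2 ⟨adj_of_bond h1, ?_⟩))
      have h2 := hopen e he
      have h3 : e = ⟨s(s, t), adj_of_bond h1⟩ := Subtype.ext h1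
      rwa [h3] at h2
  -- Marked are the boundary bonds in the open cluster of `u`. The aim is to show that all boundary
  -- bonds are marked.
  let mark : Bond → ZMod 2 := fun e =>
    if IsCut Q e ∧ ∃ s ∈ e.1, (openGraph η).Reachable u s then 1 else 0
  have hmark : ∀ (e : Bond) (s : Site), s ∈ e.1 →
      mark e = if IsCut Q e ∧ (openGraph η).Reachable u s then 1 else 0 := by
    intro e s hs
    refine if_congr ⟨?_, ?_⟩ rfl rfl
    · rintro ⟨h1, t, ht, h2⟩
      exact ⟨h1, hmove e h1 t ht s hs h2⟩
    · rintro ⟨h1, h2⟩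
      exact ⟨h1, s, hs, h2⟩
  -- The potential lives on faces and changes exactly across marked bonds. The cocycle relation
  -- around the site `(i + 1, j + 1)` holds because an even number of boundary bonds meet there, and
  -- either all or none of them are marked.
  obtain ⟨h, hH, hV⟩ := exists_potential (fun i j => mark (vb (i + 1) j))
    (fun i j => mark (hb i (j + 1))) (by
      intro i j
      rw [hmark (vb (i + 1) j) (i + 1, j + 1) (by simp [vb]),
        hmark (hb (i + 1) (j + 1)) (i + 1, j + 1) (by simp [hb]),
        hmark (hb i (j + 1)) (i + 1, j + 1) (by simp [hb]),
        hmark (vb (i + 1) (j + 1)) (i + 1, j + 1) (by simp [vb])]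
      by_cases hU : (openGraph η).Reachable u (i + 1, j + 1)
      · simp only [isCut_hb, isCut_vb, hU, and_true, add_sub_cancel_right]
        by_cases c1 : (i, j) ∈ Q <;> by_cases c2 : (i + 1, j) ∈ Q <;>
        by_cases c3 : (i, j + 1) ∈ Q <;> by_cases c4 : (i + 1, j + 1) ∈ Q <;>
        simp only [c1, c2, c3, c4] <;> decide
      · simp [hU])
  have hside : ∀ (e : Bond) (f g : Site), IsSide f e → IsSide g e → f ≠ g →
      h f.1 f.2 + h g.1 g.2 = mark e := by
    intro e f g hf hg hfg
    rcases bond_cases e with ⟨i, j, rfl⟩ | ⟨i, j, rfl⟩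
    · have := hV i (j - 1)
      rw [sub_add_cancel] at this
      rw [isSide_hb] at hf hg
      rcases hf with rfl | rfl <;> rcases hg with rfl | rfl <;> first | exact absurd rfl hfg | skip
      · simp only
        rw [this, add_right_comm, CharTwo.add_self_eq_zero, zero_add]
      · simp only
        rw [this, ← add_assoc, CharTwo.add_self_eq_zero, zero_add]
    · have := hH (i - 1) j
      rw [sub_add_cancel] at this
      rw [isSide_vb] at hf hg
      rcases hf with rfl | rfl <;> rcases hg with rfl | rfl <;> first | exact absurd rfl hfg | skip
      · simp only
        rw [this, add_right_comm, CharTwo.add_self_eq_zero, zero_add]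
      · simp only
        rw [this, ← add_assoc, CharTwo.add_self_eq_zero, zero_add]
  have hconst : ∀ f g, FaceAdj f g → (f ∈ Q ↔ g ∈ Q) → h f.1 f.2 = h g.1 g.2 := by
    rintro f g ⟨e, hf, hg⟩ hfg
    by_cases hne : f = g
    · rw [hne]
    · have h0 := hside e f g hf hg hne
      have hm : mark e = 0 := by
        refine if_neg fun hc => ?_
        rcases bond_cases e with ⟨i, j, rfl⟩ | ⟨i, j, rfl⟩
        · have hc := isCut_hb.1 hc.1
          rw [isSide_hb] at hf hg
          rcases hf with rfl | rfl <;> rcases hg with rfl | rfl <;> tauto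
        · have hc := isCut_vb.1 hc.1
          rw [isSide_vb] at hf hg
          rcases hf with rfl | rfl <;> rcases hg with rfl | rfl <;> tauto
      rw [hm] at h0
      exact CharTwo.add_eq_zero.1 h0
  have hQ' : ∀ f ∈ Q, h f.1 f.2 = h f₀.1 f₀.2 := by
    intro f hf
    have := hQ f hf
    clear hf
    induction this with
    | refl => rfl
    | tail _ hbc ih =>
      rw [← hconst _ _ hbc.1 ⟨fun _ => hbc.2.2, fun _ => hbc.2.1⟩, ih]
  have hQc' : ∀ f ∉ Q, h f.1 f.2 = h f₁.1 f₁.2 := by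
    intro f hf
    have := hQc f hf
    clear hf
    induction this using Relation.ReflTransGen.head_induction_on with
    | refl => rfl
    | head hbc _ ih =>
      rw [hconst _ _ hbc.1 ⟨fun h => absurd h hbc.2.1, fun h => absurd h hbc.2.2⟩, ih]
  -- The potential is constant on `Q` and on its complement, so its jump, the mark, is the same at
  -- every boundary bond; at `d` it is `1`.
  have hval : ∀ e, IsCut Q e → mark e = h f₀.1 f₀.2 + h f₁.1 f₁.2 := by
    rintro e ⟨f, g, hf, hg, hfQ, hgQ⟩
    rw [← hside e f g hf hg (fun hfg => hgQ (hfg ▸ hfQ)), hQ' f hfQ, hQc' g hgQ]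
  have hm : mark e = 1 := by
    rw [hval e he, ← hval d hd]
    exact if_pos ⟨hd, u, hu, SimpleGraph.Reachable.refl _⟩
  have hm' : IsCut Q e ∧ ∃ s ∈ e.1, (openGraph η).Reachable u s := by
    by_contra hcon
    have h0 : mark e = 0 := if_neg hcon
    rw [hm] at h0
    exact one_ne_zero h0
  obtain ⟨-, s, hs, hus⟩ := hm'
  exact hmove e he s hs v hv hus

/-! ### The exploration from outside a box -/

/-- The faces reached from outside the box of size `M` through closed bonds. -/
def Reached (M : ℤ) (ω : BondConfig) : Set Site :=
  {f | ∃ g, OuterFace M g ∧ Relation.ReflTransGen (ClosedStep ω) g f}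

/-- The connected component of the face at the origin in the set of faces that are not reached. -/
def Core (M : ℤ) (ω : BondConfig) : Set Site :=
  {f | Relation.ReflTransGen (fun f g => FaceAdj f g ∧ g ∉ Reached M ω) 0 f}

/-- The bonds all of whose adjacent faces are in `Q`. -/
def innerBonds (Q : Set Site) : Set Bond := {e | ∀ f, IsSide f e → f ∈ Q}

theorem shielded_iff {M k : ℤ} {ω : BondConfig} :
    Shielded M k ω ↔ ∀ f ∈ Reached M ω, OuterFace k f :=
  ⟨fun h f ⟨g, h1, h2⟩ => h f g h1 h2, fun h f g h1 h2 => h f ⟨g, h1, h2⟩⟩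

theorem Shielded.zero_notMem {M k : ℤ} (hk : 1 ≤ k) {ω : BondConfig} (h : Shielded M k ω) :
    (0 : Site) ∉ Reached M ω := by
  intro h0
  refine shielded_iff.1 h 0 h0 ?_
  simp only [Prod.fst_zero, Prod.snd_zero]
  omega

theorem outerFace_mem_reached {M : ℤ} {ω : BondConfig} {f : Site} (h : OuterFace M f) :
    f ∈ Reached M ω := ⟨f, h, .refl⟩

theorem mem_reached_of_closedStep {M : ℤ} {ω : BondConfig} {f g : Site} (h : f ∈ Reached M ω)
    (hfg : ClosedStep ω f g) : g ∈ Reached M ω :=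
  let ⟨s, h1, h2⟩ := h
  ⟨s, h1, h2.tail hfg⟩

theorem core_disjoint {M : ℤ} {ω : BondConfig} (h0 : (0 : Site) ∉ Reached M ω) {f : Site}
    (hf : f ∈ Core M ω) : f ∉ Reached M ω := by
  induction hf with
  | refl => exact h0
  | tail _ h _ => exact h.2

theorem mem_core_of_faceAdj {M : ℤ} {ω : BondConfig} {f g : Site} (h : f ∈ Core M ω) (hfg : FaceAdj f g)
    (hg : g ∉ Reached M ω) : g ∈ Core M ω :=
  Relation.ReflTransGen.tail h ⟨hfg, hg⟩

theorem zero_mem_core (M : ℤ) (ω : BondConfig) : (0 : Site) ∈ Core M ω := Relation.ReflTransGen.refl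

/-- The exploration inspects only sides of reached faces, and no such side is an inner bond of the
core. Resampling the inner bonds therefore does not affect it. -/
theorem reached_congr {M : ℤ} {ω ω' : BondConfig} (h0 : (0 : Site) ∉ Reached M ω)
    (h : ∀ e, e ∉ innerBonds (Core M ω) → (e ∈ ω ↔ e ∈ ω')) : Reached M ω' = Reached M ω := by
  have hn : ∀ f ∈ Reached M ω, ∀ e, IsSide f e → (e ∈ ω ↔ e ∈ ω') := fun f hf e he =>
    h e fun hin => core_disjoint h0 (hin f he) hf
  ext f
  constructor
  · rintro ⟨g, hg, hgf⟩
    induction hgf with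
    | refl => exact outerFace_mem_reached hg
    | @tail b c _ hbc ih =>
      obtain ⟨e, he, hb, hc⟩ := hbc
      exact mem_reached_of_closedStep ih ⟨e, fun h1 => he ((hn b ih e hb).1 h1), hb, hc⟩
  · rintro ⟨g, hg, hgf⟩
    suffices H : f ∈ Reached M ω ∧ f ∈ Reached M ω' from H.2
    induction hgf with
    | refl => exact ⟨outerFace_mem_reached hg, outerFace_mem_reached hg⟩
    | @tail b c _ hbc ih =>
      refine ⟨mem_reached_of_closedStep ih.1 hbc, ?_⟩
      obtain ⟨e, he, hb, hc⟩ := hbc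
      exact mem_reached_of_closedStep ih.2 ⟨e, fun h1 => he ((hn b ih.1 e hb).2 h1), hb, hc⟩

theorem core_congr {M : ℤ} {ω ω' : BondConfig} (h0 : (0 : Site) ∉ Reached M ω)
    (h : ∀ e, e ∉ innerBonds (Core M ω) → (e ∈ ω ↔ e ∈ ω')) : Core M ω' = Core M ω := by
  rw [Core, Core, reached_congr h0 h]

theorem core_subset_box {M : ℤ} {ω : BondConfig} (h0 : (0 : Site) ∉ Reached M ω) {f : Site}
    (hf : f ∈ Core M ω) : -M ≤ f.1 ∧ f.1 < M ∧ -M ≤ f.2 ∧ f.2 < M := by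
  by_contra hcon
  exact core_disjoint h0 hf (outerFace_mem_reached hcon)

/-- The outer face of a boundary bond has been reached, otherwise it would belong to the core; were
the bond closed, the exploration would enter the core through it. -/
theorem isCut_core_open {M : ℤ} {ω : BondConfig} (h0 : (0 : Site) ∉ Reached M ω) {e : Bond}
    (h : IsCut (Core M ω) e) : e ∈ ω := by
  obtain ⟨f, g, hf, hg, hfQ, hgQ⟩ := h
  by_contra he
  have hgR : g ∈ Reached M ω := by
    by_contra hgR
    exact hgQ (mem_core_of_faceAdj hfQ ⟨e, hf, hg⟩ hgR)
  exact core_disjoint h0 hfQ (mem_reached_of_closedStep hgR ⟨e, he, hg, hf⟩)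

theorem core_connected {M : ℤ} {ω : BondConfig} {f : Site} (hf : f ∈ Core M ω) :
    Relation.ReflTransGen (fun f g => FaceAdj f g ∧ f ∈ Core M ω ∧ g ∈ Core M ω) 0 f := by
  induction hf with
  | refl => exact .refl
  | @tail b c hb hbc ih => exact ih.tail ⟨hbc.1, hb, mem_core_of_faceAdj hb hbc.1 hbc.2⟩

theorem reflTransGen_of_walk {S : Set Site} {u v : Site} (p : squareLattice.Walk u v)
    (hp : ∀ w ∈ p.support, w ∉ S) :
    Relation.ReflTransGen (fun f g => FaceAdj f g ∧ f ∉ S ∧ g ∉ S) u v := by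
  induction p with
  | nil => exact .refl
  | cons h p ih =>
    refine .head ⟨faceAdj_of_adj h, hp _ (by simp), hp _ (by simp)⟩ (ih fun w hw => hp w ?_)
    simp [hw]

/-- Outer faces are joined around the box, and reached faces lead back to them along the
exploration. From an unreached face outside the core, a walk towards `(M, M)` cannot enter the core
before it meets a reached face. -/
theorem core_compl_connected {M : ℤ} {ω : BondConfig} (h0 : (0 : Site) ∉ Reached M ω) {f : Site}
    (hf : f ∉ Core M ω) : Relation.ReflTransGen
      (fun f g => FaceAdj f g ∧ f ∉ Core M ω ∧ g ∉ Core M ω) f (M, M) := by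
  have hR : ∀ s, s ∈ Reached M ω → s ∉ Core M ω := fun s hs hc => core_disjoint h0 hc hs
  have houter : ∀ s, OuterFace M s → Relation.ReflTransGen
      (fun f g => FaceAdj f g ∧ f ∉ Core M ω ∧ g ∉ Core M ω) s (M, M) := by
    intro s hs
    by_cases h2 : -M ≤ s.2 ∧ s.2 < M
    · obtain ⟨p, hp⟩ := exists_walk_rect s (s.1, M)
      obtain ⟨q, hq⟩ := exists_walk_rect (s.1, M) (M, M)
      refine (reflTransGen_of_walk p fun w hw => hR w (outerFace_mem_reached ?_)).trans
        (reflTransGen_of_walk q fun w hw => hR w (outerFace_mem_reached ?_))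
      · have := hp w hw
        unfold OuterFace at hs ⊢
        simp only at this
        omega
      · have := hq w hw
        unfold OuterFace
        simp only at this
        omega
    · obtain ⟨p, hp⟩ := exists_walk_rect s (M, s.2)
      obtain ⟨q, hq⟩ := exists_walk_rect (M, s.2) (M, M)
      refine (reflTransGen_of_walk p fun w hw => hR w (outerFace_mem_reached ?_)).trans
        (reflTransGen_of_walk q fun w hw => hR w (outerFace_mem_reached ?_))
      · have := hp w hw
        unfold OuterFace at hs ⊢
        simp only at this
        omega
      · have := hq w hw
        unfold OuterFace
        simp only at this
        omega
  have hreached : ∀ s ∈ Reached M ω, Relation.ReflTransGen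
      (fun f g => FaceAdj f g ∧ f ∉ Core M ω ∧ g ∉ Core M ω) s (M, M) := by
    rintro s ⟨g, hg, hgs⟩
    suffices H : s ∈ Reached M ω ∧ Relation.ReflTransGen
      (fun f g => FaceAdj f g ∧ f ∉ Core M ω ∧ g ∉ Core M ω) s (M, M) from H.2
    induction hgs with
    | refl => exact ⟨outerFace_mem_reached hg, houter g hg⟩
    | @tail b c _ hbc ih =>
      have hc := mem_reached_of_closedStep ih.1 hbc
      refine ⟨hc, .head ⟨?_, hR c hc, hR b ih.1⟩ ih.2⟩
      obtain ⟨e, -, h1, h2⟩ := hbc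
      exact ⟨e, h2, h1⟩
  obtain ⟨p, -⟩ := exists_walk_rect f (M, M)
  generalize hT : ((M, M) : Site) = T at p
  induction p with
  | nil => subst hT; exact .refl
  | @cons u v w h p ih =>
    subst hT
    by_cases hu : u ∈ Reached M ω
    · exact hreached u hu
    · have hv : v ∉ Core M ω := fun hv => hf (mem_core_of_faceAdj hv (faceAdj_of_adj h).symm hu)
      exact .head ⟨faceAdj_of_adj h, hf, hv⟩ (ih hv rfl)

/-- The site `v` is a corner of the face `f`. -/
def IsCorner (f v : Site) : Prop :=
  f.1 ≤ v.1 ∧ v.1 ≤ f.1 + 1 ∧ f.2 ≤ v.2 ∧ v.2 ≤ f.2 + 1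

/-- All faces around `v` are in `Q`. -/
def IsInterior (Q : Set Site) (v : Site) : Prop := ∀ f, IsCorner f v → f ∈ Q

/-- Some face around `v` is in `Q`. -/
def Touches (Q : Set Site) (v : Site) : Prop := ∃ f, IsCorner f v ∧ f ∈ Q

/-- `v` is an endpoint of a bond that separates `Q` from its complement. -/
def IsBoundarySite (Q : Set Site) (v : Site) : Prop := ∃ e, IsCut Q e ∧ v ∈ e.1

theorem IsSide.isCorner {f v : Site} {e : Bond} (h : IsSide f e) (hv : v ∈ e.1) :
    IsCorner f v := by
  obtain ⟨v1, v2⟩ := v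
  rcases h with rfl | rfl | rfl | rfl <;>
  simp only [hb, vb, Sym2.mem_iff, Prod.mk.injEq] at hv <;>
  simp only [IsCorner] <;> omega

theorem exists_isSide (e : Bond) : ∃ f, IsSide f e := by
  rcases bond_cases e with ⟨i, j, rfl⟩ | ⟨i, j, rfl⟩
  · exact ⟨(i, j), by simp [isSide_hb]⟩
  · exact ⟨(i, j), by simp [isSide_vb]⟩

theorem IsInterior.mem_innerBonds {Q : Set Site} {v : Site} (h : IsInterior Q v) {e : Bond}
    (hv : v ∈ e.1) : e ∈ innerBonds Q := fun f hf => h f (hf.isCorner hv)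

theorem touches_of_mem_innerBonds {Q : Set Site} {e : Bond} (h : e ∈ innerBonds Q) {v : Site}
    (hv : v ∈ e.1) : Touches Q v := by
  obtain ⟨f, hf⟩ := exists_isSide e
  exact ⟨f, hf.isCorner hv, h f hf⟩

/-- If no bond at `v` separates, going around `v` shows that its four faces are all in `Q` or all
outside; three of the four bonds suffice. -/
theorem isBoundarySite_of_touches {Q : Set Site} {v : Site} (h : Touches Q v)
    (h' : ¬ IsInterior Q v) : IsBoundarySite Q v := by
  by_contra hcon
  have hnc : ∀ e : Bond, v ∈ e.1 → ¬ IsCut Q e := fun e he hc => hcon ⟨e, hc, he⟩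
  obtain ⟨i, j⟩ := v
  have c1 := hnc (hb i j) (by simp [hb])
  have c2 := hnc (vb i j) (by simp [vb])
  have c3 := hnc (hb (i - 1) j) (by simp [hb])
  rw [isCut_hb] at c1 c3
  rw [isCut_vb] at c2
  have hcor : ∀ f, IsCorner f (i, j) → f = (i, j) ∨ f = (i - 1, j) ∨ f = (i, j - 1) ∨
      f = (i - 1, j - 1) := by
    rintro ⟨f1, f2⟩ hf
    simp only [IsCorner] at hf
    simp only [Prod.mk.injEq]
    omega
  have hall : ∀ f, IsCorner f (i, j) → (f ∈ Q ↔ (i, j) ∈ Q) := by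
    intro f hf
    rcases hcor f hf with rfl | rfl | rfl | rfl <;> tauto
  obtain ⟨f, hf, hfQ⟩ := h
  exact h' fun g hg => (hall g hg).2 ((hall f hf).1 hfQ)

theorem IsBoundarySite.exists_notMem {Q : Set Site} {v : Site} (h : IsBoundarySite Q v) :
    ∃ f, IsCorner f v ∧ f ∉ Q := by
  obtain ⟨e, ⟨f, g, -, hg, -, hgQ⟩, hv⟩ := h
  exact ⟨g, hg.isCorner hv, hgQ⟩

/-- This is what makes the core wired: its boundary sites form part of one open cluster of the
explored configuration. -/
theorem boundary_reachable {M : ℤ} {ω : BondConfig} (h0 : (0 : Site) ∉ Reached M ω) {u v : Site}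
    (hu : IsBoundarySite (Core M ω) u) (hv : IsBoundarySite (Core M ω) v) :
    (openGraph ω).Reachable u v := by
  obtain ⟨d, hd, hud⟩ := hu
  obtain ⟨e, he, hve⟩ := hv
  exact reachable_of_isCut (fun f hf => core_connected hf)
    (fun f hf => core_compl_connected h0 hf) (fun e he => isCut_core_open h0 he) hd hud he hve

theorem IsInterior.bounds {M : ℤ} {ω : BondConfig} (h0 : (0 : Site) ∉ Reached M ω) {v : Site}
    (h : IsInterior (Core M ω) v) : -M < v.1 ∧ v.1 < M ∧ -M < v.2 ∧ v.2 < M := by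
  have h1 := core_subset_box h0 (h (v.1, v.2) (by simp [IsCorner]))
  have h2 := core_subset_box h0 (h (v.1 - 1, v.2 - 1) (by simp [IsCorner]))
  simp only at h1 h2
  omega

theorem mem_core_of_shielded {M k : ℤ} {ω : BondConfig} (h : Shielded M k ω)
    {f : Site} (hf : -k ≤ f.1 ∧ f.1 < k ∧ -k ≤ f.2 ∧ f.2 < k) : f ∈ Core M ω := by
  obtain ⟨p, hp⟩ := exists_walk_rect 0 f
  simp only [Prod.fst_zero, Prod.snd_zero] at hp
  have hp' : ∀ w ∈ p.support, w ∉ Reached M ω := fun w hw hR =>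
    shielded_iff.1 h w hR (by have := hp w hw; omega)
  have key : ∀ (u v : Site) (p : squareLattice.Walk u v), (∀ w ∈ p.support, w ∉ Reached M ω) →
      u ∈ Core M ω → v ∈ Core M ω := by
    intro u v p
    induction p with
    | nil => exact fun _ h => h
    | cons h p ih =>
      exact fun hs hu => ih (fun w hw => hs w (by simp [hw]))
        (mem_core_of_faceAdj hu (faceAdj_of_adj h) (hs _ (by simp)))
  exact key 0 f p hp' (zero_mem_core M ω)

theorem IsBoundarySite.le_supNorm {M k : ℤ} {ω : BondConfig} (h : Shielded M k ω)
    {v : Site} (hv : IsBoundarySite (Core M ω) v) : k ≤ supNorm v := by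
  obtain ⟨f, hf, hfQ⟩ := hv.exists_notMem
  by_contra hcon
  rw [not_le, supNorm_lt_iff] at hcon
  refine hfQ (mem_core_of_shielded h ?_)
  unfold IsCorner at hf
  omega

/-- A path of a graph whose edges at interior sites of `Q` are open either stays in `Q` or
reaches the boundary of `Q`. -/
theorem reachable_or_boundary {Q : Set Site} {H O : SimpleGraph Site}
    (hHO : ∀ u v, H.Adj u v → IsInterior Q u → O.Adj u v ∧ Touches Q v) {u v : Site}
    (hu : Touches Q u) (h : H.Reachable u v) :
    (O.Reachable u v ∧ Touches Q v) ∨ ∃ b, IsBoundarySite Q b ∧ O.Reachable u b := by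
  obtain ⟨p⟩ := h
  induction p with
  | nil => exact Or.inl ⟨SimpleGraph.Reachable.refl _, hu⟩
  | @cons a b c hab p ih =>
    by_cases ha : IsInterior Q a
    · obtain ⟨h1, h2⟩ := hHO _ _ hab ha
      rcases ih h2 with ⟨h3, h4⟩ | ⟨t, h3, h4⟩
      · exact Or.inl ⟨h1.reachable.trans h3, h4⟩
      · exact Or.inr ⟨t, h3, h1.reachable.trans h4⟩
    · exact Or.inr ⟨a, isBoundarySite_of_touches hu ha, SimpleGraph.Reachable.refl _⟩

/-! ### Comparison with the wired one-arm probability -/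

/-- The event that the origin is connected to a site at distance at least `k`. -/
def armEvent (k : ℤ) : Set BondConfig :=
  {ω | ∃ v, k ≤ supNorm v ∧ (openGraph ω).Reachable 0 v}

theorem isUpperSet_armEvent (k : ℤ) : IsUpperSet (armEvent k) :=
  fun _ _ h ⟨v, hv, hr⟩ => ⟨v, hv, hr.mono (openGraph_mono h)⟩

theorem isUpperSet_connectedTo (x : Site) (T : Finset Site) : IsUpperSet (connectedTo x T) :=
  fun _ _ h ⟨v, hv, hr⟩ => ⟨v, hv, hr.mono (openGraph_mono h)⟩

theorem innerBonds_core_mem {M : ℕ} {ω : BondConfig} (h0 : (0 : Site) ∉ Reached M ω) {e : Bond}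
    (he : e ∈ innerBonds (Core M ω)) : e ∈ bondsIn (box M) := by
  rw [mem_bondsIn]
  intro v hv
  obtain ⟨f, hf, hfQ⟩ := touches_of_mem_innerBonds he hv
  have := core_subset_box h0 hfQ
  unfold IsCorner at hf
  rw [mem_box, abs_le, abs_le]
  omega

/-- Interior sites lie strictly inside the box, so the artificial wiring of `∂Λ` does not act on
them. -/
theorem IsInterior.notMem_boundary {M : ℕ} {ω : BondConfig} (h0 : (0 : Site) ∉ Reached M ω)
    {Λ : Finset Site} (hΛ : box M ⊆ Λ) {v : Site} (h : IsInterior (Core M ω) v) :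
    v ∉ boundary Λ := by
  intro hv
  classical
  rw [boundary, Finset.mem_filter] at hv
  obtain ⟨-, w, hvw, hw⟩ := hv
  refine hw (hΛ ?_)
  have hb := h.bounds h0
  rw [mem_box, abs_le, abs_le]
  rcases adj_cases hvw with ⟨i, j, rfl, rfl⟩ | ⟨i, j, rfl, rfl⟩ | ⟨i, j, rfl, rfl⟩ |
    ⟨i, j, rfl, rfl⟩ <;> simp only at hb ⊢ <;> omega

theorem boundary_subset (Λ : Finset Site) : boundary Λ ⊆ Λ := by
  classical
  exact Finset.filter_subset _ _

theorem wiredGraph_adj_cases {W : Finset Site} {ω : BondConfig} {u v : Site}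
    (h : (wiredGraph W ω).Adj u v) : (openGraph ω).Adj u v ∨ (u ∈ W ∧ v ∈ W) := by
  rcases h with h | h
  · exact Or.inl h
  · rw [SimpleGraph.fromRel_adj] at h
    tauto

theorem openGraph_adj_of_interior {Q : Set Site} {ω ω' : BondConfig}
    (hω : ∀ e ∈ innerBonds Q, e ∈ ω → e ∈ ω') {u v : Site} (h : (openGraph ω).Adj u v)
    (hu : IsInterior Q u) : (openGraph ω').Adj u v ∧ Touches Q v := by
  obtain ⟨h1, h2⟩ := openGraph_adj.1 h
  have h3 := hu.mem_innerBonds (e := ⟨s(u, v), h1⟩) (by simp)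
  exact ⟨openGraph_adj.2 ⟨h1, hω _ h3 h2⟩, touches_of_mem_innerBonds h3 (by simp)⟩

section Fibre

variable {M n : ℕ} {k : ℤ} {Λ : Finset Site} {η B : Finset Bond}

theorem touches_zero (M : ℤ) (ω : BondConfig) : Touches (Core M ω) 0 :=
  ⟨0, by simp [IsCorner], zero_mem_core M ω⟩

open Classical in
/-- The lattice condition for the cluster counts of the wired model in `Λ` and of the model whose
configuration `η` outside the inner bonds `B` is given. -/
theorem numClusters_fibre (hMn : M ≤ n) (hΛ : box M ⊆ Λ) (h0 : (0 : Site) ∉ Reached M (η : Set Bond))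
    (hη : η ⊆ bondsIn (box n)) (hB : ∀ e, e ∈ B ↔ e ∈ innerBonds (Core M (η : Set Bond)))
    {a b : Finset Bond} (ha : a ⊆ bondsIn Λ) (hb : bondsIn Λ \ B ⊆ b) :
    numClusters Λ (boundary Λ) (a : Set Bond) +
        numClusters (box n) ∅ ((η ∪ b ∩ B : Finset Bond) : Set Bond) ≤
      numClusters Λ (boundary Λ) ((a ∩ b : Finset Bond) : Set Bond) +
        numClusters (box n) ∅ ((η ∪ (a ∪ b) ∩ B : Finset Bond) : Set Bond) := by
  have hbox : box M ⊆ box n := by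
    intro v hv
    rw [mem_box] at hv ⊢
    omega
  have hBM : B ⊆ bondsIn (box M) := fun e he => innerBonds_core_mem h0 ((hB e).1 he)
  have hD : a \ b ⊆ B := by
    intro e he
    rw [Finset.mem_sdiff] at he
    by_contra heB
    exact he.2 (hb (Finset.mem_sdiff.2 ⟨ha he.1, heB⟩))
  have hF : η ∪ b ∩ B ⊆ bondsIn (box n) :=
    Finset.union_subset hη (Finset.inter_subset_right.trans (hBM.trans (bondsIn_mono hbox)))
  have := clusterCount_compare (supportedIn_openGraph hF)
    (supportedIn_wiredGraph (boundary_subset Λ) (Finset.inter_subset_left.trans ha : a ∩ b ⊆ _))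
    (a \ b) (hD.trans (hBM.trans (bondsIn_mono hbox))) (Finset.sdiff_subset.trans ha) (by
      intro G hG e he u v huv hr
      rw [← wiredGraph_union] at hr
      rw [← openGraph_union]
      set O := openGraph (((η ∪ b ∩ B : Finset Bond) : Set Bond) ∪ (G : Set Bond)) with hO
      have hein := (hB e).1 (hD he)
      have hstep : ∀ s t, (wiredGraph (boundary Λ)
          (((a ∩ b : Finset Bond) : Set Bond) ∪ (G : Set Bond))).Adj s t →
          IsInterior (Core M (η : Set Bond)) s →
          O.Adj s t ∧ Touches (Core M (η : Set Bond)) t := by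
        intro s t hst hs
        rcases wiredGraph_adj_cases hst with h | h
        · refine openGraph_adj_of_interior (fun e he h1 => ?_) h hs
          rcases h1 with h1 | h1
          · left
            have h1 : e ∈ a ∩ b := h1
            have h2 : e ∈ η ∪ b ∩ B := Finset.mem_union_right _
              (Finset.mem_inter.2 ⟨(Finset.mem_inter.1 h1).2, (hB e).2 he⟩)
            exact h2
          · exact Or.inr h1
        · exact absurd h.1 (hs.notMem_boundary h0 hΛ)
      -- A connection in the wired model either stays inside the core, where it uses available bonds
      -- only, or leads both endpoints to the boundary of the core, which is connected through `η`.
      rcases reachable_or_boundary hstep (touches_of_mem_innerBonds hein (by rw [huv]; simp)) hr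
        with h | ⟨s, hs, hus⟩
      · exact h.1
      · rcases reachable_or_boundary hstep (touches_of_mem_innerBonds hein (by rw [huv]; simp))
          hr.symm with h | ⟨t, ht, hvt⟩
        · exact h.1.symm
        · have hsub : (η : Set Bond) ⊆ ((η ∪ b ∩ B : Finset Bond) : Set Bond) ∪ (G : Set Bond) :=
            fun e he => Or.inl (Finset.mem_coe.2 (Finset.mem_union_left _ he))
          have hst : O.Reachable s t :=
            (boundary_reachable h0 hs ht).mono (openGraph_mono hsub)
          exact hus.trans (hst.trans hvt.symm))
  rw [← wiredGraph_union, ← openGraph_union, ← Finset.coe_union, ← Finset.coe_union] at this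
  have e1 : a ∩ b ∪ a \ b = a := by ext; simp; tauto
  have e2 : η ∪ b ∩ B ∪ a \ b = η ∪ (a ∪ b) ∩ B := by
    ext e
    have := @hD e
    simp only [Finset.mem_union, Finset.mem_inter, Finset.mem_sdiff] at this ⊢
    tauto
  rw [e1, e2] at this
  simp only [numClusters, wiredGraph_empty]
  simp only [clusterCount] at this
  omega

open Classical in
theorem relWeight_fibre {y : ℝ} (hy : 0 ≤ y) (hMn : M ≤ n) (hΛ : box M ⊆ Λ)
    (h0 : (0 : Site) ∉ Reached M (η : Set Bond))
    (hη : η ⊆ bondsIn (box n)) (hB : ∀ e, e ∈ B ↔ e ∈ innerBonds (Core M (η : Set Bond)))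
    (hdisj : Disjoint η B) {a b : Finset Bond} (ha : a ⊆ bondsIn Λ) (hb : bondsIn Λ \ B ⊆ b) :
    relWeight y Λ (boundary Λ) a * relWeight y (box n) ∅ (η ∪ b ∩ B) ≤
      relWeight y Λ (boundary Λ) (a ∩ b) * relWeight y (box n) ∅ (η ∪ (a ∪ b) ∩ B) := by
  have h := numClusters_fibre hMn hΛ h0 hη hB ha hb
  have hc : a.card + (η ∪ b ∩ B).card = (a ∩ b).card + (η ∪ (a ∪ b) ∩ B).card := by
    rw [Finset.card_union_of_disjoint (hdisj.mono_right Finset.inter_subset_right),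
      Finset.card_union_of_disjoint (hdisj.mono_right Finset.inter_subset_right)]
    have e1 : (a ∪ b) ∩ B = (b ∩ B) ∪ (a \ b) := by
      ext e
      have h1 : e ∈ a → e ∉ b → e ∈ B := fun h1 h2 => by
        by_contra h3
        exact h2 (hb (Finset.mem_sdiff.2 ⟨ha h1, h3⟩))
      simp only [Finset.mem_union, Finset.mem_inter, Finset.mem_sdiff]
      tauto
    have e2 : Disjoint (b ∩ B) (a \ b) := by
      rw [Finset.disjoint_left]
      intro e he he'
      exact (Finset.mem_sdiff.1 he').2 (Finset.mem_inter.1 he).1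
    rw [e1, Finset.card_union_of_disjoint e2]
    have := Finset.card_inter_add_card_sdiff a b
    omega
  unfold relWeight
  rw [mul_mul_mul_comm, ← pow_add, ← pow_add, mul_mul_mul_comm, ← pow_add, ← pow_add, hc]
  exact mul_le_mul_of_nonneg_left (pow_le_pow_right₀ (by norm_num) h) (by positivity)

-- The arm is followed until it first leaves the interior of the core: so far it uses inner bonds
-- only, and it stands at a boundary site, at distance at least `k`. If it never leaves before its
-- endpoint on `∂Λ`, that endpoint is itself such a site.
open Classical in
theorem armEvent_fibre (hΛ : box M ⊆ Λ) (h0 : (0 : Site) ∉ Reached M (η : Set Bond))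
    (hsh : Shielded M k (η : Set Bond))
    (hB : ∀ e, e ∈ B ↔ e ∈ innerBonds (Core M (η : Set Bond)))
    {b : Finset Bond} (hcon : (b : Set Bond) ∈ connectedTo 0 (boundary Λ)) :
    ((η ∪ b ∩ B : Finset Bond) : Set Bond) ∈ armEvent k := by
  obtain ⟨v, hv, hr⟩ := hcon
  have hstep : ∀ s t, (openGraph (b : Set Bond)).Adj s t → IsInterior (Core M (η : Set Bond)) s →
      (openGraph ((η ∪ b ∩ B : Finset Bond) : Set Bond)).Adj s t ∧
        Touches (Core M (η : Set Bond)) t := by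
    intro s t hst hs
    refine openGraph_adj_of_interior (fun e he h1 => ?_) hst hs
    have h2 : e ∈ η ∪ b ∩ B := Finset.mem_union_right _ (Finset.mem_inter.2 ⟨h1, (hB e).2 he⟩)
    exact h2
  rcases reachable_or_boundary hstep (touches_zero _ _) hr with ⟨h1, h2⟩ | ⟨s, hs, h1⟩
  · refine ⟨v, IsBoundarySite.le_supNorm hsh (isBoundarySite_of_touches h2 fun hint => ?_), h1⟩
    exact hint.notMem_boundary h0 hΛ hv
  · exact ⟨s, hs.le_supNorm hsh, h1⟩

open Classical in
/-- Conditionally on the configuration outside the inner bonds, the arm event dominates the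
wired one-arm event. -/
theorem fibre_inequality {y : ℝ} (hy : 0 ≤ y) (hMn : M ≤ n) (hΛ : box M ⊆ Λ)
    (h0 : (0 : Site) ∉ Reached M (η : Set Bond)) (hsh : Shielded M k (η : Set Bond))
    (hη : η ⊆ bondsIn (box n)) (hB : ∀ e, e ∈ B ↔ e ∈ innerBonds (Core M (η : Set Bond)))
    (hdisj : Disjoint η B) :
    (∑ F ∈ (bondsIn Λ).powerset, if (F : Set Bond) ∈ connectedTo 0 (boundary Λ) then
        relWeight y Λ (boundary Λ) F else 0) * ∑ F ∈ B.powerset, relWeight y (box n) ∅ (η ∪ F) ≤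
      (∑ F ∈ (bondsIn Λ).powerset, relWeight y Λ (boundary Λ) F) *
        ∑ F ∈ B.powerset, if ((η ∪ F : Finset Bond) : Set Bond) ∈ armEvent k then
          relWeight y (box n) ∅ (η ∪ F) else 0 := by
  have hBΛ : B ⊆ bondsIn Λ := fun e he =>
    bondsIn_mono hΛ (innerBonds_core_mem h0 ((hB e).1 he))
  -- A configuration of the inner bonds is extended to `Λ` by opening all other bonds. Both factors
  -- become sums over the same power set, and the lattice condition is needed only for maximal
  -- outside configurations.
  have hsum : ∀ φ : Finset Bond → ℝ, ∑ F ∈ B.powerset, φ F =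
      ∑ F ∈ (bondsIn Λ).powerset, if bondsIn Λ \ B ⊆ F then φ (F ∩ B) else 0 := by
    intro φ
    rw [← Finset.sum_filter]
    refine Finset.sum_bij' (fun F _ => F ∪ (bondsIn Λ \ B)) (fun F _ => F ∩ B) ?_ ?_ ?_ ?_ ?_
    · intro F hF
      rw [Finset.mem_powerset] at hF
      rw [Finset.mem_filter, Finset.mem_powerset]
      exact ⟨Finset.union_subset (hF.trans hBΛ) Finset.sdiff_subset, Finset.subset_union_right⟩
    · intro F _
      rw [Finset.mem_powerset]
      exact Finset.inter_subset_right
    · intro F hF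
      rw [Finset.mem_powerset] at hF
      ext e
      have := @hF e
      simp only [Finset.mem_inter, Finset.mem_union, Finset.mem_sdiff]
      tauto
    · intro F hF
      rw [Finset.mem_filter, Finset.mem_powerset] at hF
      ext e
      have h1 := @hF.1 e
      have h2 := @hF.2 e
      simp only [Finset.mem_inter, Finset.mem_union, Finset.mem_sdiff] at h2 ⊢
      tauto
    · intro F hF
      rw [Finset.mem_powerset] at hF
      congr 1
      ext e
      have := @hF e
      simp only [Finset.mem_inter, Finset.mem_union, Finset.mem_sdiff]
      tauto
  rw [hsum, hsum]
  have hn : ∀ F, 0 ≤ relWeight y (box n) ∅ F := relWeight_nonneg hy _ _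
  refine four_sums (bondsIn Λ) ?_ ?_ (relWeight_nonneg hy _ _) ?_ ?_
  · intro F
    split_ifs
    exacts [relWeight_nonneg hy _ _ _, le_rfl]
  · intro F
    split_ifs
    exacts [hn _, le_rfl]
  · intro F
    split_ifs
    exacts [hn _, le_rfl, le_rfl]
  · intro a ha b hb
    have hpos : 0 ≤ relWeight y Λ (boundary Λ) (a ∩ b) * (if bondsIn Λ \ B ⊆ a ∪ b then
        if ((η ∪ (a ∪ b) ∩ B : Finset Bond) : Set Bond) ∈ armEvent k then
          relWeight y (box n) ∅ (η ∪ (a ∪ b) ∩ B) else 0 else 0) := by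
      refine mul_nonneg (relWeight_nonneg hy _ _ _) ?_
      split_ifs
      exacts [hn _, le_rfl, le_rfl]
    by_cases h1 : (a : Set Bond) ∈ connectedTo 0 (boundary Λ)
    · by_cases h2 : bondsIn Λ \ B ⊆ b
      · rw [if_pos h1, if_pos h2, if_pos (h2.trans Finset.subset_union_right), if_pos]
        · exact relWeight_fibre hy hMn hΛ h0 hη hB hdisj ha h2
        · refine armEvent_fibre hΛ h0 hsh hB (isUpperSet_connectedTo _ _ ?_ h1)
          simp
      · rw [if_neg h2, mul_zero]
        exact hpos
    · rw [if_neg h1, zero_mul]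
      exact hpos

end Fibre

/-- Decomposition of a sum over configurations according to their restriction to the complement of
an explored region `inner F`, when this region depends on that restriction only. -/
theorem sum_fibres {α : Type*} [DecidableEq α] {E : Finset α} {S : Finset (Finset α)}
    {inner : Finset α → Finset α} (hSE : ∀ F ∈ S, F ⊆ E) (hin : ∀ F, inner F ⊆ E)
    (hcongr : ∀ F ∈ S, ∀ F' ⊆ E, (∀ e, e ∉ inner F → (e ∈ F ↔ e ∈ F')) →
      F' ∈ S ∧ inner F' = inner F) (φ : Finset α → ℝ) :
    ∑ F ∈ S, φ F =
      ∑ η ∈ S.image fun F => F \ inner F, ∑ F ∈ (inner η).powerset, φ (η ∪ F) := by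
  have key : ∀ F ∈ S, F \ inner F ∈ S ∧ inner (F \ inner F) = inner F := fun F hF =>
    hcongr F hF _ (Finset.sdiff_subset.trans (hSE F hF)) (fun e he => by simp [he])
  have hunion : ∀ F I : Finset α, F \ I ∪ F ∩ I = F := fun F I => by
    rw [Finset.sdiff_union_inter]
  have hinter : ∀ F I G : Finset α, G ⊆ I → (F \ I ∪ G) ∩ I = G := fun F I G h => by
    rw [Finset.union_inter_distrib_right, Finset.sdiff_inter_self, Finset.empty_union,
      Finset.inter_eq_left.2 h]
  have hsdiff : ∀ F I G : Finset α, G ⊆ I → (F \ I ∪ G) \ I = F \ I := fun F I G h => by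
    rw [Finset.union_sdiff_distrib, Finset.sdiff_idem, Finset.sdiff_eq_empty_iff_subset.2 h,
      Finset.union_empty]
  rw [← Finset.sum_fiberwise_of_maps_to (g := fun F => F \ inner F)
    (fun F hF => Finset.mem_image_of_mem _ hF)]
  refine Finset.sum_congr rfl fun η hη => ?_
  obtain ⟨F₀, hF₀, rfl⟩ := Finset.mem_image.1 hη
  have hF : ∀ F ∈ S.filter (fun F => F \ inner F = F₀ \ inner F₀), inner F = inner F₀ ∧
      F \ inner F₀ = F₀ \ inner F₀ := by
    intro F hF
    rw [Finset.mem_filter] at hF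
    have h1 : inner F = inner F₀ := by rw [← (key F hF.1).2, hF.2, (key F₀ hF₀).2]
    refine ⟨h1, ?_⟩
    have h2 := hF.2
    rwa [h1] at h2
  refine Finset.sum_bij' (fun F _ => F ∩ inner F₀) (fun F _ => F₀ \ inner F₀ ∪ F) ?_ ?_ ?_ ?_ ?_
  · intro F _
    rw [Finset.mem_powerset, (key F₀ hF₀).2]
    exact Finset.inter_subset_right
  · intro G hG
    rw [Finset.mem_powerset, (key F₀ hF₀).2] at hG
    have h1 := hcongr F₀ hF₀ (F₀ \ inner F₀ ∪ G)
      (Finset.union_subset (Finset.sdiff_subset.trans (hSE F₀ hF₀)) (hG.trans (hin F₀)))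
      (fun e he => by
        have : e ∉ G := fun h => he (hG h)
        simp [he, this])
    rw [Finset.mem_filter]
    exact ⟨h1.1, by rw [h1.2, hsdiff _ _ _ hG]⟩
  · intro F h
    rw [← (hF F h).2, hunion]
  · intro G hG
    rw [Finset.mem_powerset, (key F₀ hF₀).2] at hG
    exact hinter _ _ _ hG
  · intro F h
    rw [← (hF F h).2, hunion]

/-- The arm event in a free box dominates the wired one-arm event times the probability that the
neighbourhood of the origin is shielded. -/
theorem fkProb_armEvent_ge {p : ℝ} (hp0 : 0 ≤ p) (hp : p < 1) {M n : ℕ} {k : ℤ} (hk : 1 ≤ k)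
    (hMn : M ≤ n) {Λ : Finset Site} (hΛ : box M ⊆ Λ) :
    fkProb p Λ (boundary Λ) (connectedTo 0 (boundary Λ)) *
        fkProb p (box n) ∅ {ω | Shielded M k ω} ≤
      fkProb p (box n) ∅ (armEvent k) := by
  classical
  have hy : 0 ≤ p / (1 - p) := div_nonneg hp0 (by linarith)
  set y := p / (1 - p) with hy_def
  have hbox : box M ⊆ box n := by
    intro v hv
    rw [mem_box] at hv ⊢
    omega
  set E := bondsIn (box n) with hE
  -- The inner bonds of the core are the unexplored region; both it and shielding are determined by
  -- the other bonds, as `sum_fibres` requires.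
  let inner : Finset Bond → Finset Bond := fun F =>
    E.filter fun e => e ∈ innerBonds (Core M (F : Set Bond))
  let S : Finset (Finset Bond) := E.powerset.filter fun F => Shielded M k (F : Set Bond)
  have hS : ∀ F, F ∈ S ↔ F ⊆ E ∧ Shielded M k (F : Set Bond) := fun F => by
    simp only [S, Finset.mem_filter, Finset.mem_powerset]
  have hinner : ∀ F ∈ S, ∀ e, e ∈ inner F ↔ e ∈ innerBonds (Core M (F : Set Bond)) := by
    intro F hF e
    simp only [inner, Finset.mem_filter, and_iff_right_iff_imp]
    exact fun he => bondsIn_mono hbox (innerBonds_core_mem (((hS F).1 hF).2.zero_notMem hk) he)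
  have hcongr : ∀ F ∈ S, ∀ F' ⊆ E, (∀ e, e ∉ inner F → (e ∈ F ↔ e ∈ F')) →
      F' ∈ S ∧ inner F' = inner F := by
    intro F hF F' hF' h
    have h0 := ((hS F).1 hF).2.zero_notMem hk
    have h' : ∀ e, e ∉ innerBonds (Core M (F : Set Bond)) →
        (e ∈ (F : Set Bond) ↔ e ∈ (F' : Set Bond)) := fun e he =>
      h e fun h1 => he ((hinner F hF e).1 h1)
    refine ⟨(hS F').2 ⟨hF', ?_⟩, ?_⟩
    · rw [shielded_iff, reached_congr h0 h', ← shielded_iff]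
      exact ((hS F).1 hF).2
    · simp only [inner]
      rw [core_congr h0 h']
  have hfib := sum_fibres (fun F hF => ((hS F).1 hF).1) (fun F => Finset.filter_subset _ _) hcongr
  set A := ∑ F ∈ (bondsIn Λ).powerset, (if (F : Set Bond) ∈ connectedTo 0 (boundary Λ) then
        relWeight y Λ (boundary Λ) F else 0) with hA
  set Z := ∑ F ∈ (bondsIn Λ).powerset, relWeight y Λ (boundary Λ) F with hZ
  -- The domination holds on every fibre of the exploration, with the same constants `A` and `Z`,
  -- and is summed over the fibres.
  have hmain : A * ∑ F ∈ S, relWeight y (box n) ∅ F ≤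
      Z * ∑ F ∈ S, if (F : Set Bond) ∈ armEvent k then relWeight y (box n) ∅ F else 0 := by
    rw [hfib, hfib, Finset.mul_sum, Finset.mul_sum]
    refine Finset.sum_le_sum fun η hη => ?_
    obtain ⟨F₀, hF₀, rfl⟩ := Finset.mem_image.1 hη
    have hF₀E := ((hS F₀).1 hF₀).1
    have h1 := hcongr F₀ hF₀ _ (Finset.sdiff_subset.trans hF₀E : F₀ \ inner F₀ ⊆ E)
      (fun e he => by simp [he])
    have h2 := ((hS _).1 h1.1).2
    refine fibre_inequality hy hMn hΛ (h2.zero_notMem hk) h2 ((hS _).1 h1.1).1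
      (hinner _ h1.1) (?_ : Disjoint (F₀ \ inner F₀) (inner (F₀ \ inner F₀)))
    rw [h1.2]
    exact Finset.sdiff_disjoint
  have hZpos : 0 < Z := partition_pos hy _ _
  have hZn : 0 < ∑ F ∈ E.powerset, relWeight y (box n) ∅ F := partition_pos hy _ _
  have e1 : (∑ F ∈ E.powerset, if (F : Set Bond) ∈ {ω | Shielded M k ω} then
      relWeight y (box n) ∅ F else 0) = ∑ F ∈ S, relWeight y (box n) ∅ F := by
    rw [Finset.sum_filter]
    rfl
  have e2 : ∑ F ∈ S, (if (F : Set Bond) ∈ armEvent k then relWeight y (box n) ∅ F else 0) ≤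
      ∑ F ∈ E.powerset, if (F : Set Bond) ∈ armEvent k then relWeight y (box n) ∅ F else 0 := by
    refine Finset.sum_le_sum_of_subset_of_nonneg (Finset.filter_subset _ _) fun F _ _ => ?_
    split_ifs
    exacts [relWeight_nonneg hy _ _ _, le_rfl]
  have hfinal := hmain.trans (mul_le_mul_of_nonneg_left e2 hZpos.le)
  rw [fkProb_eq hp, fkProb_eq hp, fkProb_eq hp, ← hy_def, ← hE, e1, ← mul_div_assoc]
  refine div_le_div_of_nonneg_right ?_ hZn.le
  rw [div_mul_eq_mul_div, div_le_iff₀ hZpos, mul_comm _ Z]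
  exact hfinal

/-! ### Translated events -/

/-- Translation as a homomorphism from the translated graph of open bonds. -/
def shiftHom (z : Site) (ω : BondConfig) : openGraph (shiftBond z ⁻¹' ω) →g openGraph ω :=
  ⟨fun v => v + z, fun h => (openGraph_shift_adj z ω).1 h⟩

/-- Translation as a homomorphism of the square lattice. -/
def latticeShiftHom (z : Site) : squareLattice →g squareLattice :=
  ⟨fun v => v + z, fun h => (squareLattice_adj_add z).2 h⟩

theorem IsRing.shift {ω : BondConfig} {z : Site} {k l : ℤ} {C : Set Site}
    (h : IsRing (shiftBond z ⁻¹' ω) 0 k l C) : IsRing ω z k l {v | v - z ∈ C} := by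
  refine ⟨fun v hv => ?_, fun v hv => ?_, fun u hu v hv => ?_, fun v p hv => ?_⟩
  · simpa using h.lower (v - z) hv
  · simpa using h.upper (v - z) hv
  · obtain ⟨p, hp⟩ := h.connected _ hu _ hv
    have e1 : shiftHom z ω (u - z) = u := sub_add_cancel u z
    have e2 : shiftHom z ω (v - z) = v := sub_add_cancel v z
    refine ⟨(p.map (shiftHom z ω)).copy e1 e2, fun w hw => ?_⟩
    rw [SimpleGraph.Walk.support_copy, SimpleGraph.Walk.support_map, List.mem_map] at hw
    obtain ⟨t, ht, rfl⟩ := hw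
    have e3 : shiftHom z ω t - z = t := add_sub_cancel_right t z
    rw [Set.mem_ofPred_eq, e3]
    exact hp t ht
  · have e1 : latticeShiftHom (-z) z = 0 := add_neg_cancel z
    have e2 : latticeShiftHom (-z) v = v - z := (sub_eq_add_neg v z).symm
    obtain ⟨w, hw, hwC⟩ := h.separates (v - z) ((p.map (latticeShiftHom (-z))).copy e1 e2)
      (by simpa using hv)
    rw [SimpleGraph.Walk.support_copy, SimpleGraph.Walk.support_map, List.mem_map] at hw
    obtain ⟨t, ht, rfl⟩ := hw
    refine ⟨t, ht, ?_⟩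
    have e3 : latticeShiftHom (-z) t = t - z := (sub_eq_add_neg t z).symm
    rwa [e3] at hwC

theorem exists_of_mem_shiftEvent_armEvent {z : Site} {k : ℤ} {ω : BondConfig}
    (h : ω ∈ shiftEvent z (armEvent k)) :
    ∃ v, k ≤ supNorm (v - z) ∧ (openGraph ω).Reachable z v := by
  obtain ⟨v, hv, hr⟩ := h
  refine ⟨v + z, by simpa using hv, ?_⟩
  have := hr.map (shiftHom z ω)
  have e1 : shiftHom z ω 0 = z := zero_add z
  rwa [e1] at this

theorem shiftEvent_connectedTo_subset (x y : Site) :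
    shiftEvent x (connectedTo 0 {y - x}) ⊆ connectedTo x {y} := by
  rintro ω ⟨v, hv, hr⟩
  rw [Finset.mem_singleton] at hv
  subst hv
  refine ⟨y, by simp, ?_⟩
  have := hr.map (shiftHom x ω)
  have e1 : shiftHom x ω 0 = x := zero_add x
  have e2 : shiftHom x ω (y - x) = y := sub_add_cancel y x
  rwa [e1, e2] at this

/-! ### Consequences of the RSW bound -/

theorem betaC_nonneg : 0 ≤ betaC := Real.sSup_nonneg fun _ h => h.1

theorem pC_nonneg : 0 ≤ pC := by
  have : Real.exp (-2 * betaC) ≤ 1 := Real.exp_le_one_iff.2 (by linarith [betaC_nonneg])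
  unfold pC
  linarith

theorem pC_lt_one : pC < 1 := by
  have := Real.exp_pos (-2 * betaC)
  unfold pC
  linarith

theorem not_hasOpenCircuit_empty (a : ℝ) (x : Plane) (r₁ r₂ : ℝ) :
    ¬ HasOpenCircuit a x r₁ r₂ ∅ := by
  rintro ⟨v, γ, hγ, -⟩
  cases γ with
  | nil => exact hγ.not_nil SimpleGraph.Walk.nil_nil
  | cons h _ =>
    rw [openGraph_empty] at h
    exact h

/-- At density `0` only the empty configuration has weight. Since it contains no circuit, this will
force `pC` to be positive. -/
theorem fkProb_zero {Λ W : Finset Site} {A : Set BondConfig} (hA : (∅ : BondConfig) ∉ A) :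
    fkProb 0 Λ W A = 0 := by
  classical
  rw [fkProb_eq (by norm_num)]
  rw [Finset.sum_eq_zero, zero_div]
  intro F _
  split_ifs with h
  · have hne : F.card ≠ 0 := by
      intro h0
      rw [Finset.card_eq_zero] at h0
      subst h0
      exact hA (by simpa using h)
    rw [relWeight, zero_div, zero_pow hne, zero_mul]
  · rfl

/-- Under the RSW bound there are, at all large scales, increasing events of probability bounded
below that force rings around the origin and shield its neighbourhood. -/
theorem exists_ring_events {p : ℝ} {P : Measure BondConfig} (hP : IsFKMeasure p P)
    (hRSW : RSWLowerBound P) : ∃ (c : ℝ) (m k₀ : ℕ) (A : ℕ → Set BondConfig), 0 < c ∧ 1 ≤ m ∧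
      (∀ k, IsUpperSet (A k)) ∧ (∀ k, (∅ : BondConfig) ∉ A k) ∧ ∀ k ≥ k₀,
      (∀ᶠ n : ℕ in atTop, c ≤ fkProb p (box n) ∅ (A k)) ∧
      (∀ ω ∈ A k, ∃ C, IsRing ω 0 k (m * k : ℕ) C) ∧
      ∀ M : ℕ, m * k ≤ M → ∀ ω ∈ A k, Shielded M k ω := by
  obtain ⟨hprob, hlim⟩ := hP
  obtain ⟨r₁, r₂, hr, hr₂, hpos⟩ := hRSW 0
  obtain ⟨c, hc, hc'⟩ := exists_between hpos
  -- A real-valued liminf carries information only for functions bounded below, here by `0`.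
  have hev := eventually_lt_of_lt_liminf hc'
    (isBoundedUnder_of ⟨0, fun a => measureReal_nonneg⟩)
  obtain ⟨ε, hε, hε'⟩ := mem_nhdsGT_iff_exists_Ioo_subset.1 hev
  rw [Set.mem_Ioi] at hε
  -- The mesh `r₁ / (2 * k)` turns the inner radius into `k` and the outer one into at most `m * k`
  -- lattice units in sup norm; the threshold on `k` makes this mesh smaller than `ε`.
  refine ⟨c, ⌈2 * r₂ / r₁⌉₊, ⌊r₁ / (2 * ε)⌋₊ + 1, fun k => {ω | HasOpenCircuit (r₁ / (2 * k)) 0 r₁ r₂ ω},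
    hc, ?_, fun k => isUpperSet_hasOpenCircuit _ _ _ _,
    fun k => not_hasOpenCircuit_empty _ _ _ _, fun k hk => ?_⟩
  · exact Nat.ceil_pos.2 (by have := hr.trans hr₂; positivity)
  have hk0 : (0 : ℝ) < k := by exact_mod_cast (by omega : 0 < k)
  have hk1 : r₁ / (2 * ε) < k :=
    (Nat.lt_floor_add_one _).trans_le (by exact_mod_cast hk)
  set a := r₁ / (2 * k) with ha_def
  have ha : 0 < a := by positivity
  have haε : a < ε := by
    rw [div_lt_iff₀ (by positivity)] at hk1
    rw [ha_def, div_lt_iff₀ (by positivity)]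
    linarith
  have hka : 2 * (k : ℝ) * a = r₁ := by rw [ha_def]; field_simp
  have hla : r₂ ≤ ((⌈2 * r₂ / r₁⌉₊ * k : ℕ) : ℝ) * a := by
    have h1 := Nat.le_ceil (2 * r₂ / r₁)
    rw [div_le_iff₀ hr] at h1
    rw [Nat.cast_mul, mul_assoc, ha_def]
    have : (k : ℝ) * (r₁ / (2 * k)) = r₁ / 2 := by field_simp
    rw [this]
    linarith
  refine ⟨?_, ?_, ?_⟩
  · have h1 := hlim _ (isLocalBondEvent_hasOpenCircuit ha r₁ r₂)
    have h2 : c < P.real {ω | HasOpenCircuit a 0 r₁ r₂ ω} := hε' ⟨ha, haε⟩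
    filter_upwards [h1.eventually (lt_mem_nhds h2)] with n hn
    exact hn.le
  · intro ω hω
    exact exists_isRing ha hr hr₂ (by exact_mod_cast hka.le) (by exact_mod_cast hla) hω
  · intro M hM ω hω
    exact shielded_of_hasOpenCircuit ha hr hr₂ (l := (⌈2 * r₂ / r₁⌉₊ * k : ℕ))
      (by exact_mod_cast hka.le) (by exact_mod_cast hla) (by exact_mod_cast hM) hω

/-- One box where the bound holds is enough: every box containing its translate inherits the bound.
-/
theorem eventually_le_shiftEvent {p : ℝ} (hp0 : 0 ≤ p) (hp : p < 1) {A : Set BondConfig}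
    (hA : IsUpperSet A) {c : ℝ} (h : ∀ᶠ n : ℕ in atTop, c ≤ fkProb p (box n) ∅ A) (z : Site) :
    ∀ᶠ n : ℕ in atTop, c ≤ fkProb p (box n) ∅ (shiftEvent z A) := by
  obtain ⟨m, hm⟩ := h.exists
  filter_upwards [eventually_ge_atTop (m + z.1.natAbs + z.2.natAbs)] with n hn
  refine hm.trans (fkProb_box_le_shift hp0 hp ?_ ?_ hA)
  · rw [Int.abs_eq_natAbs]; omega
  · rw [Int.abs_eq_natAbs]; omega

/-! ### A chain of sites -/

/-- The `j`-th of `N + 1` sites along the segment from `x` to `y`. -/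
def segmentSite (N : ℕ) (x y : Site) (j : ℕ) : Site :=
  (x.1 + j * (y.1 - x.1) / N, x.2 + j * (y.2 - x.2) / N)

theorem segmentSite_zero (N : ℕ) (x y : Site) : segmentSite N x y 0 = x := by
  simp [segmentSite]

theorem segmentSite_last {N : ℕ} (hN : N ≠ 0) (x y : Site) : segmentSite N x y N = y := by
  have : (N : ℤ) ≠ 0 := by exact_mod_cast hN
  refine Prod.ext ?_ ?_ <;>
  · simp only [segmentSite]
    rw [Int.mul_ediv_cancel_left _ this]
    ring

/-- Rounding costs less than one unit: the increment is below `|d| / N + 1 ≤ k / 2 + 1 ≤ k`. -/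
theorem ediv_step {N : ℕ} (hN : 0 < N) {k d : ℤ} (hk : 2 ≤ k) (hd : 2 * |d| ≤ N * k) (j : ℕ) :
    -k < (↑(j + 1) * d / N - j * d / N) ∧ (↑(j + 1) * d / N - j * d / N) < k := by
  have hN' : (0 : ℤ) < N := by exact_mod_cast hN
  obtain ⟨h1, h2⟩ := abs_le.1 (by linarith : |d| ≤ |d|)
  have a1 := Int.mul_ediv_self_le (x := ↑(j + 1) * d) hN'.ne'
  have a2 := Int.lt_mul_ediv_self_add (x := ↑(j + 1) * d) hN'
  have b1 := Int.mul_ediv_self_le (x := j * d) hN'.ne'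
  have b2 := Int.lt_mul_ediv_self_add (x := j * d) hN'
  have e : ((j + 1 : ℕ) : ℤ) * d = j * d + d := by push_cast; ring
  rw [e] at a1 a2 ⊢
  set s := (j * d + d) / (N : ℤ)
  set t := j * d / (N : ℤ)
  constructor
  · refine lt_of_mul_lt_mul_left (a := (N : ℤ)) ?_ hN'.le
    nlinarith
  · refine lt_of_mul_lt_mul_left (a := (N : ℤ)) ?_ hN'.le
    nlinarith

theorem supNorm_segmentSite_step {N : ℕ} (hN : 0 < N) {k : ℤ} (hk : 2 ≤ k) {x y : Site}
    (hd : 2 * supNorm (y - x) ≤ N * k) (j : ℕ) :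
    supNorm (segmentSite N x y (j + 1) - segmentSite N x y j) < k := by
  have h1 : |y.1 - x.1| ≤ supNorm (y - x) := le_max_left _ _
  have h2 : |y.2 - x.2| ≤ supNorm (y - x) := le_max_right _ _
  have s1 := ediv_step hN hk (d := y.1 - x.1) (by linarith) j
  have s2 := ediv_step hN hk (d := y.2 - x.2) (by linarith) j
  rw [supNorm_lt_iff, Prod.fst_sub, Prod.snd_sub]
  simp only [segmentSite, add_sub_add_left_eq_sub]
  exact ⟨s1.1, s1.2, s2.1, s2.2⟩

/-- Rings along a chain, together with arms from `x` and from `y`, connect `x` to `y`. -/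
theorem connected_of_rings {N m k : ℕ} (hN : 0 < N) (hm : 1 ≤ m) (hk : 2 ≤ k) {x y : Site}
    (hd : 2 * supNorm (y - x) ≤ N * k) (hd' : 2 * m * m * k ≤ supNorm (y - x)) {ω : BondConfig}
    (hring : ∀ i < N + 3, ∃ C, IsRing ω (segmentSite N x y (min (i - 1) N))
      ((if i = 0 ∨ i = N + 2 then 2 * m * k else k : ℕ) : ℤ)
      ((m * (if i = 0 ∨ i = N + 2 then 2 * m * k else k) : ℕ) : ℤ) C)
    (hx : ω ∈ shiftEvent x (armEvent ((4 * m * m * k : ℕ) : ℤ)))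
    (hy : ω ∈ shiftEvent y (armEvent ((4 * m * m * k : ℕ) : ℤ))) :
    (openGraph ω).Reachable x y := by
  choose! C hC using hring
  have hmk : 0 < m * k := by positivity
  -- By truncated subtraction and the minimum, the indices `0` and `1` are both centred at `x`, and
  -- `N + 1` and `N + 2` at `y`: each end carries a large ring and a small one.
  have hz0 : segmentSite N x y (min (0 - 1) N) = x := by simp [segmentSite_zero]
  have hzN : segmentSite N x y (min (N + 2 - 1) N) = y := by
    rw [min_eq_right (by omega), segmentSite_last hN.ne']
  have hsym := supNorm_sub_comm x y
  have hconn := reachable_of_rings (N := N + 2)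
    (z := fun i => segmentSite N x y (min (i - 1) N))
    (k := fun i => ((if i = 0 ∨ i = N + 2 then 2 * m * k else k : ℕ) : ℤ))
    (l := fun i => ((m * (if i = 0 ∨ i = N + 2 then 2 * m * k else k) : ℕ) : ℤ)) (C := C)
    (fun i hi => hC i (by omega)) ?_ ?_ ?_
  · have hx0 := hC 0 (by omega)
    have hyN := hC (N + 2) (by omega)
    simp only [true_or, or_true, if_true] at hx0 hyN
    rw [hz0] at hx0
    rw [hzN] at hyN
    -- The arms extend beyond the outer radius `2 m² k` of the end rings, so they cross them.
    have hl : ((m * (2 * m * k) : ℕ) : ℤ) < ((4 * m * m * k : ℕ) : ℤ) := by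
      have : m * (2 * m * k) < 4 * m * m * k := by nlinarith
      exact_mod_cast this
    obtain ⟨v, hv, hxv⟩ := exists_of_mem_shiftEvent_armEvent hx
    obtain ⟨w, hw, hyw⟩ := exists_of_mem_shiftEvent_armEvent hy
    obtain ⟨s, hs, hxs⟩ := hx0.exists_reachable (hl.trans_le hv) hxv
    obtain ⟨t, ht, hyt⟩ := hyN.exists_reachable (hl.trans_le hw) hyw
    exact hxs.trans ((hconn s hs t ht).trans hyt.symm)
  · intro i hi
    left
    have hlt : supNorm (segmentSite N x y (min (i + 1 - 1) N) -
        segmentSite N x y (min (i - 1) N)) < k := by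
      rcases Nat.eq_zero_or_pos i with rfl | hi0
      · simp only [zero_add, Nat.sub_self, Nat.zero_sub, sub_self]
        rw [supNorm_lt_iff]
        simp only [Prod.fst_zero, Prod.snd_zero]
        omega
      · by_cases hiN : i ≤ N
        · obtain ⟨j, rfl⟩ := Nat.exists_eq_add_of_le' hi0
          rw [min_eq_left (by omega), min_eq_left (by omega)]
          exact supNorm_segmentSite_step hN (by exact_mod_cast hk) hd j
        · rw [min_eq_right (by omega), min_eq_right (by omega), sub_self, supNorm_lt_iff]
          simp only [Prod.fst_zero, Prod.snd_zero]
          omega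
    refine hlt.trans_le ?_
    have : k ≤ if i = 0 ∨ i = N + 2 then 2 * m * k else k := by
      split_ifs
      · nlinarith
      · exact le_rfl
    exact_mod_cast this
  -- Small rings have outer radius `m k`, below the inner radius `2 m k` of the ring at `x`; the
  -- ring at `y` is too far away by `hd'`.
  · intro i hi hi0
    simp only [true_or, if_true]
    rw [hz0]
    by_cases hiN : i = N + 2
    · subst hiN
      rw [if_pos (Or.inr rfl), hzN]
      push_cast
      have : (0 : ℤ) < m * k := by exact_mod_cast hmk
      nlinarith
    · rw [if_neg (by tauto)]
      have := supNorm_nonneg (segmentSite N x y (min (i - 1) N) - x)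
      push_cast
      have : (0 : ℤ) < m * k := by exact_mod_cast hmk
      nlinarith
  · intro i hi
    simp only [or_true, if_true]
    rw [hzN]
    by_cases hi0 : i = 0
    · subst hi0
      rw [if_pos (Or.inl rfl), hz0, hsym]
      push_cast
      have : (0 : ℤ) < m * k := by exact_mod_cast hmk
      nlinarith
    · rw [if_neg (by omega)]
      have := supNorm_nonneg (segmentSite N x y (min (i - 1) N) - y)
      push_cast
      have : (0 : ℤ) < m * k := by exact_mod_cast hmk
      nlinarith

/-! ### Bounds at small and at large distances -/

theorem toPlane_sub (x y : Site) : toPlane x - toPlane y = toPlane (x - y) := by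
  ext i
  fin_cases i <;> simp [toPlane]

theorem wiredOneArm_nonneg (r : ℝ) : 0 ≤ wiredOneArm r := fkProb_nonneg pC_nonneg pC_lt_one _ _ _

theorem wiredOneArm_le_one (r : ℝ) : wiredOneArm r ≤ 1 := fkProb_le_one pC_nonneg pC_lt_one _ _ _

theorem box_mem_connectedTo {n : ℕ} {v : Site} (hv : v ∈ box n) :
    ((bondsIn (box n) : Finset Bond) : Set Bond) ∈ connectedTo 0 {v} := by
  refine ⟨v, by simp, ?_⟩
  obtain ⟨p, hp⟩ := exists_walk_rect 0 v
  have hp' : ∀ w ∈ p.support, w ∈ box n := by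
    intro w hw
    have := hp w hw
    rw [mem_box, abs_le, abs_le] at hv ⊢
    simp only [Prod.fst_zero, Prod.snd_zero] at this
    omega
  clear hp hv
  generalize (0 : Site) = u at p
  induction p with
  | nil => exact SimpleGraph.Reachable.refl _
  | @cons a b c h p ih =>
    refine SimpleGraph.Reachable.trans (SimpleGraph.Adj.reachable (openGraph_adj.2 ⟨h, ?_⟩))
      (ih fun w hw => hp' w (by simp [hw]))
    rw [Finset.mem_coe, mem_bondsIn]
    intro w hw
    rcases Sym2.mem_iff.1 hw with rfl | rfl
    · exact hp' _ (by simp)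
    · exact hp' _ (by simp)

/-- A lower bound at bounded distances. -/
theorem twoPoint_lower_bound_near (hpos : 0 < pC) {μ : Measure SpinConfig}
    (hμ : IsIsingState betaC μ) (R : ℕ) :
    ∃ K : ℝ, 0 < K ∧ ∀ x y : Site, y - x ∈ box R → K ≤ twoPoint μ x y := by
  -- Only finitely many displacements occur; the least connection probability in the box of size `R`
  -- is positive and survives translation into larger boxes.
  obtain ⟨v₀, hv₀, hmin⟩ := Finset.exists_min_image (box R)
    (fun v => fkProb pC (box R) ∅ (connectedTo 0 {v})) ⟨0, by simp [mem_box]⟩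
  refine ⟨_, fkProb_pos hpos pC_lt_one (box R) ∅ (box_mem_connectedTo hv₀), fun x y hxy => ?_⟩
  refine ge_of_tendsto (tendsto_fkProb_twoPoint hμ x y) ?_
  filter_upwards [eventually_ge_atTop (R + x.1.natAbs + x.2.natAbs)] with n hn
  refine (hmin _ hxy).trans ((fkProb_box_le_shift pC_nonneg pC_lt_one (z := x) ?_ ?_
    (isUpperSet_connectedTo 0 {y - x})).trans (fkProb_mono pC_nonneg pC_lt_one _ _
      fun F _ hF => shiftEvent_connectedTo_subset x y hF))
  · rw [Int.abs_eq_natAbs]; omega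
  · rw [Int.abs_eq_natAbs]; omega

/-- The lower bound at large distances. -/
theorem twoPoint_lower_bound_far {μ : Measure SpinConfig} (hμ : IsIsingState betaC μ)
    {c : ℝ} {m k₀ : ℕ} {A : ℕ → Set BondConfig} (hc : 0 < c) (hm : 1 ≤ m)
    (hup : ∀ k, IsUpperSet (A k))
    (hA : ∀ k ≥ k₀, (∀ᶠ n : ℕ in atTop, c ≤ fkProb pC (box n) ∅ (A k)) ∧
      (∀ ω ∈ A k, ∃ C, IsRing ω 0 k (m * k : ℕ) C) ∧
      ∀ M : ℕ, m * k ≤ M → ∀ ω ∈ A k, Shielded M k ω)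
    {x y : Site} {k : ℕ} (hk : 2 ≤ k) (hkk : k₀ ≤ k) {r : ℝ}
    (hr : ‖toPlane x - toPlane y‖ / 3 = r) (h1 : 16 * m ^ 3 * k ≤ r)
    (h2 : r ≤ 32 * m ^ 3 * k) :
    c ^ (192 * m ^ 3 + 5) * wiredOneArm r ^ 2 ≤ twoPoint μ x y := by
  have hp0 := pC_nonneg
  have hp := pC_lt_one
  have hmk : 0 < m * k := by positivity
  have hkm2 : k ≤ 2 * m * k := by nlinarith
  have hkm4 : k ≤ 4 * m * m * k := by nlinarith
  -- Chosen so that `2 * supNorm (y - x) ≤ 6 r ≤ 6 * 32 m³ k = N k`.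
  set N := 192 * m ^ 3 with hN
  have hNpos : 0 < N := by positivity
  have hnorm : ‖toPlane x - toPlane y‖ = 3 * r := by linarith
  have hs1 : (supNorm (y - x) : ℝ) ≤ 3 * r := by
    rw [← hnorm, toPlane_sub, supNorm_sub_comm]
    exact supNorm_le_norm_toPlane _
  have hs2 : 3 * r ≤ 2 * supNorm (y - x) := by
    rw [← hnorm, toPlane_sub, supNorm_sub_comm]
    exact norm_toPlane_le _
  have hmR : (1 : ℝ) ≤ m := by exact_mod_cast hm
  have hkR : (2 : ℝ) ≤ k := by exact_mod_cast hk
  have hd : 2 * supNorm (y - x) ≤ N * k := by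
    have : (2 * supNorm (y - x) : ℝ) ≤ N * k := by
      rw [hN]
      push_cast
      linarith
    exact_mod_cast this
  have hd' : 2 * (m : ℤ) * m * k ≤ supNorm (y - x) := by
    have h3 : (m : ℝ) ^ 2 * k ≤ m ^ 3 * k := by
      refine mul_le_mul_of_nonneg_right (pow_le_pow_right₀ hmR (by norm_num)) (by positivity)
    have : (2 * m * m * k : ℝ) ≤ supNorm (y - x) := by
      have : 0 ≤ (m : ℝ) ^ 2 * k := by positivity
      linarith
    exact_mod_cast this
  -- the arm events
  have harm : ∀ z : Site, ∀ᶠ n : ℕ in atTop,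
      wiredOneArm r * c ≤ fkProb pC (box n) ∅ (shiftEvent z (armEvent ((4 * m * m * k : ℕ) : ℤ))) := by
    intro z
    refine eventually_le_shiftEvent hp0 hp (isUpperSet_armEvent _) ?_ z
    have hk4 := hA (4 * m * m * k) (hkk.trans hkm4)
    -- The shielding circuit of scale `4 m² k` fits into the box of size `4 m³ k`, whose points have
    -- Euclidean norm at most `8 m³ k ≤ r`.
    have hdisc : box (m * (4 * m * m * k)) ⊆ disc r := by
      intro v hv
      rw [mem_disc]
      refine (norm_toPlane_le v).trans ?_
      rw [mem_box] at hv
      have h3 : supNorm v ≤ ((m * (4 * m * m * k) : ℕ) : ℤ) := max_le hv.1 hv.2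
      have h4 : (supNorm v : ℝ) ≤ ((m * (4 * m * m * k) : ℕ) : ℝ) := by exact_mod_cast h3
      push_cast at h4
      have : 0 ≤ (m : ℝ) ^ 3 * k := by positivity
      nlinarith
    filter_upwards [hk4.1, eventually_ge_atTop (m * (4 * m * m * k))] with n hn hMn
    refine le_trans ?_ (fkProb_armEvent_ge hp0 hp (M := m * (4 * m * m * k))
      (k := ((4 * m * m * k : ℕ) : ℤ)) (by exact_mod_cast (by nlinarith)) hMn hdisc)
    refine mul_le_mul_of_nonneg_left ?_ (wiredOneArm_nonneg r)
    exact hn.trans (fkProb_mono hp0 hp _ _ fun F _ hF => hk4.2.2 _ le_rfl _ hF)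
  -- the ring events
  let B : ℕ → Set BondConfig := fun i => shiftEvent (segmentSite N x y (min (i - 1) N))
    (A (if i = 0 ∨ i = N + 2 then 2 * m * k else k))
  have hscale : ∀ i, k₀ ≤ if i = 0 ∨ i = N + 2 then 2 * m * k else k := by
    intro i
    split_ifs
    exacts [hkk.trans hkm2, hkk]
  have hring : ∀ i, ∀ ω ∈ B i, ∃ C, IsRing ω (segmentSite N x y (min (i - 1) N))
      ((if i = 0 ∨ i = N + 2 then 2 * m * k else k : ℕ) : ℤ)
      ((m * (if i = 0 ∨ i = N + 2 then 2 * m * k else k) : ℕ) : ℤ) C := by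
    intro i ω hω
    obtain ⟨C, hC⟩ := (hA _ (hscale i)).2.1 _ hω
    exact ⟨_, hC.shift⟩
  have hBup : ∀ i, IsUpperSet (B i) := fun i => IsUpperSet.shiftEvent (hup _) _
  have hBprob : ∀ᶠ n : ℕ in atTop, ∀ i ∈ Finset.range (N + 3), c ≤ fkProb pC (box n) ∅ (B i) :=
    (Finset.eventually_all _).2 fun i _ =>
      eventually_le_shiftEvent hp0 hp (hup _) (hA _ (hscale i)).1 _
  refine ge_of_tendsto (tendsto_fkProb_twoPoint hμ x y) ?_
  filter_upwards [hBprob, harm x, harm y] with n hB hx hy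
  have hrings : c ^ (N + 3) ≤ fkProb pC (box n) ∅ (⋂ i ∈ Finset.range (N + 3), B i) :=
    fkProb_biInter hp0 hp (by simp) hBup hc.le hB
  have hW := wiredOneArm_nonneg r
  have harms := (mul_le_mul hx hy (mul_nonneg hW hc.le) (fkProb_nonneg hp0 hp _ _ _)).trans
    (fkProb_inter hp0 hp (by simp) (IsUpperSet.shiftEvent (isUpperSet_armEvent _) x)
      (IsUpperSet.shiftEvent (isUpperSet_armEvent _) y))
  have hall := (mul_le_mul hrings harms
    (mul_nonneg (mul_nonneg hW hc.le) (mul_nonneg hW hc.le)) (fkProb_nonneg hp0 hp _ _ _)).trans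
    (fkProb_inter hp0 hp (by simp) (isUpperSet_iInter₂ fun i _ => hBup i)
      ((IsUpperSet.shiftEvent (isUpperSet_armEvent _) x).inter
        (IsUpperSet.shiftEvent (isUpperSet_armEvent _) y)))
  -- `N + 3` factors `c` come from the rings and two from the circuits that shield the arms.
  have heq : c ^ (N + 5) * wiredOneArm r ^ 2 =
      c ^ (N + 3) * (wiredOneArm r * c * (wiredOneArm r * c)) := by ring
  rw [heq]
  refine hall.trans (fkProb_mono hp0 hp _ _ ?_)
  rintro F - ⟨h3, h4, h5⟩
  refine ⟨y, by simp, connected_of_rings hNpos hm hk hd hd' (fun i hi => hring i _ ?_) h4 h5⟩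
  exact Set.mem_iInter₂.1 h3 i (Finset.mem_range.2 hi)

theorem exists_lower_bound (μ : Measure SpinConfig)
    (hμ : IsIsingState betaC μ)
    (P : Measure BondConfig)
    (hP : IsFKMeasure pC P)
    (hRSW : RSWLowerBound P) :
    ∃ K : ℝ, 0 < K ∧ ∀ x y : Site,
      K * wiredOneArm (‖toPlane x - toPlane y‖ / 3) ^ 2 ≤
        twoPoint μ x y := by
  obtain ⟨c, m, k₀, A, hc, hm, hup, hempty, hA⟩ := exists_ring_events hP hRSW
  -- At `pC = 0` the ring events would have probability `0`, against the RSW bound.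
  have hpos : 0 < pC := by
    refine pC_nonneg.lt_of_ne fun h0 => ?_
    obtain ⟨n, hn⟩ := (hA k₀ le_rfl).1.exists
    rw [← h0, fkProb_zero (hempty k₀)] at hn
    linarith
  set k₁ := max k₀ 2 with hk₁
  obtain ⟨K₀, hK₀, hnear⟩ := twoPoint_lower_bound_near hpos hμ (48 * m ^ 3 * k₁)
  refine ⟨min K₀ (c ^ (192 * m ^ 3 + 5)), lt_min hK₀ (by positivity), fun x y => ?_⟩
  obtain ⟨r, hr⟩ : ∃ r, ‖toPlane x - toPlane y‖ / 3 = r := ⟨_, rfl⟩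
  rw [hr]
  have hW0 := wiredOneArm_nonneg r
  have hW1 := wiredOneArm_le_one r
  have hr0 : 0 ≤ r := by rw [← hr]; positivity
  have hmR : (0 : ℝ) < 16 * m ^ 3 := by
    have : (0 : ℝ) < m := by exact_mod_cast hm
    positivity
  by_cases hfar : (16 * m ^ 3 * k₁ : ℝ) ≤ r
  -- The scale is this floor; as it is at least `1`, rounding loses at most a factor `2`, whence the
  -- window from `16 m³ k` to `32 m³ k`.
  · have hk : k₁ ≤ ⌊r / (16 * m ^ 3)⌋₊ := by
      refine Nat.le_floor ?_
      rw [le_div_iff₀ hmR]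
      linarith
    have h1 := Nat.floor_le (div_nonneg hr0 hmR.le)
    have h2 := Nat.lt_floor_add_one (r / (16 * m ^ 3))
    set k := ⌊r / (16 * m ^ 3)⌋₊
    have hk2 : 2 ≤ k := (le_max_right _ _).trans hk
    have hkR : (2 : ℝ) ≤ k := by exact_mod_cast hk2
    rw [le_div_iff₀ hmR] at h1
    rw [div_lt_iff₀ hmR] at h2
    refine le_trans (mul_le_mul_of_nonneg_right (min_le_right _ _) (pow_nonneg hW0 2))
      (twoPoint_lower_bound_far hμ hc hm hup hA hk2 ((le_max_left _ _).trans hk) hr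
        (by linarith) (by nlinarith))
  -- Here the distance is `3 r < 3 * 16 m³ k₁`, and the one-arm probability is bounded by `1`.
  · have hbox : y - x ∈ box (48 * m ^ 3 * k₁) := by
      have h3 : (supNorm (y - x) : ℝ) ≤ 3 * r := by
        rw [← hr, toPlane_sub, supNorm_sub_comm, mul_div_cancel₀ _ (by norm_num)]
        exact supNorm_le_norm_toPlane _
      have h4 : (supNorm (y - x) : ℝ) ≤ ((48 * m ^ 3 * k₁ : ℕ) : ℝ) := by
        push_cast
        push Not at hfar
        linarith
      have h5 : supNorm (y - x) ≤ ((48 * m ^ 3 * k₁ : ℕ) : ℤ) := by exact_mod_cast h4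
      rw [mem_box]
      exact ⟨(le_max_left _ _).trans h5, (le_max_right _ _).trans h5⟩
    calc min K₀ (c ^ (192 * m ^ 3 + 5)) * wiredOneArm r ^ 2 ≤ K₀ * 1 := by
          refine mul_le_mul (min_le_left _ _) (pow_le_one₀ hW0 hW1) (pow_nonneg hW0 2) hK₀.le
      _ ≤ twoPoint μ x y := by rw [mul_one]; exact hnear x y hbox

end FKIsing

theorem lemma2 (μ : MeasureTheory.Measure FKIsing.SpinConfig)
    (hμ : FKIsing.IsIsingState FKIsing.betaC μ)
    (P : MeasureTheory.Measure FKIsing.BondConfig)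
    (hP : FKIsing.IsFKMeasure FKIsing.pC P)
    (hRSW : FKIsing.RSWLowerBound P) :
    ∃ K : ℝ, 0 < K ∧ ∀ x y : FKIsing.Site,
      K * FKIsing.wiredOneArm (‖FKIsing.toPlane x - FKIsing.toPlane y‖ / 3) ^ 2 ≤
        FKIsing.twoPoint μ x y :=
  FKIsing.exists_lower_bound μ hμ P hP hRSW
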